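/- Let $n\ge 2$, $T>0$, and let $\Omega\subset\mathbb{R}^n$ be a nonempty open set (not necessarily bounded). Write $\mathcal S^n_0$ for the space of symmetric trace-free real $n\times n$ matrices. For $(v,u)\in\mathbb{R}^n\times\mathcal S^n_0$ let $e(v,u)=\frac n2\lambda_{\max}(v\otimes v-u)$, where $\lambda_{\max}$ is the largest eigenvalue. Denote by $C([0,T];L^2_w)$ the set of $v$ with $v(\cdot,t)\in L^2(\mathbb{R}^n;\mathbb{R}^n)$ for all $t\in[0,T]$ and $t\mapsto\int v(x,t)\cdot\varphi(x)\,dx$ continuous on $[0,T]$ for every $\varphi\in L^2(\mathbb{R}^n;\mathbb{R}^n)$. Let $\bar e\in C(\overline\Omega\times\,]0,T[)\cap C([0,T];L^1(\Omega))$. Assume that there are smooth $v_0:\mathbb{R}^n\times\,]0,T[\,\to\mathbb{R}^n$, $u_0:\mathbb{R}^n\times\,]0,T[\,\to\mathcal S^n_0$, $q_0:\mathbb{R}^n\times\,]0,T[\,\to\mathbb{R}$ solving $$\partial_t v_0+\operatorname{div}u_0+\nabla q_0=0,\qquad \operatorname{div}v_0=0\qquad\text{on }\mathbb{R}^n\times\,]0,T[,$$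 such that $v_0$ (extended to $t=0,T$) belongs to $C([0,T];L^2_w)$; for every $t\in\,]0,T[$ the support of $(v_0(\cdot,t),u_0(\cdot,t))$ is a compact subset of $\Omega$; and $e(v_0(x,t),u_0(x,t))<\bar e(x,t)$ for all $(x,t)\in\Omega\times\,]0,T[$. Then there exist infinitely many (pairwise distinct as elements of $C([0,T];L^2_w)$) weak solutions $v$ of the incompressible Euler equations $$\partial_tv+\operatorname{div}(v\otimes v)+\nabla p=0,\qquad \operatorname{div}v=0$$ in $\mathbb{R}^n\times[0,T[$ with initial datum $v_0(\cdot,0)$ and pressure $p=q_0-\frac1n|v|^2$, such that $v\in C([0,T];L^2_w)$; $v(x,t)=v_0(x,t)$ for $t=0,T$ and a.e. $x\in\mathbb{R}^n$; and $$\tfrac12|v(x,t)|^2=\bar e(x,t)\,\mathbf 1_\Omega(x)\qquad\text{for every }t\in\,]0,T[\text{ and a.e. }x\in\mathbb{R}^n.$$ Here "weak solution with initial datum $v^0$" means that $v\in L^2_{loc}(\mathbb{R}^n\times[0,T[)$, that $v(\cdot,t)$ is weakly divergence-free for a.e. $t\in\,]0,T[$, and that $$\int_0^T\!\!\int_{\mathbb{R}^n}\bigl[v\cdot\partial_t\varphi+\langle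 v\otimes v,\nabla\varphi\rangle\bigr]dx\,dt+\int_{\mathbb{R}^n}v^0(x)\cdot\varphi(x,0)\,dx=0$$ for all $\varphi\in C_c^\infty(\mathbb{R}^n\times[0,T[;\mathbb{R}^n)$ with $\operatorname{div}\varphi=0$; "with pressure $p$" means that $p\in L^1_{loc}(\mathbb{R}^n\times\,]0,T[)$ and the first equation holds in the sense of distributions on $\mathbb{R}^n\times\,]0,T[$. -/

import Mathlib

open Set Filter Topology MeasureTheory
open scoped ContDiff

noncomputable section

namespace Euler

/-- The Euclidean space `ℝⁿ`. -/
abbrev Rn (n : ℕ) := EuclideanSpace ℝ (Fin n)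

/-- The `j`-th standard basis vector of `ℝⁿ`. -/
def basisVec {n : ℕ} (j : Fin n) : Rn n := EuclideanSpace.single j 1

/-! ### Algebra: tensor product, largest eigenvalue, generalized energy density -/

/-- `v ⊗ v`, the matrix with entries `vᵢ vⱼ`. -/
def tensorSq {n : ℕ} (v : Rn n) : Matrix (Fin n) (Fin n) ℝ :=
  Matrix.of fun i j => v i * v j

/-- The largest (real) eigenvalue of a matrix.  It is only used for symmetric matrices of
positive size, where the spectrum is a finite nonempty set of real eigenvalues. -/
def lambdaMax {n : ℕ} (w : Matrix (Fin n) (Fin n) ℝ) : ℝ := sSup (spectrum ℝ w)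

/-- The generalized energy density `e(v,u) = (n/2) λ_max(v ⊗ v - u)`. -/
def genEnergy {n : ℕ} (v : Rn n) (u : Matrix (Fin n) (Fin n) ℝ) : ℝ :=
  (n : ℝ) / 2 * lambdaMax (tensorSq v - u)

/-! ### Function spaces -/

/-- `f ∈ C([0,T]; L¹(Ω))`. -/
structure ContinuousInL1 {n : ℕ} (T : ℝ) (Ω : Set (Rn n)) (f : Rn n → ℝ → ℝ) : Prop where
  integrable : ∀ t ∈ Icc 0 T, IntegrableOn (fun x => f x t) Ω
  continuous : ∀ t₀ ∈ Icc 0 T,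
    Tendsto (fun t => ∫ x in Ω, |f x t - f x t₀|) (𝓝[Icc 0 T] t₀) (𝓝 0)

/-- `v ∈ C([0,T]; L²_w(ℝⁿ))`: every time slice is square integrable, and
`t ↦ ∫ v(x,t) · φ(x) dx` is continuous on `[0,T]` for every `φ ∈ L²(ℝⁿ; ℝⁿ)`. -/
structure ContinuousInL2w {n : ℕ} (T : ℝ) (v : Rn n → ℝ → Rn n) : Prop where
  memLp : ∀ t ∈ Icc 0 T, MemLp (fun x => v x t) 2 volume
  continuous : ∀ φ : Rn n → Rn n, MemLp φ 2 volume →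
    ContinuousOn (fun t => ∫ x, inner ℝ (v x t) (φ x)) (Icc 0 T)

/-- Smoothness of a function of `(x,t)` on the open slab `ℝⁿ × ]0,T[`. -/
def SmoothOnSlab {n : ℕ} {F : Type*} [NormedAddCommGroup F] [NormedSpace ℝ F]
    (T : ℝ) (f : Rn n → ℝ → F) : Prop :=
  ContDiffOn ℝ ∞ (fun p : Rn n × ℝ => f p.1 p.2) (univ ×ˢ Ioo 0 T)

/-! ### The linear system -/

/-- `(v,u,q)` is a smooth solution, on `ℝⁿ × ]0,T[`, of
`∂ₜ v + div u + ∇ q = 0`, `div v = 0`, where `u` takes values in the symmetric trace-free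
matrices. -/
structure IsSmoothLinearSolution {n : ℕ} (T : ℝ) (v : Rn n → ℝ → Rn n)
    (u : Rn n → ℝ → Matrix (Fin n) (Fin n) ℝ) (q : Rn n → ℝ → ℝ) : Prop where
  smooth_v : SmoothOnSlab T v
  smooth_u : ∀ i j, SmoothOnSlab T fun x t => u x t i j
  smooth_q : SmoothOnSlab T q
  symm : ∀ x, ∀ t ∈ Ioo 0 T, (u x t).IsSymm
  traceless : ∀ x, ∀ t ∈ Ioo 0 T, (u x t).trace = 0
  momentum : ∀ x, ∀ t ∈ Ioo 0 T, ∀ i : Fin n,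
    deriv (fun s => v x s i) t + (∑ j, fderiv ℝ (fun y => u y t i j) x (basisVec j))
      + fderiv ℝ (fun y => q y t) x (basisVec i) = 0
  div_free : ∀ x, ∀ t ∈ Ioo 0 T, ∑ i, fderiv ℝ (fun y => v y t i) x (basisVec i) = 0

/-! ### Weak solutions of the Euler equations -/

/-- `w` is weakly divergence-free on `ℝⁿ`: `∫ w · ∇φ = 0` for all `φ ∈ C_c^∞(ℝⁿ)`. -/
def WeaklyDivFree {n : ℕ} (w : Rn n → Rn n) : Prop :=
  ∀ φ : Rn n → ℝ, ContDiff ℝ ∞ φ → HasCompactSupport φ → ∫ x, fderiv ℝ φ x (w x) = 0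

/-- The spatial divergence of a space-time vector field. -/
def divX {n : ℕ} (φ : Rn n × ℝ → Rn n) (p : Rn n × ℝ) : ℝ :=
  ∑ i, fderiv ℝ φ p (basisVec i, 0) i

/-- The density `v · ∂ₜφ + ⟨v ⊗ v, ∇φ⟩`, where
`⟨v ⊗ v, ∇φ⟩ = ∑ᵢⱼ vᵢ vⱼ ∂ⱼφᵢ = v · (Dₓφ v)`. -/
def momentumDensity {n : ℕ} (v : Rn n → ℝ → Rn n) (φ : Rn n × ℝ → Rn n) (p : Rn n × ℝ) : ℝ :=
  inner ℝ (v p.1 p.2) (fderiv ℝ φ p (0, 1))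
    + inner ℝ (v p.1 p.2) (fderiv ℝ φ p (v p.1 p.2, 0))

/-- `v` is a weak solution of the incompressible Euler equations on `ℝⁿ × [0,T[` with initial
datum `v⁰`.  Test fields in `C_c^∞(ℝⁿ × [0,T[; ℝⁿ)` are the restrictions to `t ≥ 0` of smooth
compactly supported fields on `ℝⁿ × ℝ` whose support lies in `{t < T}`. -/
structure IsWeakSolution {n : ℕ} (T : ℝ) (v₀ : Rn n → Rn n) (v : Rn n → ℝ → Rn n) : Prop where
  locL2 : ∀ K : Set (Rn n × ℝ), IsCompact K → K ⊆ univ ×ˢ Ico 0 T →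
    MemLp (fun p : Rn n × ℝ => v p.1 p.2) 2 (volume.restrict K)
  div_free : ∀ᵐ t ∂(volume.restrict (Ioo 0 T)), WeaklyDivFree fun x => v x t
  momentum : ∀ φ : Rn n × ℝ → Rn n, ContDiff ℝ ∞ φ → HasCompactSupport φ →
    tsupport φ ⊆ univ ×ˢ Iio T → (∀ x, ∀ t ∈ Ico 0 T, divX φ (x, t) = 0) →
    (∫ p in univ ×ˢ Ioo 0 T, momentumDensity v φ p) + ∫ x, inner ℝ (v₀ x) (φ (x, 0)) = 0

/-- `p` is a pressure for `v`: it is locally integrable on `ℝⁿ × ]0,T[` and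
`∂ₜ v + div (v ⊗ v) + ∇ p = 0` in the sense of distributions on `ℝⁿ × ]0,T[`. -/
structure HasPressure {n : ℕ} (T : ℝ) (v : Rn n → ℝ → Rn n) (p : Rn n → ℝ → ℝ) : Prop where
  locInt : LocallyIntegrableOn (fun z : Rn n × ℝ => p z.1 z.2) (univ ×ˢ Ioo 0 T)
  momentum : ∀ φ : Rn n × ℝ → Rn n, ContDiff ℝ ∞ φ → HasCompactSupport φ →
    tsupport φ ⊆ univ ×ˢ Ioo 0 T →
    ∫ z in univ ×ˢ Ioo 0 T, (momentumDensity v φ z + p z.1 z.2 * divX φ z) = 0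

end Euler

end

open scoped ContDiff

noncomputable section

namespace Euler


/-! This is convex integration in the manner of De Lellis and Székelyhidi, carried out as an
explicit iteration instead of a Baire category argument. Euler is split into the linear system ∂ₜv +
div u + ∇q = 0, div v = 0 and the pointwise constraint u = v⊗v − (|v|²/n)I. The defect is the matrix
M = (2ē/n)I − v⊗v + u (`gapMat`), which is positive definite on Ω × ]0,T[ exactly for strict
subsolutions and has trace 2ē − |v|². Entries of a positive semidefinite matrix are bounded by its
trace (`abs_entry_le_trace`), so once |v|² reaches 2ē the whole of M vanishes and the nonlinear
constraint holds, with pressure q₀ − |v|²/n. It therefore suffices to raise the energy to ē while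
staying among subsolutions.

The engine is `Subsolution.exists_perturbation`. At a point, take the column of M with a large
diagonal entry and normalise it to a unit vector a; Cauchy–Schwarz gives M ≥ M_jj a⊗a. Write v =
(v·a)a + κb with b a unit vector orthogonal to a, and add a plane wave α a with phase b·x − κt and
stress κα(a⊗b + b⊗a). The b-component of v then drops out of the change of v⊗v − u, which is
(2α(v·a) + α²) a⊗a; this is absorbed by M when α is a small multiple of M_jj/√(2ē). The wave is
localized by a third-order potential (`isSmoothLinearSolution_wave`), so it solves the linear system
exactly, with errors O(1/N) at frequency N. Finitely many waves with bounded overlap and distinct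
frequencies cover a given compact set. Their energy is half the squared amplitudes up to O(1/N),
which is at least a fixed fraction of ∫(2ē − |v|²)²/(2ē), and they are weakly small uniformly in
time.

In the iteration each increment is almost orthogonal, at every time, to all earlier velocities. The
energies are bounded, so for each fixed t the sequence is Cauchy in L² and the gap integral tends to
0 (`cauchySeq_of_almost_orthogonal`); the limit has energy ē for every t in ]0,T[. The convergence
is only pointwise in t. A jointly measurable limit is selected by `exists_measurable_limit`, and the
weak formulation is passed to the limit by dominated convergence in t. Tested against smooth fields,
the differences v − v₀ are uniformly Lipschitz in time; this gives weak continuity, and the boundary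
values are those of v₀ because each perturbation is supported in a compact subset of Ω × ]0,T[.

For multiplicity, perturb v₀ once to some v different from it at time T/2. By concavity of the gap
form, every v₀ + 2⁻ⁱ(v − v₀) is again a strict subsolution. Running the iteration from each one,
with small error against g = v − v₀, yields limits whose pairings with g at T/2 are pairwise
different. -/

/-- The quadratic form `∑ Mᵢⱼ yᵢ yⱼ`. -/
def quad {n : ℕ} (M : Matrix (Fin n) (Fin n) ℝ) (y : Rn n) : ℝ :=
  ∑ i, ∑ j, M i j * y i * y j

/-- The matrix `(2e/n) I - v ⊗ v + u`, whose positivity is the strict subsolution condition. -/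
def gapMat {n : ℕ} (e : ℝ) (v : Rn n) (u : Matrix (Fin n) (Fin n) ℝ) :
    Matrix (Fin n) (Fin n) ℝ :=
  (2 * e / n) • (1 : Matrix (Fin n) (Fin n) ℝ) - tensorSq v + u

/-! ### Quadratic forms and the gap matrix. -/

section LinearAlgebra

variable {n : ℕ} {M : Matrix (Fin n) (Fin n) ℝ}

lemma gapMat_apply (e : ℝ) (v : Rn n) (u : Matrix (Fin n) (Fin n) ℝ) (i j : Fin n) :
    gapMat e v u i j = (if i = j then 2 * e / n else 0) - v i * v j + u i j := by
  simp [gapMat, tensorSq, Matrix.one_apply]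

lemma norm_sq_eq_sum (y : Rn n) : ‖y‖ ^ 2 = ∑ i, y i ^ 2 := by
  rw [EuclideanSpace.norm_sq_eq]; simp

lemma inner_eq_sum (v y : Rn n) : inner ℝ v y = ∑ i, v i * y i := by
  simp [PiLp.inner_apply, mul_comm]

lemma abs_apply_le_norm (v : Rn n) (i : Fin n) : |v i| ≤ ‖v‖ := by
  have := PiLp.norm_apply_le v i
  simpa using this

lemma quad_add_mat (M N : Matrix (Fin n) (Fin n) ℝ) (y : Rn n) :
    quad (M + N) y = quad M y + quad N y := by
  simp [quad, add_mul, Finset.sum_add_distrib]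

lemma quad_sub_mat (M N : Matrix (Fin n) (Fin n) ℝ) (y : Rn n) :
    quad (M - N) y = quad M y - quad N y := by
  simp [quad, sub_mul, Finset.sum_sub_distrib]

lemma quad_smul_mat (c : ℝ) (M : Matrix (Fin n) (Fin n) ℝ) (y : Rn n) :
    quad (c • M) y = c * quad M y := by
  simp [quad, Finset.mul_sum, mul_assoc]

lemma quad_one (y : Rn n) : quad (1 : Matrix (Fin n) (Fin n) ℝ) y = ‖y‖ ^ 2 := by
  rw [norm_sq_eq_sum]
  simp [quad, Matrix.one_apply, sq]

lemma quad_tensor (a b y : Rn n) :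
    quad (Matrix.of fun i j => a i * b j) y = inner ℝ a y * inner ℝ b y := by
  simp only [quad, inner_eq_sum, Finset.sum_mul_sum, Matrix.of_apply]
  exact Finset.sum_congr rfl fun i _ => Finset.sum_congr rfl fun j _ => by ring

lemma quad_tensorSq (v y : Rn n) : quad (tensorSq v) y = inner ℝ v y ^ 2 := by
  rw [tensorSq, quad_tensor, sq]

lemma quad_gapMat (e : ℝ) (v : Rn n) (u : Matrix (Fin n) (Fin n) ℝ) (y : Rn n) :
    quad (gapMat e v u) y = 2 * e / n * ‖y‖ ^ 2 - inner ℝ v y ^ 2 + quad u y := by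
  rw [gapMat, quad_add_mat, quad_sub_mat, quad_smul_mat, quad_one, quad_tensorSq]

lemma trace_gapMat (hn : 0 < n) (e : ℝ) (v : Rn n) {u : Matrix (Fin n) (Fin n) ℝ}
    (hu : u.trace = 0) : (gapMat e v u).trace = 2 * e - ‖v‖ ^ 2 := by
  have : (tensorSq v).trace = ‖v‖ ^ 2 := by
    rw [norm_sq_eq_sum]
    simp [Matrix.trace, tensorSq, sq]
  have hn' : (n : ℝ) ≠ 0 := by positivity
  simp only [gapMat, Matrix.trace_add, Matrix.trace_sub, Matrix.trace_smul, Matrix.trace_one,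
    this, hu, Fintype.card_fin, smul_eq_mul]
  field_simp
  ring

lemma gapMat_isSymm (e : ℝ) (v : Rn n) {u : Matrix (Fin n) (Fin n) ℝ} (hu : u.IsSymm) :
    (gapMat e v u).IsSymm := by
  ext i j
  have : u j i = u i j := hu.apply i j
  simp only [Matrix.transpose_apply, gapMat_apply, this, eq_comm (a := i), mul_comm]

lemma quad_smul (M : Matrix (Fin n) (Fin n) ℝ) (c : ℝ) (y : Rn n) :
    quad M (c • y) = c ^ 2 * quad M y := by
  simp only [quad, Finset.mul_sum, PiLp.smul_apply, smul_eq_mul]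
  exact Finset.sum_congr rfl fun i _ => Finset.sum_congr rfl fun j _ => by ring

lemma quad_zero (M : Matrix (Fin n) (Fin n) ℝ) : quad M 0 = 0 := by simp [quad]

lemma quad_add_basisVec (hM : M.IsSymm) (y : Rn n) (s : ℝ) (j : Fin n) :
    quad M (y + s • basisVec j) = quad M y + 2 * s * (∑ i, M i j * y i) + s ^ 2 * M j j := by
  have h1 : ∀ i, (y + s • basisVec j : Rn n) i = y i + if i = j then s else 0 := by
    intro i
    simp [basisVec]
  simp only [quad, h1, mul_add, add_mul, Finset.sum_add_distrib]
  have h2 : ∑ i, ∑ k, M i k * y i * (if k = j then s else 0) = s * ∑ i, M i j * y i := by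
    simp [Finset.mul_sum, mul_comm]
  have h3 : ∑ i, ∑ k, M i k * (if i = j then s else 0) * y k = s * ∑ i, M i j * y i := by
    rw [Finset.sum_comm]
    simp only [mul_ite, ite_mul, mul_zero, zero_mul, Finset.sum_ite_eq', Finset.mem_univ, if_true,
      Finset.mul_sum]
    refine Finset.sum_congr rfl fun i _ => ?_
    rw [hM.apply i j]; ring
  have h4 : ∑ i, ∑ k, M i k * (if i = j then s else 0) * (if k = j then s else 0)
      = s ^ 2 * M j j := by
    simp; ring
  rw [h2, h3, h4]; ring

lemma quad_basisVec (M : Matrix (Fin n) (Fin n) ℝ) (j : Fin n) :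
    quad M (basisVec j) = M j j := by
  simp [quad, basisVec]

/-- Cauchy–Schwarz for a positive semidefinite form, applied to a basis vector. -/
lemma sq_col_le (hM : M.IsSymm) (hpos : ∀ y, 0 ≤ quad M y) (y : Rn n) (j : Fin n) :
    (∑ i, M i j * y i) ^ 2 ≤ M j j * quad M y := by
  have h : ∀ s : ℝ, 0 ≤ M j j * (s * s) + 2 * (∑ i, M i j * y i) * s + quad M y := by
    intro s
    have := hpos (y + s • basisVec j)
    rw [quad_add_basisVec hM] at this
    linarith
  have := discrim_le_zero h
  rw [discrim] at this
  nlinarith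

lemma diag_nonneg (hpos : ∀ y, 0 ≤ quad M y) (j : Fin n) : 0 ≤ M j j := by
  simpa [quad_basisVec] using hpos (basisVec j)

lemma diag_le_trace (hpos : ∀ y, 0 ≤ quad M y) (j : Fin n) : M j j ≤ M.trace :=
  Finset.single_le_sum (f := fun i => M i i) (fun i _ => diag_nonneg hpos i) (Finset.mem_univ j)

lemma trace_nonneg (hpos : ∀ y, 0 ≤ quad M y) : 0 ≤ M.trace :=
  Finset.sum_nonneg fun i _ => diag_nonneg hpos i

/-- Cauchy–Schwarz gives M_ij² ≤ M_ii M_jj. This is what turns saturation of the energy (zero trace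
of the gap matrix) into the full nonlinear constraint. -/
lemma abs_entry_le_trace (hM : M.IsSymm) (hpos : ∀ y, 0 ≤ quad M y) (i j : Fin n) :
    |M i j| ≤ M.trace := by
  have h := sq_col_le hM hpos (basisVec i) j
  rw [quad_basisVec] at h
  have h1 : ∑ k, M k j * (basisVec i : Rn n) k = M i j := by
    simp [basisVec]
  rw [h1] at h
  refine abs_le_of_sq_le_sq (h.trans ?_) (trace_nonneg hpos)
  rw [sq]
  exact mul_le_mul (diag_le_trace hpos j) (diag_le_trace hpos i) (diag_nonneg hpos i)
    (trace_nonneg hpos)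

lemma exists_trace_le_diag (hn : 0 < n) (M : Matrix (Fin n) (Fin n) ℝ) :
    ∃ j, M.trace / n ≤ M j j := by
  have : (Finset.univ : Finset (Fin n)).Nonempty := ⟨⟨0, hn⟩, Finset.mem_univ _⟩
  have hn' : (n : ℝ) ≠ 0 := by positivity
  obtain ⟨j, -, hj⟩ := Finset.exists_le_of_sum_le (f := fun _ : Fin n => M.trace / n)
    (g := fun j => M j j) this (by
      simp only [Finset.sum_const, Finset.card_univ, Fintype.card_fin, nsmul_eq_mul]
      rw [mul_div_cancel₀ _ hn']; exact le_refl (Matrix.trace M))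
  exact ⟨j, hj⟩

/-- A symmetric matrix whose largest eigenvalue is `< r` satisfies `w < r I`. -/
lemma quad_lt_of_lambdaMax_lt {w : Matrix (Fin n) (Fin n) ℝ} (hw : w.IsSymm) {r : ℝ}
    (h : lambdaMax w < r) {y : Rn n} (hy : y ≠ 0) : quad w y < r * ‖y‖ ^ 2 := by
  have hA : (r • (1 : Matrix (Fin n) (Fin n) ℝ) - w).IsHermitian := by
    ext i j
    simp [Matrix.conjTranspose_apply, Matrix.one_apply, hw.apply i j, eq_comm]
  have hpd : (r • (1 : Matrix (Fin n) (Fin n) ℝ) - w).PosDef := by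
    rw [hA.posDef_iff_eigenvalues_pos]
    intro i
    have h1 := hA.eigenvalues_mem_spectrum_real i
    -- An eigenvalue μ of rI − w corresponds to the eigenvalue r − μ of w. The spectrum is finite,
    -- so the supremum defining `lambdaMax` bounds it.
    have h2 : r - hA.eigenvalues i ∈ spectrum ℝ w := by
      have h3 : hA.eigenvalues i ∈ spectrum ℝ (algebraMap ℝ (Matrix (Fin n) (Fin n) ℝ) r - w) := by
        rwa [Algebra.algebraMap_eq_smul_one]
      rw [← spectrum.singleton_sub_eq] at h3
      obtain ⟨r', hr', s, hs, hs'⟩ := h3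
      have hs' : r' - s = hA.eigenvalues i := hs'
      rw [mem_singleton_iff.mp hr'] at hs'
      rw [← hs']
      simpa using hs
    have h4 : r - hA.eigenvalues i ≤ lambdaMax w :=
      le_csSup (Matrix.finite_spectrum w).bddAbove h2
    linarith
  have hy' : (WithLp.ofLp y : Fin n → ℝ) ≠ 0 := by
    intro h0; apply hy; ext i; exact congrFun h0 i
  have h5 := hpd.dotProduct_mulVec_pos hy'
  have h6 : star (WithLp.ofLp y) ⬝ᵥ ((r • (1 : Matrix (Fin n) (Fin n) ℝ) - w).mulVec y.ofLp)
      = quad (r • 1 - w) y := by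
    simp only [quad, dotProduct, Matrix.mulVec, Finset.mul_sum, Pi.star_apply, star_trivial]
    exact Finset.sum_congr rfl fun i _ => Finset.sum_congr rfl fun j _ => by ring
  rw [h6, quad_sub_mat, quad_smul_mat, quad_one] at h5
  linarith

/-- The only place where eigenvalues enter: from here on the subsolution condition is positivity of
a quadratic form, which is easy to perturb. -/
lemma quad_gapMat_pos_of_genEnergy_lt (hn : 0 < n) {e : ℝ} {v : Rn n}
    {u : Matrix (Fin n) (Fin n) ℝ} (hu : u.IsSymm) (h : genEnergy v u < e) {y : Rn n}
    (hy : y ≠ 0) : 0 < quad (gapMat e v u) y := by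
  have hn' : (0 : ℝ) < n := by positivity
  have hs : (tensorSq v - u).IsSymm := by
    ext i j
    simp [tensorSq, hu.apply i j, mul_comm]
  have h1 : lambdaMax (tensorSq v - u) < 2 * e / n := by
    rw [genEnergy] at h
    rw [lt_div_iff₀ hn']
    linarith
  have h2 := quad_lt_of_lambdaMax_lt hs h1 hy
  rw [quad_sub_mat, quad_tensorSq] at h2
  rw [quad_gapMat]
  linarith

/-- Every vector is the sum of its component along a unit vector `a` and of a multiple of some unit
vector orthogonal to `a`. -/
lemma exists_orthonormal_decomp (hn : 2 ≤ n) (v a : Rn n) (ha : ‖a‖ = 1) :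
    ∃ (b : Rn n) (κ : ℝ), ‖b‖ = 1 ∧ inner ℝ a b = 0 ∧ v = (inner ℝ v a : ℝ) • a + κ • b := by
  set m := v - (inner ℝ v a : ℝ) • a with hm
  have ham : inner ℝ a m = 0 := by
    rw [hm, inner_sub_right, inner_smul_right, real_inner_self_eq_norm_sq, ha, real_inner_comm]
    ring
  by_cases h0 : m = 0
  -- If v is parallel to a, any unit vector orthogonal to a will do, with κ = 0; such a vector
  -- exists because n ≥ 2.
  · have hfin : (Submodule.span ℝ {a})ᗮ ≠ ⊥ := by
      intro h
      rw [Submodule.orthogonal_eq_bot_iff] at h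
      have h1 := finrank_span_singleton (K := ℝ) (v := a) (by rintro rfl; simp at ha)
      rw [h, finrank_top, finrank_euclideanSpace_fin] at h1
      omega
    obtain ⟨c, hc, hc0⟩ := Submodule.exists_mem_ne_zero_of_ne_bot hfin
    have hac : inner ℝ a c = 0 := by
      rw [Submodule.mem_orthogonal_singleton_iff_inner_right] at hc
      exact hc
    refine ⟨‖c‖⁻¹ • c, 0, norm_smul_inv_norm hc0, by rw [inner_smul_right, hac, mul_zero], ?_⟩
    rw [zero_smul, add_zero]
    exact sub_eq_zero.mp h0
  · refine ⟨‖m‖⁻¹ • m, ‖m‖, norm_smul_inv_norm h0, by rw [inner_smul_right, ham, mul_zero], ?_⟩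
    rw [smul_smul, mul_inv_cancel₀ (norm_ne_zero_iff.mpr h0), one_smul, hm]
    abel

end LinearAlgebra


/-! ### Directional derivatives of highly oscillating functions. -/

/-- The derivative of `g` in the constant direction `h`. -/
def dirD {V : Type*} [NormedAddCommGroup V] [NormedSpace ℝ V] (h : V) (g : V → ℝ) : V → ℝ :=
  fun z => fderiv ℝ g z h

lemma exists_bound_of_hasCompactSupport {X : Type*} [TopologicalSpace X] [Nonempty X] {g : X → ℝ}
    (hg : Continuous g) (hs : HasCompactSupport g) :
    ∃ C, 0 ≤ C ∧ ∀ z, |g z| ≤ C := by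
  obtain ⟨C, hC⟩ := hg.bounded_above_of_compact_support hs
  exact ⟨C, (norm_nonneg _).trans (hC (Classical.arbitrary X)), hC⟩

section DirectionalDerivative

variable {V : Type*} [NormedAddCommGroup V] [NormedSpace ℝ V] {g f : V → ℝ}

lemma contDiff_dirD (h : V) (hg : ContDiff ℝ ∞ g) : ContDiff ℝ ∞ (dirD h g) :=
  (hg.fderiv_right (m := ∞) (by simp)).clm_apply contDiff_const

lemma tsupport_dirD_subset (h : V) (g : V → ℝ) : tsupport (dirD h g) ⊆ tsupport g :=
  tsupport_fderiv_apply_subset ℝ h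

lemma dirD_comm (hg : ContDiff ℝ ∞ g) (h k : V) : dirD h (dirD k g) = dirD k (dirD h g) := by
  funext z
  have hd : DifferentiableAt ℝ (fderiv ℝ g) z :=
    ((hg.fderiv_right (m := ∞) (by simp)).differentiable (by simp)) z
  have h1 : ∀ a b : V, dirD a (dirD b g) z = fderiv ℝ (fderiv ℝ g) z a b := by
    intro a b
    change fderiv ℝ (fun y => fderiv ℝ g y b) z a = _
    rw [fderiv_clm_apply hd (differentiableAt_const b)]
    simp
  rw [h1, h1]
  exact (hg.contDiffAt.isSymmSndFDerivAt (by
    rw [minSmoothness_of_isRCLikeNormedField]; exact WithTop.coe_le_coe.mpr le_top)) h k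

lemma dirD_add (h : V) (hf : ContDiff ℝ ∞ f) (hg : ContDiff ℝ ∞ g) :
    dirD h (fun z => f z + g z) = fun z => dirD h f z + dirD h g z := by
  funext z
  simp only [dirD]
  rw [fderiv_fun_add (hf.differentiable (by simp) z) (hg.differentiable (by simp) z)]
  rfl

lemma dirD_sub (h : V) (hf : ContDiff ℝ ∞ f) (hg : ContDiff ℝ ∞ g) :
    dirD h (fun z => f z - g z) = fun z => dirD h f z - dirD h g z := by
  funext z
  simp only [dirD]
  rw [fderiv_fun_sub (hf.differentiable (by simp) z) (hg.differentiable (by simp) z)]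
  rfl

lemma dirD_const_mul (h : V) (c : ℝ) (hg : ContDiff ℝ ∞ g) :
    dirD h (fun z => c * g z) = fun z => c * dirD h g z := by
  funext z
  simp only [dirD]
  rw [fderiv_const_mul (hg.differentiable (by simp) z)]
  rfl

lemma dirD_mul_sin (h : V) (hg : ContDiff ℝ ∞ g) (ℓ : V →L[ℝ] ℝ) :
    dirD h (fun z => g z * Real.sin (ℓ z))
      = fun z => dirD h g z * Real.sin (ℓ z) + ℓ h * (g z * Real.cos (ℓ z)) := by
  funext z
  have h1 := ((hg.differentiable (by simp) z).hasFDerivAt).mul (ℓ.hasFDerivAt (x := z)).sin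
  simp only [dirD]
  erw [h1.fderiv]
  simp
  ring

lemma dirD_mul_cos (h : V) (hg : ContDiff ℝ ∞ g) (ℓ : V →L[ℝ] ℝ) :
    dirD h (fun z => g z * Real.cos (ℓ z))
      = fun z => dirD h g z * Real.cos (ℓ z) - ℓ h * (g z * Real.sin (ℓ z)) := by
  funext z
  have h1 := ((hg.differentiable (by simp) z).hasFDerivAt).mul (ℓ.hasFDerivAt (x := z)).cos
  simp only [dirD]
  erw [h1.fderiv]
  simp
  ring

lemma hasCompactSupport_dirD (h : V) (hs : HasCompactSupport g) : HasCompactSupport (dirD h g) :=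
  hs.of_isClosed_subset (isClosed_tsupport _) (tsupport_dirD_subset h g)

/-- Leading order of the third derivatives of a highly oscillating function. -/
lemma exists_third_deriv_bound (hg : ContDiff ℝ ∞ g) (hs : HasCompactSupport g) (ℓ : V →L[ℝ] ℝ)
    (h₁ h₂ h₃ : V) : ∃ C, 0 ≤ C ∧ ∀ N : ℝ, 1 ≤ N → ∀ z,
      |dirD h₁ (dirD h₂ (dirD h₃ (fun z => (-(N ^ 3)⁻¹ * g z) * Real.sin ((N • ℓ) z)))) z
        - ℓ h₁ * ℓ h₂ * ℓ h₃ * (g z * Real.cos ((N • ℓ) z))| ≤ C / N := by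
  have S : ∀ h, ContDiff ℝ ∞ (dirD h g) := fun h => contDiff_dirD h hg
  have S2 : ∀ h k, ContDiff ℝ ∞ (dirD h (dirD k g)) := fun h k => contDiff_dirD h (S k)
  have K : ∀ h, HasCompactSupport (dirD h g) := fun h => hasCompactSupport_dirD h hs
  have K2 : ∀ h k, HasCompactSupport (dirD h (dirD k g)) := fun h k =>
    hasCompactSupport_dirD h (K k)
  -- Leibniz expansion sorted by the number of derivatives that fall on the phase. The term with all
  -- three has been subtracted; the others carry at most N² against the prefactor N⁻³.
  have key : ∀ N : ℝ, N ≠ 0 → ∀ z,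
      dirD h₁ (dirD h₂ (dirD h₃ (fun z => (-(N ^ 3)⁻¹ * g z) * Real.sin ((N • ℓ) z)))) z
        - ℓ h₁ * ℓ h₂ * ℓ h₃ * (g z * Real.cos ((N • ℓ) z)) =
      -(N ^ 3)⁻¹ * (dirD h₁ (dirD h₂ (dirD h₃ g)) z * Real.sin ((N • ℓ) z)
        + N * ((ℓ h₁ * dirD h₂ (dirD h₃ g) z + ℓ h₂ * dirD h₁ (dirD h₃ g) z
          + ℓ h₃ * dirD h₁ (dirD h₂ g) z) * Real.cos ((N • ℓ) z))
        - N ^ 2 * ((ℓ h₁ * ℓ h₂ * dirD h₃ g z + ℓ h₁ * ℓ h₃ * dirD h₂ g z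
          + ℓ h₂ * ℓ h₃ * dirD h₁ g z) * Real.sin ((N • ℓ) z))) := by
    intro N hN z
    have cs : ContDiff ℝ ∞ fun z => Real.sin ((N • ℓ) z) :=
      Real.contDiff_sin.comp (N • ℓ).contDiff
    have cc : ContDiff ℝ ∞ fun z => Real.cos ((N • ℓ) z) :=
      Real.contDiff_cos.comp (N • ℓ).contDiff
    have e1 : dirD h₃ (fun z => (-(N ^ 3)⁻¹ * g z) * Real.sin ((N • ℓ) z))
        = fun z => -(N ^ 3)⁻¹ * (dirD h₃ g z * Real.sin ((N • ℓ) z)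
            + (N • ℓ) h₃ * (g z * Real.cos ((N • ℓ) z))) := by
      rw [dirD_mul_sin h₃ (contDiff_const.mul hg), dirD_const_mul h₃ _ hg]
      funext z; ring
    have e2 : dirD h₂ (dirD h₃ (fun z => (-(N ^ 3)⁻¹ * g z) * Real.sin ((N • ℓ) z)))
        = fun z => -(N ^ 3)⁻¹ * ((dirD h₂ (dirD h₃ g) z * Real.sin ((N • ℓ) z)
            + (N • ℓ) h₂ * (dirD h₃ g z * Real.cos ((N • ℓ) z)))
            + (N • ℓ) h₃ * (dirD h₂ g z * Real.cos ((N • ℓ) z)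
              - (N • ℓ) h₂ * (g z * Real.sin ((N • ℓ) z)))) := by
      rw [e1, dirD_const_mul h₂ _ (((S h₃).mul cs).add (contDiff_const.mul (hg.mul cc))),
        dirD_add h₂ ((S h₃).mul cs) (contDiff_const.mul (hg.mul cc)),
        dirD_const_mul h₂ _ (hg.mul cc), dirD_mul_sin h₂ (S h₃), dirD_mul_cos h₂ hg]
    rw [e2, dirD_const_mul h₁, dirD_add h₁, dirD_add h₁, dirD_const_mul h₁, dirD_const_mul h₁,
      dirD_sub h₁, dirD_const_mul h₁, dirD_mul_sin h₁ (S2 h₂ h₃), dirD_mul_cos h₁ (S h₃),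
      dirD_mul_cos h₁ (S h₂), dirD_mul_sin h₁ hg]
    · simp only [smul_apply, smul_eq_mul]
      field_simp
      ring
    all_goals
      have := S h₃; have := S h₂; have := S2 h₂ h₃
      fun_prop
  obtain ⟨C3, p3, b3⟩ := exists_bound_of_hasCompactSupport
    (contDiff_dirD h₁ (S2 h₂ h₃)).continuous (hasCompactSupport_dirD h₁ (K2 h₂ h₃))
  have c2 : ∀ c h k, ∃ C, 0 ≤ C ∧ ∀ z, |c * dirD h (dirD k g) z| ≤ C := by
    intro c h k
    exact exists_bound_of_hasCompactSupport (continuous_const.mul (S2 h k).continuous)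
      ((K2 h k).mul_left (f := fun _ => c))
  have c1 : ∀ c h, ∃ C, 0 ≤ C ∧ ∀ z, |c * dirD h g z| ≤ C := by
    intro c h
    exact exists_bound_of_hasCompactSupport (continuous_const.mul (S h).continuous)
      ((K h).mul_left (f := fun _ => c))
  obtain ⟨A1, pA1, bA1⟩ := c2 (ℓ h₁) h₂ h₃
  obtain ⟨A2, pA2, bA2⟩ := c2 (ℓ h₂) h₁ h₃
  obtain ⟨A3, pA3, bA3⟩ := c2 (ℓ h₃) h₁ h₂
  obtain ⟨B1, pB1, bB1⟩ := c1 (ℓ h₁ * ℓ h₂) h₃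
  obtain ⟨B2, pB2, bB2⟩ := c1 (ℓ h₁ * ℓ h₃) h₂
  obtain ⟨B3, pB3, bB3⟩ := c1 (ℓ h₂ * ℓ h₃) h₁
  refine ⟨C3 + (A1 + A2 + A3) + (B1 + B2 + B3), by positivity, fun N hN z => ?_⟩
  have hN0 : 0 < N := by linarith
  have trig : ∀ x y C : ℝ, |x| ≤ C → |y| ≤ 1 → |x * y| ≤ C := by
    intro x y C hx hy
    rw [abs_mul]
    nlinarith [abs_nonneg x, abs_nonneg y]
  have tri3 : ∀ x y w X Y W : ℝ, |x| ≤ X → |y| ≤ Y → |w| ≤ W → |x + y + w| ≤ X + Y + W :=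
    fun x y w X Y W hx hy hw =>
      (abs_add_le _ _).trans (add_le_add ((abs_add_le _ _).trans (add_le_add hx hy)) hw)
  have t1 := trig _ (Real.sin ((N • ℓ) z)) _ (b3 z) (Real.abs_sin_le_one _)
  have t2 := trig _ (Real.cos ((N • ℓ) z)) _ (tri3 _ _ _ _ _ _ (bA1 z) (bA2 z) (bA3 z))
    (Real.abs_cos_le_one _)
  have t3 := trig _ (Real.sin ((N • ℓ) z)) _ (tri3 _ _ _ _ _ _ (bB1 z) (bB2 z) (bB3 z))
    (Real.abs_sin_le_one _)
  rw [key N hN0.ne' z, abs_mul, abs_neg, abs_of_pos (by positivity : 0 < (N ^ 3)⁻¹)]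
  rw [inv_mul_le_iff₀ (by positivity)]
  have hN2 : N ≤ N ^ 2 := by nlinarith
  have hN1 : 1 ≤ N ^ 2 := by nlinarith
  have e : N ^ 3 * ((C3 + (A1 + A2 + A3) + (B1 + B2 + B3)) / N)
      = N ^ 2 * (C3 + (A1 + A2 + A3) + (B1 + B2 + B3)) := by
    field_simp
  rw [e]
  refine (abs_sub _ _).trans ?_
  refine (add_le_add_left (abs_add_le _ _) _).trans ?_
  rw [abs_mul N, abs_mul (N ^ 2), abs_of_pos hN0, abs_of_pos (by positivity : 0 < N ^ 2)]
  have s1 := mul_le_mul_of_nonneg_left t2 hN0.le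
  have s2 := mul_le_mul_of_nonneg_left t3 (by positivity : 0 ≤ N ^ 2)
  have s3 : N * (A1 + A2 + A3) ≤ N ^ 2 * (A1 + A2 + A3) :=
    mul_le_mul_of_nonneg_right hN2 (by positivity)
  have s4 : 1 * C3 ≤ N ^ 2 * C3 := mul_le_mul_of_nonneg_right hN1 p3
  linarith

end DirectionalDerivative


/-! ### Partial derivatives as space-time directional derivatives. -/

section Slices

variable {n : ℕ}

lemma fderiv_slice {F : Type*} [NormedAddCommGroup F] [NormedSpace ℝ F] {f : Rn n × ℝ → F}
    {x : Rn n} {t : ℝ} (hf : DifferentiableAt ℝ f (x, t)) (e : Rn n) :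
    fderiv ℝ (fun y => f (y, t)) x e = fderiv ℝ f (x, t) (e, 0) := by
  have h2 := (HasFDerivAt.comp (g := f) (f := fun y : Rn n => (y, t)) x hf.hasFDerivAt
    (hasFDerivAt_prodMk_left (𝕜 := ℝ) x t)).fderiv
  change fderiv ℝ (f ∘ fun y => (y, t)) x e = _
  rw [h2]
  simp

lemma hasDerivAt_slice {F : Type*} [NormedAddCommGroup F] [NormedSpace ℝ F] {f : Rn n × ℝ → F}
    {x : Rn n} {t : ℝ} (hf : DifferentiableAt ℝ f (x, t)) :
    HasDerivAt (fun s => f (x, s)) (fderiv ℝ f (x, t) (0, 1)) t := by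
  have := (hf.hasFDerivAt.comp t (hasFDerivAt_prodMk_right x t)).hasDerivAt
  exact this.congr_deriv (by simp)

lemma eq_sum_basisVec (c : Rn n) : c = ∑ j, c j • basisVec j := by
  ext i
  simp [basisVec, Pi.single_apply]

lemma sum_mul_fderiv_basisVec {F : Type*} [NormedAddCommGroup F] [NormedSpace ℝ F]
    (L : Rn n × ℝ →L[ℝ] F) (c : Rn n) :
    ∑ j, c j • L (basisVec j, 0) = L (c, 0) := by
  have : ((c, 0) : Rn n × ℝ) = ∑ j, c j • ((basisVec j, 0) : Rn n × ℝ) := by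
    conv_lhs => rw [eq_sum_basisVec c]
    ext1
    · simp [Prod.fst_sum]
    · simp [Prod.snd_sum]
  rw [this, map_sum]
  exact Finset.sum_congr rfl fun j _ => (map_smul L _ _).symm

end Slices

/-! ### Linearity of the system. -/

section LinearSystem

variable {n : ℕ} {T : ℝ} {v v' : Rn n → ℝ → Rn n} {u u' : Rn n → ℝ → Matrix (Fin n) (Fin n) ℝ}
  {q q' : Rn n → ℝ → ℝ}

lemma isOpen_slab (T : ℝ) : IsOpen ((univ : Set (Rn n)) ×ˢ Ioo 0 T) := isOpen_univ.prod isOpen_Ioo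

lemma SmoothOnSlab.contDiffAt {F : Type*} [NormedAddCommGroup F] [NormedSpace ℝ F]
    {f : Rn n → ℝ → F} (hf : SmoothOnSlab T f) (x : Rn n) {t : ℝ} (ht : t ∈ Ioo 0 T) :
    ContDiffAt ℝ ∞ (fun p : Rn n × ℝ => f p.1 p.2) (x, t) :=
  ContDiffOn.contDiffAt hf ((isOpen_slab T).mem_nhds ⟨mem_univ _, ht⟩)

lemma SmoothOnSlab.differentiableAt {F : Type*} [NormedAddCommGroup F] [NormedSpace ℝ F]
    {f : Rn n → ℝ → F} (hf : SmoothOnSlab T f) (x : Rn n) {t : ℝ} (ht : t ∈ Ioo 0 T) :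
    DifferentiableAt ℝ (fun p : Rn n × ℝ => f p.1 p.2) (x, t) :=
  (hf.contDiffAt x ht).differentiableAt (by simp)

lemma SmoothOnSlab.differentiableAt_left {F : Type*} [NormedAddCommGroup F] [NormedSpace ℝ F]
    {f : Rn n → ℝ → F} (hf : SmoothOnSlab T f) (x : Rn n) {t : ℝ} (ht : t ∈ Ioo 0 T) :
    DifferentiableAt ℝ (fun y => f y t) x :=
  DifferentiableAt.comp (f := fun y : Rn n => (y, t)) x (hf.differentiableAt x ht)
    (hasFDerivAt_prodMk_left x t).differentiableAt

lemma SmoothOnSlab.differentiableAt_right {F : Type*} [NormedAddCommGroup F] [NormedSpace ℝ F]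
    {f : Rn n → ℝ → F} (hf : SmoothOnSlab T f) (x : Rn n) {t : ℝ} (ht : t ∈ Ioo 0 T) :
    DifferentiableAt ℝ (fun s => f x s) t :=
  (hasDerivAt_slice (hf.differentiableAt x ht)).differentiableAt

lemma SmoothOnSlab.coord {f : Rn n → ℝ → Rn n} (hf : SmoothOnSlab T f) (i : Fin n) :
    SmoothOnSlab T fun x t => f x t i :=
  (EuclideanSpace.proj (𝕜 := ℝ) i).contDiff.comp_contDiffOn hf

lemma IsSmoothLinearSolution.add_smul (h : IsSmoothLinearSolution T v u q)
    (h' : IsSmoothLinearSolution T v' u' q') (c : ℝ) :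
    IsSmoothLinearSolution T (fun x t => v x t + c • v' x t) (fun x t => u x t + c • u' x t)
      (fun x t => q x t + c * q' x t) where
  smooth_v := ContDiffOn.add h.smooth_v (ContDiffOn.const_smul c h'.smooth_v)
  smooth_u i j := ContDiffOn.add (h.smooth_u i j) (ContDiffOn.mul contDiffOn_const (h'.smooth_u i j))
  smooth_q := ContDiffOn.add h.smooth_q (ContDiffOn.mul contDiffOn_const h'.smooth_q)
  symm x t ht := (h.symm x t ht).add ((h'.symm x t ht).smul c)
  traceless x t ht := by
    rw [Matrix.trace_add, Matrix.trace_smul, h.traceless x t ht, h'.traceless x t ht]; simp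
  momentum x t ht i := by
    have h1 := h.momentum x t ht i
    have h2 := h'.momentum x t ht i
    have e1 : deriv (fun s => (v x s + c • v' x s) i) t
        = deriv (fun s => v x s i) t + c * deriv (fun s => v' x s i) t := by
      have a1 := (h.smooth_v.coord i).differentiableAt_right x ht
      have a2 := (h'.smooth_v.coord i).differentiableAt_right x ht
      have := (a1.hasDerivAt.add (a2.hasDerivAt.const_mul c)).deriv
      rw [← this]; rfl
    have e2 : ∀ j, fderiv ℝ (fun y => (u y t + c • u' y t) i j) x (basisVec j)
        = fderiv ℝ (fun y => u y t i j) x (basisVec j)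
          + c * fderiv ℝ (fun y => u' y t i j) x (basisVec j) := by
      intro j
      have a1 := SmoothOnSlab.differentiableAt_left (h.smooth_u i j) x ht
      have a2 := SmoothOnSlab.differentiableAt_left (h'.smooth_u i j) x ht
      have := (a1.hasFDerivAt.add (a2.hasFDerivAt.const_mul c)).fderiv
      change fderiv ℝ (fun y => u y t i j + c * u' y t i j) x (basisVec j) = _
      erw [this]; rfl
    have e3 : fderiv ℝ (fun y => q y t + c * q' y t) x (basisVec i)
        = fderiv ℝ (fun y => q y t) x (basisVec i)
          + c * fderiv ℝ (fun y => q' y t) x (basisVec i) := by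
      have a1 := SmoothOnSlab.differentiableAt_left h.smooth_q x ht
      have a2 := SmoothOnSlab.differentiableAt_left h'.smooth_q x ht
      have := (a1.hasFDerivAt.add (a2.hasFDerivAt.const_mul c)).fderiv
      erw [this]; rfl
    rw [e1, e3, Finset.sum_congr rfl fun j _ => e2 j, Finset.sum_add_distrib, ← Finset.mul_sum]
    linear_combination h1 + c * h2
  div_free x t ht := by
    have h1 := h.div_free x t ht
    have h2 := h'.div_free x t ht
    have e2 : ∀ i, fderiv ℝ (fun y => (v y t + c • v' y t) i) x (basisVec i)
        = fderiv ℝ (fun y => v y t i) x (basisVec i)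
          + c * fderiv ℝ (fun y => v' y t i) x (basisVec i) := by
      intro i
      have a1 := (h.smooth_v.coord i).differentiableAt_left x ht
      have a2 := (h'.smooth_v.coord i).differentiableAt_left x ht
      have := (a1.hasFDerivAt.add (a2.hasFDerivAt.const_mul c)).fderiv
      change fderiv ℝ (fun y => v y t i + c * v' y t i) x (basisVec i) = _
      erw [this]; rfl
    rw [Finset.sum_congr rfl fun j _ => e2 j, Finset.sum_add_distrib, ← Finset.mul_sum, h1, h2]
    simp

lemma IsSmoothLinearSolution.add (h : IsSmoothLinearSolution T v u q)
    (h' : IsSmoothLinearSolution T v' u' (fun _ _ => 0)) :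
    IsSmoothLinearSolution T (fun x t => v x t + v' x t) (fun x t => u x t + u' x t) q := by
  simpa using h.add_smul h' 1

lemma IsSmoothLinearSolution.zero :
    IsSmoothLinearSolution (n := n) T (fun _ _ => 0) (fun _ _ => 0) (fun _ _ => 0) where
  smooth_v := contDiffOn_const
  smooth_u i j := contDiffOn_const
  smooth_q := contDiffOn_const
  symm x t ht := Matrix.isSymm_zero
  traceless x t ht := Matrix.trace_zero _ _
  momentum x t ht i := by simp
  div_free x t ht := by simp

lemma IsSmoothLinearSolution.sum {ι : Type*} (s : Finset ι) {w : ι → Rn n → ℝ → Rn n}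
    {z : ι → Rn n → ℝ → Matrix (Fin n) (Fin n) ℝ}
    (h : ∀ i ∈ s, IsSmoothLinearSolution T (w i) (z i) (fun _ _ => 0)) :
    IsSmoothLinearSolution T (fun x t => ∑ i ∈ s, w i x t) (fun x t => ∑ i ∈ s, z i x t)
      (fun _ _ => 0) := by
  classical
  induction s using Finset.induction_on with
  | empty => simpa using IsSmoothLinearSolution.zero
  | insert i s hi ih =>
    have := (h i (Finset.mem_insert_self i s)).add
      (ih fun j hj => h j (Finset.mem_insert_of_mem hj))
    simpa [Finset.sum_insert hi] using this

end LinearSystem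

/-! ### Localized plane waves as exact solutions. -/

section Wave

variable {n : ℕ}

/-- `∂_b (∂_a² + ∂_b²) g`. -/
def waveA (a b : Rn n) (g : Rn n × ℝ → ℝ) (z : Rn n × ℝ) : ℝ :=
  dirD (b, 0) (dirD (b, 0) (dirD (b, 0) g)) z + dirD (b, 0) (dirD (a, 0) (dirD (a, 0) g)) z

/-- `2 ∂_t ∂_a ∂_b g`. -/
def waveP (a b : Rn n) (g : Rn n × ℝ → ℝ) (z : Rn n × ℝ) : ℝ :=
  2 * dirD (0, 1) (dirD (a, 0) (dirD (b, 0) g)) z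

/-- `∂_t (∂_b² - ∂_a²) g`. -/
def waveQ (a b : Rn n) (g : Rn n × ℝ → ℝ) (z : Rn n × ℝ) : ℝ :=
  dirD (0, 1) (dirD (b, 0) (dirD (b, 0) g)) z - dirD (0, 1) (dirD (a, 0) (dirD (a, 0) g)) z

/-- The velocity of the localized plane wave with potential `g`. -/
def waveV (a b : Rn n) (g : Rn n × ℝ → ℝ) (x : Rn n) (t : ℝ) : Rn n :=
  waveA a b g (x, t) • a - waveA b a g (x, t) • b

/-- The stress of the localized plane wave with potential `g`. -/
def waveU (a b : Rn n) (g : Rn n × ℝ → ℝ) (x : Rn n) (t : ℝ) : Matrix (Fin n) (Fin n) ℝ :=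
  Matrix.of fun i j => -(waveP a b g (x, t) * (a i * a j - b i * b j)
    + waveQ a b g (x, t) * (a i * b j + b i * a j))

variable {a b : Rn n} {g : Rn n × ℝ → ℝ}

lemma contDiff_waveA (a b : Rn n) (hg : ContDiff ℝ ∞ g) : ContDiff ℝ ∞ (waveA a b g) :=
  (contDiff_dirD _ (contDiff_dirD _ (contDiff_dirD _ hg))).add
    (contDiff_dirD _ (contDiff_dirD _ (contDiff_dirD _ hg)))

lemma contDiff_waveP (a b : Rn n) (hg : ContDiff ℝ ∞ g) : ContDiff ℝ ∞ (waveP a b g) :=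
  contDiff_const.mul (contDiff_dirD _ (contDiff_dirD _ (contDiff_dirD _ hg)))

lemma contDiff_waveQ (a b : Rn n) (hg : ContDiff ℝ ∞ g) : ContDiff ℝ ∞ (waveQ a b g) :=
  (contDiff_dirD _ (contDiff_dirD _ (contDiff_dirD _ hg))).sub
    (contDiff_dirD _ (contDiff_dirD _ (contDiff_dirD _ hg)))

lemma contDiff_waveV (a b : Rn n) (hg : ContDiff ℝ ∞ g) :
    ContDiff ℝ ∞ (fun p : Rn n × ℝ => waveV a b g p.1 p.2) :=
  ((contDiff_waveA a b hg).smul contDiff_const).sub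
    ((contDiff_waveA b a hg).smul contDiff_const)

lemma contDiff_waveU (a b : Rn n) (hg : ContDiff ℝ ∞ g) (i j : Fin n) :
    ContDiff ℝ ∞ (fun p : Rn n × ℝ => waveU a b g p.1 p.2 i j) :=
  (((contDiff_waveP a b hg).mul contDiff_const).add
    ((contDiff_waveQ a b hg).mul contDiff_const)).neg

lemma dirD3_eq_zero {V : Type*} [NormedAddCommGroup V] [NormedSpace ℝ V] {g : V → ℝ} {z : V}
    (hz : z ∉ tsupport g) (h k l : V) : dirD h (dirD k (dirD l g)) z = 0 := by
  by_contra h0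
  exact hz (tsupport_dirD_subset _ _ (tsupport_dirD_subset _ _ (tsupport_dirD_subset _ _
    (subset_tsupport _ h0))))

lemma waveV_eq_zero {x : Rn n} {t : ℝ} (hz : (x, t) ∉ tsupport g) : waveV a b g x t = 0 := by
  simp [waveV, waveA, dirD3_eq_zero hz]

lemma waveU_eq_zero {x : Rn n} {t : ℝ} (hz : (x, t) ∉ tsupport g) : waveU a b g x t = 0 := by
  ext i j
  simp [waveU, waveP, waveQ, dirD3_eq_zero hz]

/-- Differential identities in commuting derivatives: with D = ∂_a² + ∂_b² the velocity is (∂_b D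
g)a − (∂_a D g)b, visibly divergence-free. Along a, the divergence of the stress is −(2∂ₜ∂_a²∂_b +
∂ₜ∂_b(∂_b² − ∂_a²))g = −∂ₜ∂_b D g, and symmetrically along b, so no pressure is needed.
Orthonormality of a and b enters only through the trace. -/
lemma isSmoothLinearSolution_wave (T : ℝ) (ha : ‖a‖ = 1) (hb : ‖b‖ = 1)
    (hab : inner ℝ a b = 0) (hg : ContDiff ℝ ∞ g) :
    IsSmoothLinearSolution T (waveV a b g) (waveU a b g) (fun _ _ => 0) where
  smooth_v := (contDiff_waveV a b hg).contDiffOn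
  smooth_u i j := (contDiff_waveU a b hg i j).contDiffOn
  smooth_q := contDiffOn_const
  symm x t ht := by
    ext i j
    simp only [Matrix.transpose_apply, waveU, Matrix.of_apply]
    ring
  traceless x t ht := by
    have h1 : ∑ i, a i ^ 2 = 1 := by rw [← norm_sq_eq_sum, ha]; norm_num
    have h2 : ∑ i, b i ^ 2 = 1 := by rw [← norm_sq_eq_sum, hb]; norm_num
    have h3 : ∑ i, a i * b i = 0 := by rw [← inner_eq_sum, hab]
    have : (waveU a b g x t).trace = -(waveP a b g (x, t) * (∑ i, a i ^ 2 - ∑ i, b i ^ 2)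
        + waveQ a b g (x, t) * (2 * ∑ i, a i * b i)) := by
      simp only [Matrix.trace, Matrix.diag, waveU, Matrix.of_apply, ← Finset.sum_sub_distrib,
        Finset.mul_sum, ← Finset.sum_add_distrib, ← Finset.sum_neg_distrib]
      exact Finset.sum_congr rfl fun i _ => by ring
    rw [this, h1, h2, h3]; ring
  momentum x t ht i := by
    have sA := contDiff_waveA a b hg
    have sA' := contDiff_waveA b a hg
    have sP := contDiff_waveP a b hg
    have sQ := contDiff_waveQ a b hg
    have dA := sA.differentiable (by simp) (x, t)
    have dA' := sA'.differentiable (by simp) (x, t)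
    have dP := sP.differentiable (by simp) (x, t)
    have dQ := sQ.differentiable (by simp) (x, t)
    have e1 : deriv (fun s => waveV a b g x s i) t
        = dirD (0, 1) (waveA a b g) (x, t) * a i - dirD (0, 1) (waveA b a g) (x, t) * b i :=
      (((hasDerivAt_slice dA).mul_const (a i)).sub ((hasDerivAt_slice dA').mul_const (b i))).deriv
    have e2 : ∀ j, fderiv ℝ (fun y => waveU a b g y t i j) x (basisVec j)
        = -((a i * a j - b i * b j) * fderiv ℝ (waveP a b g) (x, t) (basisVec j, 0)
          + (a i * b j + b i * a j) * fderiv ℝ (waveQ a b g) (x, t) (basisVec j, 0)) := by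
      intro j
      have hU := (contDiff_waveU a b hg i j).differentiable (by simp) (x, t)
      rw [fderiv_slice (f := fun p : Rn n × ℝ => waveU a b g p.1 p.2 i j) hU]
      have := ((dP.hasFDerivAt.mul_const (a i * a j - b i * b j)).add
        (dQ.hasFDerivAt.mul_const (a i * b j + b i * a j))).neg
      change fderiv ℝ (-((fun z => waveP a b g z * (a i * a j - b i * b j)) +
        fun z => waveQ a b g z * (a i * b j + b i * a j))) (x, t) (basisVec j, 0) = _
      rw [this.fderiv]
      simp
    have e3 : ∑ j, fderiv ℝ (fun y => waveU a b g y t i j) x (basisVec j)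
        = -(a i * dirD (a, 0) (waveP a b g) (x, t) - b i * dirD (b, 0) (waveP a b g) (x, t)
          + a i * dirD (b, 0) (waveQ a b g) (x, t) + b i * dirD (a, 0) (waveQ a b g) (x, t)) := by
      simp only [dirD, ← sum_mul_fderiv_basisVec _ a, ← sum_mul_fderiv_basisVec _ b,
        Finset.mul_sum, ← Finset.sum_sub_distrib, ← Finset.sum_add_distrib,
        ← Finset.sum_neg_distrib, smul_eq_mul]
      refine Finset.sum_congr rfl fun j _ => ?_
      rw [e2]; ring
    have S1 : ∀ h, ContDiff ℝ ∞ (dirD h g) := fun h => contDiff_dirD h hg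
    have S2 : ∀ h k, ContDiff ℝ ∞ (dirD h (dirD k g)) := fun h k => contDiff_dirD h (S1 k)
    have S3 : ∀ h k l, ContDiff ℝ ∞ (dirD h (dirD k (dirD l g))) := fun h k l =>
      contDiff_dirD h (S2 k l)
    have xA : ∀ h (c d : Rn n), dirD h (waveA c d g) (x, t)
        = dirD h (dirD (d, 0) (dirD (d, 0) (dirD (d, 0) g))) (x, t)
          + dirD h (dirD (d, 0) (dirD (c, 0) (dirD (c, 0) g))) (x, t) := by
      intro h c d
      exact congrFun (dirD_add h (S3 _ _ _) (S3 _ _ _)) (x, t)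
    have xP : ∀ h, dirD h (waveP a b g) (x, t)
        = 2 * dirD (0, 1) (dirD h (dirD (a, 0) (dirD (b, 0) g))) (x, t) := by
      intro h
      rw [dirD_comm (S2 _ _) (0, 1) h]
      exact congrFun (dirD_const_mul h 2 (S3 _ _ _)) (x, t)
    have xQ : ∀ h, dirD h (waveQ a b g) (x, t)
        = dirD (0, 1) (dirD h (dirD (b, 0) (dirD (b, 0) g))) (x, t)
          - dirD (0, 1) (dirD h (dirD (a, 0) (dirD (a, 0) g))) (x, t) := by
      intro h
      rw [dirD_comm (S2 _ _) (0, 1) h, dirD_comm (S2 _ _) (0, 1) h]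
      exact congrFun (dirD_sub h (S3 _ _ _) (S3 _ _ _)) (x, t)
    have c1 : dirD (a, 0) (dirD (a, 0) (dirD (b, 0) g))
        = dirD (b, 0) (dirD (a, 0) (dirD (a, 0) g)) := by
      rw [dirD_comm hg (a, 0) (b, 0), dirD_comm (S1 _) (a, 0) (b, 0)]
    have c2 : dirD (b, 0) (dirD (a, 0) (dirD (b, 0) g))
        = dirD (a, 0) (dirD (b, 0) (dirD (b, 0) g)) := by
      rw [dirD_comm (S1 _) (b, 0) (a, 0)]
    rw [e1, e3, xA, xA, xP, xP, xQ, xQ, c1, c2]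
    simp
    ring
  div_free x t ht := by
    have dA := (contDiff_waveA a b hg).differentiable (by simp) (x, t)
    have dA' := (contDiff_waveA b a hg).differentiable (by simp) (x, t)
    have S1 : ∀ h, ContDiff ℝ ∞ (dirD h g) := fun h => contDiff_dirD h hg
    have S2 : ∀ h k, ContDiff ℝ ∞ (dirD h (dirD k g)) := fun h k => contDiff_dirD h (S1 k)
    have S3 : ∀ h k l, ContDiff ℝ ∞ (dirD h (dirD k (dirD l g))) := fun h k l =>
      contDiff_dirD h (S2 k l)
    have e2 : ∀ i, fderiv ℝ (fun y => waveV a b g y t i) x (basisVec i)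
        = a i * fderiv ℝ (waveA a b g) (x, t) (basisVec i, 0)
          - b i * fderiv ℝ (waveA b a g) (x, t) (basisVec i, 0) := by
      intro i
      have := (dA.hasFDerivAt.mul_const (a i)).sub (dA'.hasFDerivAt.mul_const (b i))
      have e := fderiv_slice this.differentiableAt (basisVec i)
      rw [this.fderiv] at e
      exact e.trans (by simp)
    have xA : ∀ h (c d : Rn n), dirD h (waveA c d g) (x, t)
        = dirD h (dirD (d, 0) (dirD (d, 0) (dirD (d, 0) g))) (x, t)
          + dirD h (dirD (d, 0) (dirD (c, 0) (dirD (c, 0) g))) (x, t) := by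
      intro h c d
      exact congrFun (dirD_add h (S3 _ _ _) (S3 _ _ _)) (x, t)
    have h1 := sum_mul_fderiv_basisVec (fderiv ℝ (waveA a b g) (x, t)) a
    have h2 := sum_mul_fderiv_basisVec (fderiv ℝ (waveA b a g) (x, t)) b
    simp only [smul_eq_mul] at h1 h2
    rw [Finset.sum_congr rfl fun i _ => e2 i, Finset.sum_sub_distrib, h1, h2]
    change dirD (a, 0) (waveA a b g) (x, t) - dirD (b, 0) (waveA b a g) (x, t) = 0
    have c : ∀ f : Rn n × ℝ → ℝ, ContDiff ℝ ∞ f → dirD (b, 0) (dirD (a, 0) f)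
      = dirD (a, 0) (dirD (b, 0) f) := fun f hf => dirD_comm hf _ _
    rw [xA, xA, c _ (S2 _ _), c _ (S2 _ _)]
    ring

/-- Leading order of a localized plane wave with phase `N ℓ`. -/
lemma exists_wave_bound (ha : ‖a‖ = 1) (hb : ‖b‖ = 1) (hg : ContDiff ℝ ∞ g)
    (hs : HasCompactSupport g) (ℓ : Rn n × ℝ →L[ℝ] ℝ) (hℓa : ℓ (a, 0) = 0) (hℓb : ℓ (b, 0) = 1) :
    ∃ C, 0 ≤ C ∧ ∀ N : ℝ, 1 ≤ N → ∀ x t,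
      ‖waveV a b (fun z => (-(N ^ 3)⁻¹ * g z) * Real.sin ((N • ℓ) z)) x t
        - (g (x, t) * Real.cos ((N • ℓ) (x, t))) • a‖ ≤ C / N ∧
      ∀ i j, |waveU a b (fun z => (-(N ^ 3)⁻¹ * g z) * Real.sin ((N • ℓ) z)) x t i j
        + ℓ (0, 1) * (g (x, t) * Real.cos ((N • ℓ) (x, t))) * (a i * b j + b i * a j)| ≤ C / N := by
  have key := exists_third_deriv_bound hg hs ℓ
  obtain ⟨C1, p1, h1⟩ := key (b, 0) (b, 0) (b, 0)
  obtain ⟨C2, p2, h2⟩ := key (b, 0) (a, 0) (a, 0)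
  obtain ⟨C3, p3, h3⟩ := key (a, 0) (a, 0) (a, 0)
  obtain ⟨C4, p4, h4⟩ := key (a, 0) (b, 0) (b, 0)
  obtain ⟨C5, p5, h5⟩ := key (0, 1) (a, 0) (b, 0)
  obtain ⟨C6, p6, h6⟩ := key (0, 1) (b, 0) (b, 0)
  obtain ⟨C7, p7, h7⟩ := key (0, 1) (a, 0) (a, 0)
  refine ⟨(C1 + C2 + C3 + C4) + (4 * C5 + 2 * C6 + 2 * C7), by positivity, fun N hN x t => ?_⟩
  have hN0 : 0 < N := by linarith
  set G := fun z => (-(N ^ 3)⁻¹ * g z) * Real.sin ((N • ℓ) z) with hG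
  have h1 := h1 N hN (x, t)
  have h2 := h2 N hN (x, t)
  have h3 := h3 N hN (x, t)
  have h4 := h4 N hN (x, t)
  have h5 := h5 N hN (x, t)
  have h6 := h6 N hN (x, t)
  have h7 := h7 N hN (x, t)
  simp only [hℓa, hℓb, mul_one, one_mul, mul_zero, zero_mul, sub_zero] at h1 h2 h3 h4 h5 h6 h7
  have d5 : 0 ≤ C5 / N := by positivity
  have d6 : 0 ≤ C6 / N := by positivity
  have d7 : 0 ≤ C7 / N := by positivity
  have d1 : 0 ≤ C1 / N := by positivity
  have d2 : 0 ≤ C2 / N := by positivity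
  have d3 : 0 ≤ C3 / N := by positivity
  have d4 : 0 ≤ C4 / N := by positivity
  have esum : ((C1 + C2 + C3 + C4) + (4 * C5 + 2 * C6 + 2 * C7)) / N
      = C1 / N + C2 / N + C3 / N + C4 / N + (4 * (C5 / N) + 2 * (C6 / N) + 2 * (C7 / N)) := by
    ring
  rw [esum]
  constructor
  · have e : waveV a b G x t - (g (x, t) * Real.cos ((N • ℓ) (x, t))) • a
        = (dirD (b, 0) (dirD (b, 0) (dirD (b, 0) G)) (x, t)
            - g (x, t) * Real.cos ((N • ℓ) (x, t))) • a
          + dirD (b, 0) (dirD (a, 0) (dirD (a, 0) G)) (x, t) • a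
          - (dirD (a, 0) (dirD (a, 0) (dirD (a, 0) G)) (x, t)
            + dirD (a, 0) (dirD (b, 0) (dirD (b, 0) G)) (x, t)) • b := by
      simp only [waveV, waveA]
      module
    rw [e]
    refine (norm_sub_le _ _).trans ?_
    refine (add_le_add_left (norm_add_le _ _) _).trans ?_
    rw [norm_smul, norm_smul, norm_smul, ha, hb, mul_one, mul_one, mul_one, Real.norm_eq_abs,
      Real.norm_eq_abs, Real.norm_eq_abs]
    have := abs_add_le (dirD (a, 0) (dirD (a, 0) (dirD (a, 0) G)) (x, t))
      (dirD (a, 0) (dirD (b, 0) (dirD (b, 0) G)) (x, t))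
    linarith
  · intro i j
    have ab : ∀ i, |a i| ≤ 1 := fun i => ha ▸ abs_apply_le_norm a i
    have bb : ∀ i, |b i| ≤ 1 := fun i => hb ▸ abs_apply_le_norm b i
    have mulb : ∀ x y : ℝ, |x| ≤ 1 → |y| ≤ 1 → |x * y| ≤ 1 := by
      intro x y hx hy
      rw [abs_mul]
      exact mul_le_one₀ hx (abs_nonneg _) hy
    have f1 : |a i * a j - b i * b j| ≤ 2 := by
      have := abs_sub (a i * a j) (b i * b j)
      linarith [mulb _ _ (ab i) (ab j), mulb _ _ (bb i) (bb j)]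
    have f2 : |a i * b j + b i * a j| ≤ 2 := by
      have := abs_add_le (a i * b j) (b i * a j)
      linarith [mulb _ _ (ab i) (bb j), mulb _ _ (bb i) (ab j)]
    have e : waveU a b G x t i j
        + ℓ (0, 1) * (g (x, t) * Real.cos ((N • ℓ) (x, t))) * (a i * b j + b i * a j)
        = -(2 * (dirD (0, 1) (dirD (a, 0) (dirD (b, 0) G)) (x, t) * (a i * a j - b i * b j)))
          - (dirD (0, 1) (dirD (b, 0) (dirD (b, 0) G)) (x, t)
            - ℓ (0, 1) * (g (x, t) * Real.cos ((N • ℓ) (x, t)))) * (a i * b j + b i * a j)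
          + dirD (0, 1) (dirD (a, 0) (dirD (a, 0) G)) (x, t) * (a i * b j + b i * a j) := by
      simp only [waveU, waveP, waveQ, Matrix.of_apply]
      ring
    have m1 : ∀ x y C : ℝ, |x| ≤ C → |y| ≤ 2 → |x * y| ≤ 2 * C := by
      intro x y C hx hy
      rw [abs_mul]
      nlinarith [abs_nonneg x, abs_nonneg y]
    rw [e]
    refine (abs_add_le _ _).trans ?_
    refine (add_le_add_left (abs_sub _ _) _).trans ?_
    rw [abs_neg, abs_mul 2, abs_two]
    have := m1 _ _ _ h5 f1
    have := m1 _ _ _ h6 f2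
    have := m1 _ _ _ h7 f2
    linarith

end Wave


/-! ### Nonstationary phase on time slices. -/

section SliceIntegrals

variable {n : ℕ} {F : Type*} [NormedAddCommGroup F]

lemma hasCompactSupport_slice {f : Rn n × ℝ → F} (hf : HasCompactSupport f) (t : ℝ) :
    HasCompactSupport fun x => f (x, t) := by
  refine HasCompactSupport.intro (IsCompact.image hf continuous_fst) fun x hx => ?_
  by_contra h0
  exact hx ⟨(x, t), subset_tsupport _ h0, rfl⟩

lemma integrable_slice {f : Rn n × ℝ → F} (hc : Continuous f) (hf : HasCompactSupport f) (t : ℝ) :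
    Integrable fun x => f (x, t) :=
  Continuous.integrable_of_hasCompactSupport (by fun_prop) (hasCompactSupport_slice hf t)

variable [NormedSpace ℝ F]

lemma norm_integral_slice_le {f : Rn n → F} {S : Set (Rn n)} (hS : IsCompact S) {B : ℝ}
    (hB : ∀ x, ‖f x‖ ≤ B) (h0 : ∀ x, x ∉ S → f x = 0) :
    ‖∫ x, f x‖ ≤ B * volume.real S := by
  rw [← setIntegral_eq_integral_of_forall_compl_eq_zero h0]
  exact norm_setIntegral_le_of_norm_le_const hS.measure_lt_top fun x _ => hB x

/-- Nonstationary phase: one integration by parts in space. -/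
lemma exists_oscillation_bound {f : Rn n × ℝ → ℝ} (hf : ContDiff ℝ ∞ f)
    (hs : HasCompactSupport f) (ℓ : Rn n × ℝ →L[ℝ] ℝ) {b : Rn n} (hb : ℓ (b, 0) ≠ 0) :
    ∃ C, 0 ≤ C ∧ ∀ N : ℝ, 0 < N → ∀ t, |∫ x, f (x, t) * Real.cos ((N • ℓ) (x, t))| ≤ C / N := by
  have hd := contDiff_dirD (b, 0) hf
  have hds := hasCompactSupport_dirD (b, 0) hs
  obtain ⟨B, hB0, hB⟩ := exists_bound_of_hasCompactSupport hd.continuous hds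
  set S := Prod.fst '' tsupport (dirD ((b, 0) : Rn n × ℝ) f) with hS
  have hSc : IsCompact S := IsCompact.image hds continuous_fst
  refine ⟨B * volume.real S / |ℓ (b, 0)|, by positivity, fun N hN t => ?_⟩
  have hsin : ContDiff ℝ ∞ (fun z : Rn n × ℝ => Real.sin ((N • ℓ) z)) :=
    Real.contDiff_sin.comp (N • ℓ).contDiff
  have hfd : ∀ x, DifferentiableAt ℝ f (x, t) := fun x => hf.differentiable (by simp) _
  have hsd : ∀ x, DifferentiableAt ℝ (fun z : Rn n × ℝ => Real.sin ((N • ℓ) z)) (x, t) :=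
    fun x => hsin.differentiable (by simp) _
  have e1 : ∀ x, fderiv ℝ (fun y => Real.sin ((N • ℓ) (y, t))) x b
      = N * ℓ (b, 0) * Real.cos ((N • ℓ) (x, t)) := by
    intro x
    rw [fderiv_slice (hsd x), ((N • ℓ).hasFDerivAt.sin).fderiv]
    simp
    ring
  have e2 : ∀ x, fderiv ℝ (fun y => f (y, t)) x b = dirD (b, 0) f (x, t) := fun x =>
    fderiv_slice (hfd x) b
  have i1 : Integrable fun x => fderiv ℝ (fun y => f (y, t)) x b * Real.sin ((N • ℓ) (x, t)) := by
    simp only [e2]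
    exact integrable_slice (f := fun z => dirD (b, 0) f z * Real.sin ((N • ℓ) z))
      (hd.continuous.mul hsin.continuous) hds.mul_right t
  have i2 : Integrable fun x => f (x, t) * fderiv ℝ (fun y => Real.sin ((N • ℓ) (y, t))) x b := by
    simp only [e1]
    exact integrable_slice (f := fun z => f z * (N * ℓ (b, 0) * Real.cos ((N • ℓ) z)))
      (hf.continuous.mul (continuous_const.mul (Real.continuous_cos.comp (N • ℓ).continuous)))
      hs.mul_right t
  have i3 : Integrable fun x => f (x, t) * Real.sin ((N • ℓ) (x, t)) :=
    integrable_slice (f := fun z => f z * Real.sin ((N • ℓ) z))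
      (hf.continuous.mul hsin.continuous) hs.mul_right t
  have key := integral_mul_fderiv_eq_neg_fderiv_mul_of_integrable i1 i2 i3
    (fun x _ => DifferentiableAt.comp (f := fun y : Rn n => (y, t)) x (hfd x)
      (hasFDerivAt_prodMk_left x t).differentiableAt)
    (fun x _ => DifferentiableAt.comp (g := fun z : Rn n × ℝ => Real.sin ((N • ℓ) z))
      (f := fun y : Rn n => (y, t)) x (hsd x) (hasFDerivAt_prodMk_left x t).differentiableAt)
  simp only [e1, e2] at key
  have e3 : ∫ x, f (x, t) * (N * ℓ (b, 0) * Real.cos ((N • ℓ) (x, t)))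
      = N * ℓ (b, 0) * ∫ x, f (x, t) * Real.cos ((N • ℓ) (x, t)) := by
    rw [← integral_const_mul]
    exact integral_congr_ae (Eventually.of_forall fun x => by simp only []; ring)
  rw [e3] at key
  have hle : ‖∫ x, dirD (b, 0) f (x, t) * Real.sin ((N • ℓ) (x, t))‖ ≤ B * volume.real S := by
    refine norm_integral_slice_le hSc (fun x => ?_) (fun x hx => ?_)
    · rw [norm_mul]
      have h1 := hB (x, t)
      have h2 := Real.abs_sin_le_one ((N • ℓ) (x, t))
      rw [Real.norm_eq_abs, Real.norm_eq_abs]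
      nlinarith [abs_nonneg (dirD (b, 0) f (x, t)), abs_nonneg (Real.sin ((N • ℓ) (x, t)))]
    · have : dirD (b, 0) f (x, t) = 0 := by
        by_contra h0
        exact hx ⟨(x, t), subset_tsupport _ h0, rfl⟩
      rw [this, zero_mul]
  have hab : 0 < |ℓ (b, 0)| := abs_pos.mpr hb
  rw [le_div_iff₀ hN, le_div_iff₀ hab]
  calc |∫ x, f (x, t) * Real.cos ((N • ℓ) (x, t))| * N * |ℓ (b, 0)|
      = |N * ℓ (b, 0) * ∫ x, f (x, t) * Real.cos ((N • ℓ) (x, t))| := by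
        rw [abs_mul, abs_mul, abs_of_pos hN]; ring
    _ ≤ B * volume.real S := by rw [key, abs_neg]; exact hle

end SliceIntegrals

/-! ### Covers by bumps of bounded overlap. -/

section Cover

variable {n : ℕ}

/-- The coordinates of a space-time point; `none` is time. -/
def stCoord (w : Rn n × ℝ) : Option (Fin n) → ℝ
  | none => w.2
  | some l => w.1 l

lemma abs_stCoord_le (w : Rn n × ℝ) (l : Option (Fin n)) : |stCoord w l| ≤ ‖w‖ := by
  cases l with
  | none => exact norm_snd_le w
  | some l => exact (abs_apply_le_norm w.1 l).trans (norm_fst_le w)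

lemma contDiff_stCoord (l : Option (Fin n)) : ContDiff ℝ ∞ fun w : Rn n × ℝ => stCoord w l := by
  cases l with
  | none => exact contDiff_snd
  | some l => exact (EuclideanSpace.proj (𝕜 := ℝ) l).contDiff.comp contDiff_fst

lemma dist_le_of_stCoord {w z : Rn n × ℝ} {r : ℝ}
    (h : ∀ l, |stCoord w l - stCoord z l| ≤ r) : dist w z ≤ (n + 1) * r := by
  have hr : 0 ≤ r := (abs_nonneg _).trans (h none)
  rw [Prod.dist_eq, max_le_iff]
  constructor
  · rw [dist_eq_norm]
    have h1 : ‖w.1 - z.1‖ ≤ ∑ l, ‖(w.1 - z.1) l • (basisVec l : Rn n)‖ := by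
      conv_lhs => rw [eq_sum_basisVec (w.1 - z.1)]
      exact norm_sum_le _ _
    have h2 : ∀ l, ‖(w.1 - z.1) l • (basisVec l : Rn n)‖ ≤ r := by
      intro l
      have h1 : ‖(basisVec l : Rn n)‖ = 1 := by simp [basisVec]
      rw [norm_smul, h1, mul_one]
      exact h (some l)
    have h3 := h1.trans (Finset.sum_le_sum fun l _ => h2 l)
    simp at h3
    linarith
  · have := h none
    rw [Real.dist_eq]
    have h4 : |w.2 - z.2| ≤ r := this
    have : 0 ≤ n * r := by positivity
    linarith

/-- Finite families of bump functions of small support, with bounded overlap, covering a given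
compact set. -/
lemma exists_bump_cover {C : Set (Rn n × ℝ)} (hC : IsCompact C) {δ : ℝ} (hδ : 0 < δ) :
    ∃ (m : ℕ) (ψ : Fin m → Rn n × ℝ → ℝ) (z : Fin m → Rn n × ℝ),
      (∀ i, ContDiff ℝ ∞ (ψ i)) ∧ (∀ i w, 0 ≤ ψ i w ∧ ψ i w ≤ 1) ∧ (∀ i, z i ∈ C) ∧
      (∀ i w, ψ i w ≠ 0 → dist w (z i) ≤ δ) ∧ (∀ w ∈ C, ∃ i, ψ i w = 1) ∧
      ∀ w, (Finset.univ.filter fun i => ψ i w ≠ 0).card ≤ 2 ^ (n + 1) := by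
  classical
  -- θ is 1 on [−1/2, 1/2] and vanishes off ]−1, 1[. Products of its lattice translates are 1 at
  -- points whose nearest lattice point is the index, and at most two integers per coordinate are
  -- active, which gives the overlap 2^(n+1) in space-time.
  let θ : ContDiffBump (0 : ℝ) := ⟨1 / 2, 1, by norm_num, by norm_num⟩
  -- Two points where the same bump is nonzero differ by at most 2h in each of the n + 1
  -- coordinates, hence by at most (n + 1)·2h = δ.
  set h : ℝ := δ / (2 * (n + 1)) with hh
  have hpos : 0 < h := by positivity
  let Ψ : (Option (Fin n) → ℤ) → Rn n × ℝ → ℝ := fun k w => ∏ l, θ (stCoord w l / h - k l)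
  have Ψsmooth : ∀ k, ContDiff ℝ ∞ (Ψ k) := fun k => contDiff_prod fun l _ =>
    θ.contDiff.comp (((contDiff_stCoord l).div_const h).sub contDiff_const)
  have Ψact : ∀ k w, Ψ k w ≠ 0 → ∀ l, |stCoord w l / h - k l| < 1 := by
    intro k w hne l
    have h1 := Finset.prod_ne_zero_iff.mp hne l (Finset.mem_univ l)
    by_contra hge
    exact h1 (θ.zero_of_le_dist (by simpa [Real.dist_eq] using not_lt.mp hge))
  have Ψact' : ∀ k w, Ψ k w ≠ 0 → ∀ l, |stCoord w l - h * k l| ≤ h := by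
    intro k w hne l
    have h1 := (Ψact k w hne l).le
    have h2 : stCoord w l - h * k l = h * (stCoord w l / h - k l) := by field_simp
    rw [h2, abs_mul, abs_of_pos hpos]
    exact mul_le_of_le_one_right hpos.le h1
  -- Only bumps that meet C are kept. A point of C where the bump is nonzero serves as its centre,
  -- so that all centres lie in C.
  set A : Set (Option (Fin n) → ℤ) := {k | ∃ w ∈ C, Ψ k w ≠ 0} with hA
  obtain ⟨R, hR⟩ := hC.isBounded.exists_norm_le
  have hAfin : A.Finite := by
    refine Set.Finite.subset (Set.finite_Icc (fun _ => -⌈R / h + 1⌉) (fun _ => ⌈R / h + 1⌉)) ?_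
    rintro k ⟨w, hw, hne⟩
    have h1 : ∀ l, |(k l : ℝ)| ≤ R / h + 1 := by
      intro l
      have h2 := (Ψact k w hne l).le
      have h3 : |stCoord w l / h| ≤ R / h := by
        rw [abs_div, abs_of_pos hpos]
        exact div_le_div_of_nonneg_right ((abs_stCoord_le w l).trans (hR w hw)) hpos.le
      have h4 : (k l : ℝ) = stCoord w l / h - (stCoord w l / h - k l) := by ring
      rw [h4]
      exact (abs_sub _ _).trans (add_le_add h3 h2)
    have h5 : ∀ l, |(k l : ℝ)| ≤ (⌈R / h + 1⌉ : ℝ) := fun l => (h1 l).trans (Int.le_ceil _)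
    constructor
    · intro l
      have := (abs_le.mp (h5 l)).1
      exact_mod_cast this
    · intro l
      have := (abs_le.mp (h5 l)).2
      exact_mod_cast this
  have : Fintype A := hAfin.fintype
  let e := (Fintype.equivFin A).symm
  choose zz hzC hzne using fun k : A => k.2
  refine ⟨Fintype.card A, fun i => Ψ (e i), fun i => zz (e i), fun i => Ψsmooth _, fun i w => ?_,
    fun i => hzC _, fun i w hne => ?_, fun w hw => ?_, fun w => ?_⟩
  · exact ⟨Finset.prod_nonneg fun l _ => θ.nonneg, Finset.prod_le_one (fun l _ => θ.nonneg)
      fun l _ => θ.le_one⟩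
  · have : ∀ l, |stCoord w l - stCoord (zz (e i)) l| ≤ 2 * h := by
      intro l
      have h1 := Ψact' _ w hne l
      have h2 := Ψact' _ _ (hzne (e i)) l
      have h3 : stCoord w l - stCoord (zz (e i)) l = (stCoord w l - h * (e i : _ → ℤ) l)
        - (stCoord (zz (e i)) l - h * (e i : _ → ℤ) l) := by ring
      rw [h3]
      exact (abs_sub _ _).trans (by linarith)
    refine (dist_le_of_stCoord this).trans (le_of_eq ?_)
    rw [hh]; field_simp
  · have h1 : Ψ (fun l => round (stCoord w l / h)) w = 1 := by
      refine Finset.prod_eq_one fun l _ => θ.one_of_mem_closedBall ?_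
      rw [Metric.mem_closedBall, Real.dist_eq, sub_zero]
      exact abs_sub_round _
    have h2 : (fun l => round (stCoord w l / h)) ∈ A := ⟨w, hw, by rw [h1]; exact one_ne_zero⟩
    exact ⟨e.symm ⟨_, h2⟩, by simpa using h1⟩
  · have hcard : (Fintype.piFinset fun l : Option (Fin n) =>
        ({⌊stCoord w l / h⌋, ⌊stCoord w l / h⌋ + 1} : Finset ℤ)).card ≤ 2 ^ (n + 1) := by
      rw [Fintype.card_piFinset]
      refine (Finset.prod_le_pow_card _ _ 2 fun l _ => Finset.card_le_two).trans ?_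
      simp
    refine le_trans (Finset.card_le_card_of_injOn (fun i => (e i : Option (Fin n) → ℤ)) ?_ ?_) hcard
    · intro i hi
      have hne := (Finset.mem_filter.mp hi).2
      simp only [Finset.mem_coe, Fintype.mem_piFinset, Finset.mem_insert, Finset.mem_singleton]
      intro l
      have h1 := abs_lt.mp (Ψact _ w hne l)
      set s := stCoord w l / h
      set k := (e i : Option (Fin n) → ℤ) l
      have h2 := Int.floor_le s
      have h3 := Int.lt_floor_add_one s
      have h4 : (⌊s⌋ : ℝ) < k + 1 := by linarith [h1.2]
      have h5 : (k : ℝ) < ⌊s⌋ + 1 + 1 := by linarith [h1.1]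
      have h4' : ⌊s⌋ < k + 1 := by exact_mod_cast h4
      have h5' : k < ⌊s⌋ + 1 + 1 := by exact_mod_cast h5
      omega
    · intro i _ j _ hij
      exact e.injective (Subtype.ext hij)

end Cover


/-! ### Subsolutions and the pointwise geometry of a perturbation. -/

/-- A strict subsolution which agrees with the reference fields off a compact subset of
`Ω × ]0,T[`. -/
structure Subsolution {n : ℕ} (T : ℝ) (Ω : Set (Rn n)) (ebar : Rn n → ℝ → ℝ)
    (v₀ : Rn n → ℝ → Rn n) (u₀ : Rn n → ℝ → Matrix (Fin n) (Fin n) ℝ) (q₀ : Rn n → ℝ → ℝ)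
    (v : Rn n → ℝ → Rn n) (u : Rn n → ℝ → Matrix (Fin n) (Fin n) ℝ) : Prop where
  sol : IsSmoothLinearSolution T v u q₀
  eq_off_compact : ∃ K : Set (Rn n × ℝ), IsCompact K ∧ K ⊆ Ω ×ˢ Ioo 0 T ∧
    ∀ x t, (x, t) ∉ K → v x t = v₀ x t ∧ u x t = u₀ x t
  pos : ∀ x ∈ Ω, ∀ t ∈ Ioo 0 T, ∀ y, y ≠ 0 → 0 < quad (gapMat (ebar x t) (v x t) (u x t)) y

/-- The local rate of energy gain of a perturbation. -/
def gapDensity {n : ℕ} (e : ℝ) (v : Rn n) : ℝ := (2 * e - ‖v‖ ^ 2) ^ 2 / (2 * e)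

section PointwiseGeometry

variable {n : ℕ}

lemma quad_nonneg_of_pos {M : Matrix (Fin n) (Fin n) ℝ} (h : ∀ y, y ≠ 0 → 0 < quad M y)
    (y : Rn n) : 0 ≤ quad M y := by
  by_cases hy : y = 0
  · rw [hy, quad_zero]
  · exact (h y hy).le

/-- A positive definite matrix has positive trace, and the trace of the gap matrix is the energy
gap. -/
lemma gap_pos (hn : 0 < n) {e : ℝ} {v : Rn n} {u : Matrix (Fin n) (Fin n) ℝ} (hu : u.trace = 0)
    (h : ∀ y, y ≠ 0 → 0 < quad (gapMat e v u) y) : 0 < 2 * e - ‖v‖ ^ 2 := by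
  rw [← trace_gapMat hn e v hu]
  have hb : (basisVec ⟨0, hn⟩ : Rn n) ≠ 0 := by
    intro h0
    have := congrArg (fun w : Rn n => w ⟨0, hn⟩) h0
    simp [basisVec] at this
  have h1 := h _ hb
  rw [quad_basisVec] at h1
  exact h1.trans_le (diag_le_trace (quad_nonneg_of_pos h) _)

/-- The oscillation direction at a strict subsolution value. -/
lemma exists_oscillation_frame (hn : 2 ≤ n) {e : ℝ} {v : Rn n} {u : Matrix (Fin n) (Fin n) ℝ}
    (hs : u.IsSymm) (hu : u.trace = 0) (h : ∀ y, y ≠ 0 → 0 < quad (gapMat e v u) y)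
    {K : ℝ} (hK : 1 ≤ K) :
    ∃ (a b : Rn n) (κ ρ : ℝ), ‖a‖ = 1 ∧ ‖b‖ = 1 ∧ inner ℝ a b = 0 ∧
      v = (inner ℝ v a : ℝ) • a + κ • b ∧ 0 ≤ ρ ∧ ρ ≤ √(2 * e) ∧
      (∀ y, ρ * inner ℝ a y ^ 2 * (8 * K * √(2 * e)) ≤ quad (gapMat e v u) y) ∧
      (∀ y, (ρ * inner ℝ a y) ^ 2 * (8 * K) ^ 2 ≤ quad (gapMat e v u) y) ∧
      (2 * e - ‖v‖ ^ 2) / √(2 * e) ≤ 8 * K * n * ρ := by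
  have hn0 : 0 < n := by omega
  have hnR : (0 : ℝ) < n := by exact_mod_cast hn0
  set M := gapMat e v u with hM
  have hMs : M.IsSymm := gapMat_isSymm e v hs
  have hMn := quad_nonneg_of_pos h
  have htr : M.trace = 2 * e - ‖v‖ ^ 2 := trace_gapMat hn0 e v hu
  have hg := gap_pos hn0 hu h
  have he : 0 < 2 * e := by nlinarith [sq_nonneg ‖v‖]
  set V := √(2 * e) with hV
  have hVpos : 0 < V := Real.sqrt_pos.mpr he
  have hV2 : V ^ 2 = 2 * e := Real.sq_sqrt he.le
  obtain ⟨j, hj⟩ := exists_trace_le_diag hn0 M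
  have hjpos : 0 < M j j := lt_of_lt_of_le (by rw [htr]; positivity) hj
  have hjle : M j j ≤ V ^ 2 := by
    have := diag_le_trace hMn j
    rw [htr] at this
    nlinarith [sq_nonneg ‖v‖]
  -- The column j of M gives (p·y)² ≤ M_jj quad M y, and |p| ≥ M_jj. After normalisation M dominates
  -- M_jj a⊗a.
  set p : Rn n := WithLp.toLp 2 (fun i => M i j) with hp
  have hpj : M j j ≤ ‖p‖ := (le_abs_self _).trans (abs_apply_le_norm p j)
  have hppos : 0 < ‖p‖ := hjpos.trans_le hpj
  set a : Rn n := ‖p‖⁻¹ • p with ha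
  have hau : ‖a‖ = 1 := norm_smul_inv_norm (norm_pos_iff.mp hppos)
  have hkey : ∀ y, M j j * inner ℝ a y ^ 2 ≤ quad M y := by
    intro y
    have h1 : inner ℝ p y ^ 2 ≤ M j j * quad M y := by
      rw [inner_eq_sum]; exact sq_col_le hMs hMn y j
    have h2 : inner ℝ a y = ‖p‖⁻¹ * inner ℝ p y := by rw [ha, real_inner_smul_left]
    rw [h2, mul_pow, inv_pow]
    have h3 : M j j * ((‖p‖ ^ 2)⁻¹ * inner ℝ p y ^ 2) = M j j * inner ℝ p y ^ 2 / ‖p‖ ^ 2 := by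
      field_simp
    rw [h3, div_le_iff₀ (by positivity)]
    have h4 : M j j ^ 2 ≤ ‖p‖ ^ 2 := pow_le_pow_left₀ hjpos.le hpj 2
    nlinarith [mul_le_mul_of_nonneg_left h1 hjpos.le, mul_le_mul_of_nonneg_right h4 (hMn y)]
  obtain ⟨b, κ, hb, hab, hdec⟩ := exists_orthonormal_decomp hn v a hau
  have hK0 : 0 < K := by linarith
  -- One wave of amplitude ρ changes the form by at most 2Vρ a⊗a to first order, that is by
  -- (M_jj/(4K)) a⊗a. Hence K overlapping waves consume at most a quarter of M to first order.
  refine ⟨a, b, κ, M j j / (8 * K * V), hau, hb, hab, hdec, by positivity, ?_, fun y => ?_,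
    fun y => ?_, ?_⟩
  · rw [div_le_iff₀ (by positivity)]
    nlinarith [mul_le_mul_of_nonneg_right hK (sq_nonneg V), sq_nonneg V]
  · have : M j j / (8 * K * V) * inner ℝ a y ^ 2 * (8 * K * V) = M j j * inner ℝ a y ^ 2 := by
      field_simp
    rw [this]
    exact hkey y
  · have : (M j j / (8 * K * V) * inner ℝ a y) ^ 2 * (8 * K) ^ 2
        = M j j * (M j j * inner ℝ a y ^ 2) / V ^ 2 := by
      field_simp
    rw [this, div_le_iff₀ (by positivity)]
    have h1 := hkey y
    have h2 := mul_le_mul_of_nonneg_left h1 hjpos.le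
    have h3 := mul_le_mul_of_nonneg_right hjle (hMn y)
    linarith
  · rw [← htr]
    have : 8 * K * n * (M j j / (8 * K * V)) = n * M j j / V := by field_simp
    rw [this]
    refine div_le_div_of_nonneg_right ?_ hVpos.le
    rw [div_le_iff₀ hnR] at hj
    linarith

/-- Adding at most `K` small waves keeps the gap form positive. -/
lemma quad_gapMat_perturb_pos {ι : Type*} {e : ℝ} {v dv y : Rn n}
    {u du : Matrix (Fin n) (Fin n) ℝ} {K V μ δ ε : ℝ} (hK : 1 ≤ K) (hV : 0 ≤ V)
    (hδ : 0 ≤ δ) (hε : 0 ≤ ε) (hε1 : ε ≤ 1)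
    (hy : ‖y‖ = 1) (hv : ‖v‖ ≤ V) (hμ : μ ≤ quad (gapMat e v u) y)
    (s : Finset ι) (hs : (s.card : ℝ) ≤ K)
    {eh α ρ κ : ι → ℝ} {vh a b : ι → Rn n} {Q : ι → ℝ}
    (hdec : ∀ i ∈ s, vh i = (inner ℝ (vh i) (a i) : ℝ) • a i + κ i • b i)
    (hα : ∀ i ∈ s, |α i| ≤ ρ i) (hρV : ∀ i ∈ s, ρ i ≤ V) (ha : ∀ i ∈ s, ‖a i‖ = 1)
    (hvh : ∀ i ∈ s, ‖vh i‖ ≤ √(2 * eh i))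
    (h1 : ∀ i ∈ s, ρ i * inner ℝ (a i) y ^ 2 * (8 * K * √(2 * eh i)) ≤ Q i)
    (h2 : ∀ i ∈ s, (ρ i * inner ℝ (a i) y) ^ 2 * (8 * K) ^ 2 ≤ Q i)
    (hQ : ∀ i ∈ s, Q i ≤ quad (gapMat e v u) y + δ) (hvv : ∀ i ∈ s, ‖v - vh i‖ ≤ δ)
    (hdv : |inner ℝ dv y - ∑ i ∈ s, α i * inner ℝ (a i) y| ≤ ε)
    (hdu : |quad du y - ∑ i ∈ s, 2 * κ i * α i * (inner ℝ (a i) y * inner ℝ (b i) y)| ≤ ε)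
    (hsmall : (1 + 2 * K * V) * δ + (2 * V + 2 * K * V + 2) * ε < μ / 2) :
    0 < quad (gapMat e (v + dv) (u + du)) y := by
  set X := ∑ i ∈ s, α i * inner ℝ (a i) y with hX
  set Y := ∑ i ∈ s, 2 * κ i * α i * (inner ℝ (a i) y * inner ℝ (b i) y) with hY
  set m := quad (gapMat e v u) y with hm
  have hK0 : 0 < K := by linarith
  have inner1 : ∀ w : Rn n, |inner ℝ w y| ≤ ‖w‖ := fun w => by
    simpa [hy] using abs_real_inner_le_norm w y
  have ainner : ∀ i ∈ s, |inner ℝ (a i) y| ≤ 1 := fun i hi => (ha i hi) ▸ inner1 (a i)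
  have exp : quad (gapMat e (v + dv) (u + du)) y
      = m - 2 * inner ℝ v y * inner ℝ dv y - inner ℝ dv y ^ 2 + quad du y := by
    rw [hm, quad_gapMat, quad_gapMat, quad_add_mat, inner_add_left]
    ring
  have hm0 : 0 ≤ m + δ := by
    have : 0 ≤ (1 + 2 * K * V) * δ + (2 * V + 2 * K * V + 2) * ε := by positivity
    linarith
  have hXle : |X| ≤ K * V := by
    calc |X| ≤ ∑ i ∈ s, |α i * inner ℝ (a i) y| := Finset.abs_sum_le_sum_abs _ _
      _ ≤ ∑ _i ∈ s, V := by
        refine Finset.sum_le_sum fun i hi => ?_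
        rw [abs_mul]
        have := hα i hi
        have := hρV i hi
        have := ainner i hi
        nlinarith [abs_nonneg (α i), abs_nonneg (inner ℝ (a i) y)]
      _ = s.card * V := by rw [Finset.sum_const, nsmul_eq_mul]
      _ ≤ K * V := mul_le_mul_of_nonneg_right hs hV
  -- Cauchy–Schwarz over at most K active waves; 64K² is the (8K)² of the hypothesis `h2`.
  have hXsq : X ^ 2 ≤ (m + δ) / 64 := by
    have c1 : X ^ 2 ≤ s.card * ∑ i ∈ s, (α i * inner ℝ (a i) y) ^ 2 := sq_sum_le_card_mul_sum_sq
    have c2 : ∑ i ∈ s, (α i * inner ℝ (a i) y) ^ 2 ≤ ∑ _i ∈ s, (m + δ) / (64 * K ^ 2) := by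
      refine Finset.sum_le_sum fun i hi => ?_
      rw [le_div_iff₀ (by positivity)]
      have d1 := (h2 i hi).trans (hQ i hi)
      have d2 : (α i * inner ℝ (a i) y) ^ 2 ≤ (ρ i * inner ℝ (a i) y) ^ 2 := by
        rw [mul_pow, mul_pow]
        refine mul_le_mul_of_nonneg_right ?_ (sq_nonneg _)
        rw [← sq_abs (α i)]
        exact pow_le_pow_left₀ (abs_nonneg _) (hα i hi) 2
      nlinarith [mul_le_mul_of_nonneg_right d2 (sq_nonneg K)]
    rw [Finset.sum_const, nsmul_eq_mul] at c2
    have c3 : (s.card : ℝ) * (s.card * ((m + δ) / (64 * K ^ 2))) ≤ K * (K * ((m + δ) / (64 * K ^ 2))) := by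
      gcongr
    have c4 : K * (K * ((m + δ) / (64 * K ^ 2))) = (m + δ) / 64 := by field_simp
    have c5 := mul_le_mul_of_nonneg_left c2 (Nat.cast_nonneg (α := ℝ) s.card)
    linarith
  -- The stress cancels the b-components of the frozen velocities. What remains is
  -- (v_i·a_i)(a_i·y)², absorbed by the form through `h1`, and the oscillation of v around its
  -- frozen value, of size δ.
  have hlin : -((m + δ) / 4 + 2 * K * V * δ) ≤ Y - 2 * inner ℝ v y * X := by
    have e1 : Y - 2 * inner ℝ v y * X = ∑ i ∈ s, -(2 * α i * inner ℝ (a i) y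
        * (inner ℝ (v - vh i) y + inner ℝ (vh i) (a i) * inner ℝ (a i) y)) := by
      rw [hY, hX, Finset.mul_sum, ← Finset.sum_sub_distrib]
      refine Finset.sum_congr rfl fun i hi => ?_
      have : inner ℝ (vh i) y = inner ℝ (vh i) (a i) * inner ℝ (a i) y + κ i * inner ℝ (b i) y := by
        conv_lhs => rw [hdec i hi, inner_add_left, real_inner_smul_left, real_inner_smul_left]
      rw [inner_sub_left, this]
      ring
    have e2 : ∑ _i ∈ s, -((m + δ) / (4 * K) + 2 * V * δ) ≤ Y - 2 * inner ℝ v y * X := by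
      rw [e1]
      refine Finset.sum_le_sum fun i hi => ?_
      have hρ0 : 0 ≤ ρ i := (abs_nonneg _).trans (hα i hi)
      have f1 : |α i * inner ℝ (a i) y * inner ℝ (v - vh i) y| ≤ V * 1 * δ := by
        rw [abs_mul, abs_mul]
        have := (hα i hi).trans (hρV i hi)
        have := ainner i hi
        have := (inner1 (v - vh i)).trans (hvv i hi)
        gcongr
      have f2 : |α i * inner ℝ (vh i) (a i) * inner ℝ (a i) y ^ 2| ≤ (m + δ) / (8 * K) := by
        rw [abs_mul, abs_mul, abs_of_nonneg (sq_nonneg (inner ℝ (a i) y)),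
          le_div_iff₀ (by positivity)]
        have g1 : |inner ℝ (vh i) (a i)| ≤ √(2 * eh i) := by
          have := abs_real_inner_le_norm (vh i) (a i)
          rw [ha i hi, mul_one] at this
          exact this.trans (hvh i hi)
        have g2 := (h1 i hi).trans (hQ i hi)
        calc |α i| * |inner ℝ (vh i) (a i)| * inner ℝ (a i) y ^ 2 * (8 * K)
            ≤ ρ i * √(2 * eh i) * inner ℝ (a i) y ^ 2 * (8 * K) := by
              have := hα i hi
              gcongr
          _ = ρ i * inner ℝ (a i) y ^ 2 * (8 * K * √(2 * eh i)) := by ring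
          _ ≤ m + δ := g2
      have f3 : (m + δ) / (4 * K) = 2 * ((m + δ) / (8 * K)) := by ring
      have f1' := (abs_le.mp f1).2
      have f2' := (abs_le.mp f2).2
      rw [f3]
      nlinarith
    rw [Finset.sum_const, nsmul_eq_mul] at e2
    have e3 : (s.card : ℝ) * ((m + δ) / (4 * K) + 2 * V * δ)
        ≤ K * ((m + δ) / (4 * K) + 2 * V * δ) := by gcongr
    have e4 : K * ((m + δ) / (4 * K) + 2 * V * δ) = (m + δ) / 4 + 2 * K * V * δ := by field_simp
    linarith
  set r₁ := inner ℝ dv y - X with hr₁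
  set r₂ := quad du y - Y with hr₂
  have s1 : inner ℝ dv y = X + r₁ := by ring
  have s2 : quad du y = Y + r₂ := by ring
  -- The total loss is at most (1/64 + 1/4)(m + δ) + 2KVδ + (2V + 2KV + 2)ε, which is below m
  -- because m ≥ μ and `hsmall` bounds the errors by μ/2.
  rw [exp, s1, s2]
  have t1 : |inner ℝ v y * r₁| ≤ V * ε := by
    rw [abs_mul]; exact mul_le_mul ((inner1 v).trans hv) hdv (abs_nonneg _) hV
  have t2 : |X * r₁| ≤ K * V * ε := by
    rw [abs_mul]; exact mul_le_mul hXle hdv (abs_nonneg _) (by positivity)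
  have t3 : r₁ ^ 2 ≤ ε := by
    rw [← sq_abs]
    nlinarith [abs_nonneg r₁]
  have t1' := (abs_le.mp t1).2
  have t2' := (abs_le.mp t2).2
  have t4' := (abs_le.mp hdu).1
  have hKVδ : 0 ≤ K * V * δ := by positivity
  nlinarith

end PointwiseGeometry

/-! ### Calculus of O(1/N) quantities. -/

section Decay

/-- `I N x` is `O(1/N)` uniformly in `x`. -/
def Decays {X : Type*} (I : ℝ → X → ℝ) : Prop :=
  ∃ C, 0 ≤ C ∧ ∀ N, 1 ≤ N → ∀ x, |I N x| ≤ C / N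

variable {X : Type*} {I J : ℝ → X → ℝ}

lemma Decays.add (hI : Decays I) (hJ : Decays J) : Decays fun N x => I N x + J N x := by
  obtain ⟨C, hC, h⟩ := hI
  obtain ⟨D, hD, k⟩ := hJ
  refine ⟨C + D, by positivity, fun N hN x => (abs_add_le _ _).trans ?_⟩
  rw [add_div]
  exact add_le_add (h N hN x) (k N hN x)

lemma Decays.const_mul (hI : Decays I) (c : ℝ) : Decays fun N x => c * I N x := by
  obtain ⟨C, hC, h⟩ := hI
  refine ⟨|c| * C, by positivity, fun N hN x => ?_⟩
  rw [abs_mul, mul_div_assoc]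
  exact mul_le_mul_of_nonneg_left (h N hN x) (abs_nonneg _)

lemma Decays.zero : Decays fun (_ : ℝ) (_ : X) => 0 := ⟨0, le_rfl, fun N hN x => by simp⟩

lemma Decays.sum {ι : Type*} (s : Finset ι) {I : ι → ℝ → X → ℝ} (h : ∀ i ∈ s, Decays (I i)) :
    Decays fun N x => ∑ i ∈ s, I i N x := by
  classical
  induction s using Finset.induction_on with
  | empty => simpa using Decays.zero
  | insert i s hi ih =>
    have := (h i (Finset.mem_insert_self i s)).add
      (ih fun j hj => h j (Finset.mem_insert_of_mem hj))
    simpa [Finset.sum_insert hi] using this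

lemma Decays.mono (hI : Decays I) (h : ∀ N, 1 ≤ N → ∀ x, |J N x| ≤ |I N x|) : Decays J := by
  obtain ⟨C, hC, k⟩ := hI
  exact ⟨C, hC, fun N hN x => (h N hN x).trans (k N hN x)⟩

lemma Decays.eventually_le (hI : Decays I) {η : ℝ} (hη : 0 < η) :
    ∀ᶠ N in atTop, ∀ x, |I N x| ≤ η := by
  obtain ⟨C, hC, h⟩ := hI
  filter_upwards [eventually_ge_atTop (max 1 (C / η))] with N hN x
  have h1 : 1 ≤ N := (le_max_left _ _).trans hN
  refine (h N h1 x).trans ?_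
  rw [div_le_iff₀ (by linarith)]
  have := (le_max_right _ _).trans hN
  rw [div_le_iff₀ hη] at this
  linarith

/-- Rescaling the frequency by a factor `≥ 1`. -/
lemma Decays.scale (hI : Decays I) {k : ℝ} (hk : 1 ≤ k) : Decays fun N x => I (k * N) x := by
  obtain ⟨C, hC, h⟩ := hI
  refine ⟨C, hC, fun N hN x => (h (k * N) (by nlinarith) x).trans ?_⟩
  exact div_le_div_of_nonneg_left hC (by linarith) (by nlinarith)

end Decay


/-! ### Sums and bounds of quadratic forms. -/

section QuadSums

variable {n : ℕ}

lemma quad_sum {ι : Type*} (s : Finset ι) (N : ι → Matrix (Fin n) (Fin n) ℝ) (y : Rn n) :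
    quad (∑ i ∈ s, N i) y = ∑ i ∈ s, quad (N i) y := by
  classical
  induction s using Finset.induction_on with
  | empty => simp [quad]
  | insert i s hi ih => rw [Finset.sum_insert hi, Finset.sum_insert hi, quad_add_mat, ih]

lemma abs_quad_le (M : Matrix (Fin n) (Fin n) ℝ) {y : Rn n} (hy : ‖y‖ = 1) :
    |quad M y| ≤ ∑ i, ∑ j, |M i j| := by
  refine (Finset.abs_sum_le_sum_abs _ _).trans (Finset.sum_le_sum fun i _ => ?_)
  refine (Finset.abs_sum_le_sum_abs _ _).trans (Finset.sum_le_sum fun j _ => ?_)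
  have h1 := abs_apply_le_norm y i
  have h2 := abs_apply_le_norm y j
  rw [hy] at h1 h2
  rw [abs_mul, abs_mul, mul_assoc]
  exact mul_le_of_le_one_right (abs_nonneg _) (mul_le_one₀ h1 (abs_nonneg _) h2)

lemma quad_sym_tensor (c : ℝ) (a b y : Rn n) :
    quad (Matrix.of fun i j => c * (a i * b j + b i * a j)) y
      = 2 * c * (inner ℝ a y * inner ℝ b y) := by
  have : (Matrix.of fun i j => c * (a i * b j + b i * a j))
      = c • (Matrix.of fun i j => a i * b j) + c • (Matrix.of fun i j => b i * a j) := by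
    ext i j; simp; ring
  rw [this, quad_add_mat, quad_smul_mat, quad_smul_mat, quad_tensor, quad_tensor]
  ring

lemma quad_pos_of_unit {M : Matrix (Fin n) (Fin n) ℝ} (h : ∀ y, ‖y‖ = 1 → 0 < quad M y)
    {y : Rn n} (hy : y ≠ 0) : 0 < quad M y := by
  have hy' : 0 < ‖y‖ := norm_pos_iff.mpr hy
  have h1 := h (‖y‖⁻¹ • y) (norm_smul_inv_norm hy)
  rw [quad_smul] at h1
  exact pos_of_mul_pos_right h1 (by positivity)

end QuadSums

/-- Used for fields that are smooth only on the open slab: multiplied by a compactly supported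
amplitude, or after subtraction of the background, they become globally smooth. -/
lemma contDiff_of_contDiffOn_of_tsupport {V F : Type*} [NormedAddCommGroup V] [NormedSpace ℝ V]
    [NormedAddCommGroup F] [NormedSpace ℝ F] {f : V → F} {U : Set V} (hU : IsOpen U)
    (hf : ContDiffOn ℝ ∞ f U) (hs : tsupport f ⊆ U) : ContDiff ℝ ∞ f := by
  rw [contDiff_iff_contDiffAt]
  intro z
  by_cases hz : z ∈ tsupport f
  · exact hf.contDiffAt (hU.mem_nhds (hs hz))
  · have h0 : f =ᶠ[𝓝 z] fun _ => 0 := notMem_tsupport_iff_eventuallyEq.mp hz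
    exact contDiffAt_const.congr_of_eventuallyEq h0

lemma tsupport_subset_of_forall_notMem {V F : Type*} [TopologicalSpace V] [Zero F] {f : V → F}
    {C : Set V} (hC : IsClosed C) (h : ∀ z, z ∉ C → f z = 0) : tsupport f ⊆ C :=
  closure_minimal (fun z hz => by by_contra h0; exact hz (h z h0)) hC

/-! ### Uniformity of the subsolution condition on compact sets. -/

section LocalUniformity

variable {n : ℕ} {T : ℝ} {Ω : Set (Rn n)} {ebar : Rn n → ℝ → ℝ} {v₀ : Rn n → ℝ → Rn n}
  {u₀ : Rn n → ℝ → Matrix (Fin n) (Fin n) ℝ} {q₀ : Rn n → ℝ → ℝ} {v : Rn n → ℝ → Rn n}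
  {u : Rn n → ℝ → Matrix (Fin n) (Fin n) ℝ}

lemma Subsolution.gap_pos (h : Subsolution T Ω ebar v₀ u₀ q₀ v u) (hn : 0 < n) {x : Rn n}
    (hx : x ∈ Ω) {t : ℝ} (ht : t ∈ Ioo 0 T) : 0 < 2 * ebar x t - ‖v x t‖ ^ 2 :=
  Euler.gap_pos hn (h.sol.traceless x t ht) (h.pos x hx t ht)

lemma Subsolution.two_mul_energy_pos (h : Subsolution T Ω ebar v₀ u₀ q₀ v u) (hn : 0 < n)
    {x : Rn n} (hx : x ∈ Ω) {t : ℝ} (ht : t ∈ Ioo 0 T) : 0 < 2 * ebar x t := by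
  nlinarith [h.gap_pos hn hx ht, sq_nonneg ‖v x t‖]

lemma Subsolution.norm_le (h : Subsolution T Ω ebar v₀ u₀ q₀ v u) (hn : 0 < n) {x : Rn n}
    (hx : x ∈ Ω) {t : ℝ} (ht : t ∈ Ioo 0 T) : ‖v x t‖ ≤ √(2 * ebar x t) := by
  refine Real.le_sqrt_of_sq_le ?_
  linarith [h.gap_pos hn hx ht]

lemma Subsolution.continuousOn_entry (h : Subsolution T Ω ebar v₀ u₀ q₀ v u)
    (he : ContinuousOn (fun p : Rn n × ℝ => ebar p.1 p.2) (Ω ×ˢ Ioo 0 T)) (i j : Fin n) :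
    ContinuousOn (fun p : Rn n × ℝ => gapMat (ebar p.1 p.2) (v p.1 p.2) (u p.1 p.2) i j)
      (Ω ×ˢ Ioo 0 T) := by
  have hsub : Ω ×ˢ Ioo 0 T ⊆ univ ×ˢ Ioo 0 T := prod_mono (subset_univ _) le_rfl
  have hu := (ContDiffOn.continuousOn (h.sol.smooth_u i j)).mono hsub
  have hv := fun i => (ContDiffOn.continuousOn (h.sol.smooth_v.coord i)).mono hsub
  simp only [gapMat_apply]
  refine ContinuousOn.add (ContinuousOn.sub ?_ ((hv i).mul (hv j))) hu
  split_ifs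
  · exact (continuousOn_const.mul he).div_const _
  · exact continuousOn_const

lemma Subsolution.continuousOn_rate (h : Subsolution T Ω ebar v₀ u₀ q₀ v u) (hn : 0 < n)
    (he : ContinuousOn (fun p : Rn n × ℝ => ebar p.1 p.2) (Ω ×ˢ Ioo 0 T)) :
    ContinuousOn (fun p : Rn n × ℝ =>
      (2 * ebar p.1 p.2 - ‖v p.1 p.2‖ ^ 2) / √(2 * ebar p.1 p.2)) (Ω ×ˢ Ioo 0 T) := by
  have hsub : Ω ×ˢ Ioo 0 T ⊆ univ ×ˢ Ioo 0 T := prod_mono (subset_univ _) le_rfl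
  have hv := (ContDiffOn.continuousOn h.sol.smooth_v).mono hsub
  refine ContinuousOn.div ((continuousOn_const.mul he).sub (hv.norm.pow 2))
    (Real.continuous_sqrt.comp_continuousOn (continuousOn_const.mul he)) ?_
  rintro ⟨x, t⟩ ⟨hx, ht⟩
  exact (Real.sqrt_pos.mpr (h.two_mul_energy_pos hn hx ht)).ne'

/-- Bounds on a compact neighbourhood. -/
lemma Subsolution.exists_compact_bounds (h : Subsolution T Ω ebar v₀ u₀ q₀ v u)
    (he : ContinuousOn (fun p : Rn n × ℝ => ebar p.1 p.2) (Ω ×ˢ Ioo 0 T)) {C : Set (Rn n × ℝ)}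
    (hC : IsCompact C) (hCU : C ⊆ Ω ×ˢ Ioo 0 T) :
    ∃ V μ : ℝ, 0 < V ∧ 0 < μ ∧ (∀ w ∈ C, √(2 * ebar w.1 w.2) ≤ V) ∧
      ∀ w ∈ C, ∀ y, ‖y‖ = 1 → μ ≤ quad (gapMat (ebar w.1 w.2) (v w.1 w.2) (u w.1 w.2)) y := by
  obtain ⟨V, hV⟩ := hC.exists_bound_of_continuousOn
    (Real.continuous_sqrt.comp_continuousOn (continuousOn_const.mul (he.mono hCU)) :
      ContinuousOn (fun w : Rn n × ℝ => √(2 * ebar w.1 w.2)) C)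
  have hcont : ContinuousOn (fun p : (Rn n × ℝ) × Rn n =>
      quad (gapMat (ebar p.1.1 p.1.2) (v p.1.1 p.1.2) (u p.1.1 p.1.2)) p.2)
      (C ×ˢ Metric.sphere 0 1) := by
    refine continuousOn_finsetSum _ fun i _ => continuousOn_finsetSum _ fun j _ => ?_
    have h1 : ContinuousOn (fun p : (Rn n × ℝ) × Rn n =>
        gapMat (ebar p.1.1 p.1.2) (v p.1.1 p.1.2) (u p.1.1 p.1.2) i j)
        (C ×ˢ Metric.sphere 0 1) :=
      ((h.continuousOn_entry he i j).mono hCU).comp continuousOn_fst fun p hp => hp.1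
    refine (h1.mul (Continuous.continuousOn ?_)).mul (Continuous.continuousOn ?_)
    · exact (EuclideanSpace.proj (𝕜 := ℝ) i).continuous.comp continuous_snd
    · exact (EuclideanSpace.proj (𝕜 := ℝ) j).continuous.comp continuous_snd
  obtain ⟨μ, hμ, hμ'⟩ := (hC.prod (isCompact_sphere (0 : Rn n) 1)).exists_forall_le' hcont
    (a := 0) (by
      rintro ⟨⟨x, t⟩, y⟩ ⟨hw, hy⟩
      have hU := hCU hw
      exact h.pos x hU.1 t hU.2 y (by rintro rfl; simp at hy))
  refine ⟨|V| + 1, μ, by positivity, hμ, fun w hw => ?_, fun w hw y hy => ?_⟩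
  · have h1 : ‖√(2 * ebar w.1 w.2)‖ ≤ V := hV w hw
    rw [Real.norm_eq_abs, abs_of_nonneg (Real.sqrt_nonneg _)] at h1
    linarith [le_abs_self V]
  · exact hμ' (w, y) ⟨hw, by simpa using hy⟩

/-- Lets the oscillation frame be frozen at the centre of each bump: over small distances the gap
form changes by at most δ on unit vectors and the gain rate by at most a factor 2. -/
lemma Subsolution.exists_radius (h : Subsolution T Ω ebar v₀ u₀ q₀ v u) (hn : 0 < n)
    (he : ContinuousOn (fun p : Rn n × ℝ => ebar p.1 p.2) (Ω ×ˢ Ioo 0 T)) {C : Set (Rn n × ℝ)}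
    (hC : IsCompact C) (hCU : C ⊆ Ω ×ˢ Ioo 0 T) {δ : ℝ} (hδ : 0 < δ) :
    ∃ r > 0, ∀ w ∈ C, ∀ z ∈ C, dist w z ≤ r →
      ‖v w.1 w.2 - v z.1 z.2‖ ≤ δ ∧
      (∀ y, ‖y‖ = 1 → quad (gapMat (ebar z.1 z.2) (v z.1 z.2) (u z.1 z.2)) y
        ≤ quad (gapMat (ebar w.1 w.2) (v w.1 w.2) (u w.1 w.2)) y + δ) ∧
      (2 * ebar w.1 w.2 - ‖v w.1 w.2‖ ^ 2) / √(2 * ebar w.1 w.2)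
        ≤ 2 * ((2 * ebar z.1 z.2 - ‖v z.1 z.2‖ ^ 2) / √(2 * ebar z.1 z.2)) := by
  have hsub : Ω ×ˢ Ioo 0 T ⊆ univ ×ˢ Ioo 0 T := prod_mono (subset_univ _) le_rfl
  have hr := (h.continuousOn_rate hn he).mono hCU
  obtain ⟨ν, hν, hν'⟩ := hC.exists_forall_le' hr (a := 0) (by
    rintro ⟨x, t⟩ hw
    have hU := hCU hw
    exact div_pos (h.gap_pos hn hU.1 hU.2)
      (Real.sqrt_pos.mpr (h.two_mul_energy_pos hn hU.1 hU.2)))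
  let F : Rn n × ℝ → Rn n × (Fin n → Fin n → ℝ) × ℝ := fun w =>
    (v w.1 w.2, fun i j => gapMat (ebar w.1 w.2) (v w.1 w.2) (u w.1 w.2) i j,
      (2 * ebar w.1 w.2 - ‖v w.1 w.2‖ ^ 2) / √(2 * ebar w.1 w.2))
  have hF : ContinuousOn F C := by
    refine ContinuousOn.prodMk (((ContDiffOn.continuousOn h.sol.smooth_v).mono hsub).mono hCU)
      (ContinuousOn.prodMk ?_ hr)
    exact continuousOn_pi.mpr fun i => continuousOn_pi.mpr fun j =>
      (h.continuousOn_entry he i j).mono hCU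
  have hunif := hC.uniformContinuousOn_of_continuous hF
  rw [Metric.uniformContinuousOn_iff] at hunif
  -- The form involves n² entries, hence the division. The minimum with the lower bound ν of the
  -- rate turns an additive error into the factor 2.
  set ε := min (δ / (n ^ 2 + 1)) ν with hε
  have hε0 : 0 < ε := lt_min (by positivity) hν
  have hεδ : ε * n ^ 2 ≤ δ ∧ ε ≤ δ := by
    have h1 : ε ≤ δ / (n ^ 2 + 1) := min_le_left _ _
    rw [le_div_iff₀ (by positivity)] at h1
    constructor <;> nlinarith [sq_nonneg (n : ℝ)]
  obtain ⟨r, hr0, hr'⟩ := hunif ε hε0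
  refine ⟨r / 2, by positivity, fun w hw z hz hd => ?_⟩
  have hdist := hr' w hw z hz (by linarith)
  rw [Prod.dist_eq, max_lt_iff, Prod.dist_eq, max_lt_iff] at hdist
  obtain ⟨h1, h2, h3⟩ := hdist
  refine ⟨?_, fun y hy => ?_, ?_⟩
  · have h1' : ‖v w.1 w.2 - v z.1 z.2‖ < ε := by rw [← dist_eq_norm]; exact h1
    exact h1'.le.trans hεδ.2
  · have h4 := abs_quad_le (gapMat (ebar z.1 z.2) (v z.1 z.2) (u z.1 z.2)
      - gapMat (ebar w.1 w.2) (v w.1 w.2) (u w.1 w.2)) hy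
    rw [quad_sub_mat] at h4
    have h5 : ∑ i, ∑ j, |(gapMat (ebar z.1 z.2) (v z.1 z.2) (u z.1 z.2)
        - gapMat (ebar w.1 w.2) (v w.1 w.2) (u w.1 w.2)) i j| ≤ ∑ _i : Fin n, ∑ _j : Fin n, ε := by
      refine Finset.sum_le_sum fun i _ => Finset.sum_le_sum fun j _ => ?_
      have h6 := (dist_pi_lt_iff hε0).mp ((dist_pi_lt_iff hε0).mp h2 i) j
      rw [dist_comm, Real.dist_eq] at h6
      exact h6.le
    simp only [Finset.sum_const, Finset.card_univ, Fintype.card_fin, nsmul_eq_mul] at h5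
    have h7 := (abs_le.mp (h4.trans h5)).2
    have h8 : (n : ℝ) * (n * ε) = ε * n ^ 2 := by ring
    linarith [hεδ.1]
  · have h4 := (abs_lt.mp (by rw [← Real.dist_eq]; exact h3 :
      |(F w).2.2 - (F z).2.2| < ε)).2
    have h5 := hν' z hz
    have h6 : ε ≤ ν := min_le_right _ _
    change (2 * ebar w.1 w.2 - ‖v w.1 w.2‖ ^ 2) / √(2 * ebar w.1 w.2)
      - (2 * ebar z.1 z.2 - ‖v z.1 z.2‖ ^ 2) / √(2 * ebar z.1 z.2) < ε at h4
    linarith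

end LocalUniformity


/-! ### Families of waves with distinct frequencies. -/

/-- The linear phase `b · x - κ t`. -/
def phase {n : ℕ} (b : Rn n) (κ : ℝ) : Rn n × ℝ →L[ℝ] ℝ :=
  (innerSL ℝ b).comp (ContinuousLinearMap.fst ℝ (Rn n) ℝ)
    - κ • ContinuousLinearMap.snd ℝ (Rn n) ℝ

/-- The potential of a localized plane wave of amplitude `g`, frequency `N` and phase `ℓ`. -/
def potential {V : Type*} [NormedAddCommGroup V] [NormedSpace ℝ V] (N : ℝ) (g : V → ℝ)
    (ℓ : V →L[ℝ] ℝ) (z : V) : ℝ :=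
  (-(N ^ 3)⁻¹ * g z) * Real.sin ((N • ℓ) z)

/-- A finite family of localized plane waves. -/
structure WaveFamily (n m : ℕ) where
  a : Fin m → Rn n
  b : Fin m → Rn n
  κ : Fin m → ℝ
  g : Fin m → Rn n × ℝ → ℝ
  norm_a : ∀ i, ‖a i‖ = 1
  norm_b : ∀ i, ‖b i‖ = 1
  inner_ab : ∀ i, inner ℝ (a i) (b i) = 0
  smooth : ∀ i, ContDiff ℝ ∞ (g i)

namespace WaveFamily

variable {n m : ℕ} (W : WaveFamily n m)

/-- The relative frequencies, chosen pairwise distinct. -/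
def freq (i : Fin m) : ℝ := (i : ℕ) + 1

lemma one_le_freq (i : Fin m) : 1 ≤ freq i := by
  simp [freq]

/-- The oscillating factor of the `i`-th wave. -/
def osc (N : ℝ) (i : Fin m) (w : Rn n × ℝ) : ℝ :=
  Real.cos (((freq i * N) • phase (W.b i) (W.κ i)) w)

/-- The velocity of the family. -/
def vel (N : ℝ) (x : Rn n) (t : ℝ) : Rn n :=
  ∑ i, waveV (W.a i) (W.b i) (potential (freq i * N) (W.g i) (phase (W.b i) (W.κ i))) x t

/-- The stress of the family. -/
def stress (N : ℝ) (x : Rn n) (t : ℝ) : Matrix (Fin n) (Fin n) ℝ :=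
  ∑ i, waveU (W.a i) (W.b i) (potential (freq i * N) (W.g i) (phase (W.b i) (W.κ i))) x t

/-- The leading part of the velocity. -/
def lead (N : ℝ) (w : Rn n × ℝ) : Rn n := ∑ i, (W.g i w * W.osc N i w) • W.a i

lemma phase_apply (b : Rn n) (κ : ℝ) (x : Rn n) (t : ℝ) :
    phase b κ (x, t) = inner ℝ b x - κ * t := by
  simp [phase]

lemma contDiff_potential {V : Type*} [NormedAddCommGroup V] [NormedSpace ℝ V] (N : ℝ) {g : V → ℝ}
    (ℓ : V →L[ℝ] ℝ) (hg : ContDiff ℝ ∞ g) : ContDiff ℝ ∞ (potential N g ℓ) :=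
  (contDiff_const.mul hg).mul (Real.contDiff_sin.comp (N • ℓ).contDiff)

lemma tsupport_potential_subset {V : Type*} [NormedAddCommGroup V] [NormedSpace ℝ V] (N : ℝ)
    (g : V → ℝ) (ℓ : V →L[ℝ] ℝ) : tsupport (potential N g ℓ) ⊆ tsupport g := by
  refine closure_mono fun z hz => ?_
  intro h0
  exact hz (by simp [potential, h0])

lemma isSmoothLinearSolution (T N : ℝ) :
    IsSmoothLinearSolution T (W.vel N) (W.stress N) (fun _ _ => 0) :=
  IsSmoothLinearSolution.sum _ fun i _ => isSmoothLinearSolution_wave T (W.norm_a i) (W.norm_b i)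
    (W.inner_ab i) (contDiff_potential _ _ (W.smooth i))

lemma contDiff_vel (N : ℝ) : ContDiff ℝ ∞ fun p : Rn n × ℝ => W.vel N p.1 p.2 :=
  ContDiff.sum fun i _ => contDiff_waveV _ _ (contDiff_potential _ _ (W.smooth i))

lemma continuous_osc (N : ℝ) (i : Fin m) : Continuous (W.osc N i) :=
  Real.continuous_cos.comp (ContinuousLinearMap.continuous _)

variable {C : Set (Rn n × ℝ)}

lemma vel_eq_zero (hC : IsClosed C) (h0 : ∀ i z, z ∉ C → W.g i z = 0) (N : ℝ) {x : Rn n} {t : ℝ}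
    (h : (x, t) ∉ C) : W.vel N x t = 0 :=
  Finset.sum_eq_zero fun i _ => waveV_eq_zero fun hz =>
    h (tsupport_subset_of_forall_notMem hC (h0 i) (tsupport_potential_subset _ _ _ hz))

lemma stress_eq_zero (hC : IsClosed C) (h0 : ∀ i z, z ∉ C → W.g i z = 0) (N : ℝ) {x : Rn n}
    {t : ℝ} (h : (x, t) ∉ C) : W.stress N x t = 0 :=
  Finset.sum_eq_zero fun i _ => waveU_eq_zero fun hz =>
    h (tsupport_subset_of_forall_notMem hC (h0 i) (tsupport_potential_subset _ _ _ hz))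

lemma lead_eq_zero (h0 : ∀ i z, z ∉ C → W.g i z = 0) (N : ℝ) {z : Rn n × ℝ} (h : z ∉ C) :
    W.lead N z = 0 :=
  Finset.sum_eq_zero fun i _ => by rw [h0 i z h, zero_mul, zero_smul]

lemma hasCompactSupport_g (hC : IsCompact C) (h0 : ∀ i z, z ∉ C → W.g i z = 0) (i : Fin m) :
    HasCompactSupport (W.g i) := HasCompactSupport.intro hC (h0 i)

/-- The phase is constant along a and has unit derivative along b, so every leading third derivative
involving a vanishes. Its time derivative −κ combines with the minus sign in `waveU` to give stress
+κ times the velocity amplitude. -/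
lemma decays_wave (hC : IsCompact C) (h0 : ∀ i z, z ∉ C → W.g i z = 0) (i : Fin m) :
    Decays (fun N (w : Rn n × ℝ) =>
      ‖waveV (W.a i) (W.b i) (potential (freq i * N) (W.g i) (phase (W.b i) (W.κ i))) w.1 w.2
        - (W.g i w * W.osc N i w) • W.a i‖) ∧
    ∀ k l, Decays (fun N (w : Rn n × ℝ) =>
      waveU (W.a i) (W.b i) (potential (freq i * N) (W.g i) (phase (W.b i) (W.κ i))) w.1 w.2 k l
        - W.κ i * (W.g i w * W.osc N i w) * (W.a i k * W.b i l + W.b i k * W.a i l)) := by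
  obtain ⟨B, hB, h⟩ := exists_wave_bound (W.norm_a i) (W.norm_b i) (W.smooth i)
    (W.hasCompactSupport_g hC h0 i) (phase (W.b i) (W.κ i))
    (by rw [phase_apply, real_inner_comm, W.inner_ab i]; simp)
    (by rw [phase_apply, real_inner_self_eq_norm_sq, W.norm_b i]; simp)
  constructor
  · refine Decays.scale (I := fun N (w : Rn n × ℝ) =>
      ‖waveV (W.a i) (W.b i) (potential N (W.g i) (phase (W.b i) (W.κ i))) w.1 w.2
        - (W.g i w * Real.cos ((N • phase (W.b i) (W.κ i)) w)) • W.a i‖)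
      ⟨B, hB, fun N hN w => ?_⟩ (one_le_freq i)
    rw [abs_norm]
    exact (h N hN w.1 w.2).1
  · intro k l
    refine Decays.scale (I := fun N (w : Rn n × ℝ) =>
      waveU (W.a i) (W.b i) (potential N (W.g i) (phase (W.b i) (W.κ i))) w.1 w.2 k l
        - W.κ i * (W.g i w * Real.cos ((N • phase (W.b i) (W.κ i)) w))
          * (W.a i k * W.b i l + W.b i k * W.a i l))
      ⟨B, hB, fun N hN w => ?_⟩ (one_le_freq i)
    have := (h N hN w.1 w.2).2 k l
    rw [phase_apply, inner_zero_right] at this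
    change |waveU (W.a i) (W.b i) (potential N (W.g i) (phase (W.b i) (W.κ i))) w.1 w.2 k l
      + (0 - W.κ i * 1) * (W.g i w * Real.cos ((N • phase (W.b i) (W.κ i)) w))
          * (W.a i k * W.b i l + W.b i k * W.a i l)| ≤ B / N at this
    refine le_trans (le_of_eq (congrArg abs ?_)) this
    ring

lemma decays_vel_sub_lead (hC : IsCompact C) (h0 : ∀ i z, z ∉ C → W.g i z = 0) :
    Decays fun N (w : Rn n × ℝ) => ‖W.vel N w.1 w.2 - W.lead N w‖ := by
  refine (Decays.sum Finset.univ fun i _ => (W.decays_wave hC h0 i).1).mono fun N _ w => ?_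
  rw [abs_norm, abs_of_nonneg (Finset.sum_nonneg fun i _ => norm_nonneg _), vel, lead,
    ← Finset.sum_sub_distrib]
  exact norm_sum_le _ _

lemma decays_stress (hC : IsCompact C) (h0 : ∀ i z, z ∉ C → W.g i z = 0) :
    Decays fun N (w : Rn n × ℝ) => ∑ k, ∑ l, |(W.stress N w.1 w.2 - ∑ i,
      Matrix.of fun k l => W.κ i * (W.g i w * W.osc N i w)
        * (W.a i k * W.b i l + W.b i k * W.a i l)) k l| := by
  refine Decays.sum _ fun k _ => Decays.sum _ fun l _ => ?_
  refine (Decays.sum Finset.univ fun i _ => (W.decays_wave hC h0 i).2 k l).mono fun N _ w => ?_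
  rw [abs_abs, stress, Matrix.sub_apply, Matrix.sum_apply, Matrix.sum_apply,
    ← Finset.sum_sub_distrib]
  rfl

lemma exists_lead_bound (hC : IsCompact C) (h0 : ∀ i z, z ∉ C → W.g i z = 0) :
    ∃ B, 0 ≤ B ∧ ∀ N w, ‖W.lead N w‖ ≤ B := by
  have h1 : ∀ i, ∃ B, 0 ≤ B ∧ ∀ z, |W.g i z| ≤ B := fun i =>
    exists_bound_of_hasCompactSupport (W.smooth i).continuous (W.hasCompactSupport_g hC h0 i)
  choose B hB0 hB using h1
  refine ⟨∑ i, B i, Finset.sum_nonneg fun i _ => hB0 i, fun N w => ?_⟩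
  refine (norm_sum_le _ _).trans (Finset.sum_le_sum fun i _ => ?_)
  rw [norm_smul, W.norm_a, mul_one, Real.norm_eq_abs, abs_mul]
  exact (mul_le_of_le_one_right (abs_nonneg _) (Real.abs_cos_le_one _)).trans (hB i w)

lemma decays_integral_osc {f : Rn n × ℝ → ℝ} (hf : ContDiff ℝ ∞ f) (hs : HasCompactSupport f)
    (ℓ : Rn n × ℝ →L[ℝ] ℝ) {b : Rn n} (hb : ℓ (b, 0) ≠ 0) :
    Decays fun N t => ∫ x, f (x, t) * Real.cos ((N • ℓ) (x, t)) := by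
  obtain ⟨B, hB, h⟩ := exists_oscillation_bound hf hs ℓ hb
  exact ⟨B, hB, fun N hN t => h N (by linarith) t⟩

/-- A decaying integrand supported in a fixed compact set has decaying slice integrals. -/
lemma decays_slice_integral (hC : IsCompact C) {I : ℝ → Rn n × ℝ → ℝ} (hI : Decays I)
    (h0 : ∀ N z, z ∉ C → I N z = 0) : Decays fun N t => ∫ x, I N (x, t) := by
  obtain ⟨B, hB, h⟩ := hI
  refine ⟨B * volume.real (Prod.fst '' C), by positivity, fun N hN t => ?_⟩
  have := norm_integral_slice_le (f := fun x => I N (x, t)) (hC.image continuous_fst)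
    (fun x => h N hN (x, t)) fun x hx => h0 N _ fun hz => hx ⟨_, hz, rfl⟩
  rw [mul_div_right_comm]
  exact this

/-- The velocity of the family tends weakly to zero, uniformly in time. -/
lemma decays_integral_inner (hC : IsCompact C) (h0 : ∀ i z, z ∉ C → W.g i z = 0)
    {U : Set (Rn n × ℝ)} (hU : IsOpen U) (hCU : C ⊆ U) {Φ : Rn n × ℝ → Rn n}
    (hΦ : ContDiffOn ℝ ∞ Φ U) :
    Decays fun N t => ∫ x, inner ℝ (W.vel N x t) (Φ (x, t)) := by
  have hcl := hC.isClosed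
  obtain ⟨B, hB⟩ := hC.exists_bound_of_continuousOn (hΦ.continuousOn.mono hCU)
  -- The test field is smooth only on U; the amplitude g_i, supported in C ⊆ U, cuts it off to a
  -- smooth compactly supported function.
  let f : Fin m → Rn n × ℝ → ℝ := fun i w => W.g i w * inner ℝ (W.a i) (Φ w)
  have fz : ∀ i z, z ∉ C → f i z = 0 := fun i z hz => by simp [f, h0 i z hz]
  have fsm : ∀ i, ContDiff ℝ ∞ (f i) := fun i =>
    contDiff_of_contDiffOn_of_tsupport hU
      ((W.smooth i).contDiffOn.mul (contDiffOn_const.inner ℝ hΦ))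
      ((tsupport_subset_of_forall_notMem hcl (fz i)).trans hCU)
  have fcs : ∀ i, HasCompactSupport (f i) := fun i => HasCompactSupport.intro hC (fz i)
  let E : ℝ → Rn n × ℝ → ℝ := fun N w => inner ℝ (W.vel N w.1 w.2 - W.lead N w) (Φ w)
  have Ez : ∀ N z, z ∉ C → E N z = 0 := fun N z hz => by
    simp only [E]
    rw [W.vel_eq_zero hcl h0 N (x := z.1) (t := z.2) hz, W.lead_eq_zero h0 N hz]
    simp
  have hE : Decays E := by
    refine ((W.decays_vel_sub_lead hC h0).const_mul |B|).mono fun N _ w => ?_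
    rw [abs_mul, abs_abs, abs_norm]
    by_cases hw : w ∈ C
    · refine (abs_real_inner_le_norm _ _).trans ?_
      rw [mul_comm]
      exact mul_le_mul_of_nonneg_right ((hB w hw).trans (le_abs_self B)) (norm_nonneg _)
    · rw [Ez N w hw, abs_zero]; positivity
  have hsum : Decays fun N t => ∑ i, ∫ x, f i (x, t) * W.osc N i (x, t) := by
    refine Decays.sum _ fun i _ => ?_
    have := (decays_integral_osc (fsm i) (fcs i) (phase (W.b i) (W.κ i)) (b := W.b i)
      (by rw [phase_apply, real_inner_self_eq_norm_sq, W.norm_b i]; simp)).scale (one_le_freq i)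
    exact this
  refine (hsum.add (decays_slice_integral hC hE Ez)).mono fun N _ t => le_of_eq ?_
  congr 1
  have i1 : ∀ i, Integrable fun x => f i (x, t) * W.osc N i (x, t) := fun i =>
    integrable_slice (f := fun w => f i w * W.osc N i w)
      ((fsm i).continuous.mul (W.continuous_osc N i)) (fcs i).mul_right t
  have vsm : ContDiff ℝ ∞ fun w : Rn n × ℝ => inner ℝ (W.vel N w.1 w.2) (Φ w) := by
    refine contDiff_of_contDiffOn_of_tsupport hU ((W.contDiff_vel N).contDiffOn.inner ℝ hΦ)
      ((tsupport_subset_of_forall_notMem hcl fun z hz => ?_).trans hCU)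
    rw [W.vel_eq_zero hcl h0 N (x := z.1) (t := z.2) hz, inner_zero_left]
  have i2 : Integrable fun x => inner ℝ (W.vel N x t) (Φ (x, t)) :=
    integrable_slice (f := fun w : Rn n × ℝ => inner ℝ (W.vel N w.1 w.2) (Φ w)) vsm.continuous
      (HasCompactSupport.intro hC fun z hz => by
        rw [W.vel_eq_zero hcl h0 N (x := z.1) (t := z.2) hz, inner_zero_left]) t
  have e : ∀ x, E N (x, t) = inner ℝ (W.vel N x t) (Φ (x, t))
      - ∑ i, f i (x, t) * W.osc N i (x, t) := by
    intro x
    simp only [E, inner_sub_left, lead, sum_inner, real_inner_smul_left, f]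
    congr 1
    exact Finset.sum_congr rfl fun i _ => by ring
  simp only [e]
  rw [integral_sub i2 (integrable_finsetSum _ fun i _ => i1 i),
    integral_finsetSum _ fun i _ => i1 i]
  ring

/-- The energy of the family equals, up to `O(1/N)`, half of the squared amplitudes. -/
lemma decays_energy (hC : IsCompact C) (h0 : ∀ i z, z ∉ C → W.g i z = 0) :
    Decays fun N t => (∫ x, ‖W.vel N x t‖ ^ 2) - ∑ i, 1 / 2 * ∫ x, W.g i (x, t) ^ 2 := by
  classical
  have hcl := hC.isClosed
  obtain ⟨B, hB0, hB⟩ := W.exists_lead_bound hC h0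
  have gs := W.hasCompactSupport_g hC h0
  let E : ℝ → Rn n × ℝ → ℝ := fun N w => ‖W.vel N w.1 w.2‖ ^ 2 - ‖W.lead N w‖ ^ 2
  have Ez : ∀ N z, z ∉ C → E N z = 0 := fun N z hz => by
    simp only [E]
    rw [W.vel_eq_zero hcl h0 N (x := z.1) (t := z.2) hz, W.lead_eq_zero h0 N hz]
    simp
  have hE : Decays E := by
    obtain ⟨D, hD0, hD⟩ := W.decays_vel_sub_lead hC h0
    refine ⟨D * (2 * B + D), by positivity, fun N hN w => ?_⟩
    have h1 := hD N hN w
    rw [abs_norm] at h1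
    have h2 := hB N w
    have h3 : ‖W.vel N w.1 w.2‖ ≤ ‖W.lead N w‖ + ‖W.vel N w.1 w.2 - W.lead N w‖ := by
      have := norm_add_le (W.lead N w) (W.vel N w.1 w.2 - W.lead N w)
      rwa [add_sub_cancel] at this
    have h4 : |‖W.vel N w.1 w.2‖ - ‖W.lead N w‖| ≤ ‖W.vel N w.1 w.2 - W.lead N w‖ :=
      abs_norm_sub_norm_le _ _
    have h5 : D / N ≤ D := div_le_self hD0 hN
    have h6 : E N w = (‖W.vel N w.1 w.2‖ - ‖W.lead N w‖) * (‖W.vel N w.1 w.2‖ + ‖W.lead N w‖) := by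
      simp only [E]; ring
    rw [h6, abs_mul, abs_of_nonneg (by positivity :
      0 ≤ ‖W.vel N w.1 w.2‖ + ‖W.lead N w‖), mul_div_right_comm]
    exact mul_le_mul (h4.trans h1) (by linarith) (by positivity) (by positivity)
  -- The factor 1/2 comes from cos A cos B = (cos(A + B) + cos(A − B))/2.
  let f : Fin m → Fin m → Rn n × ℝ → ℝ := fun i j w =>
    1 / 2 * inner ℝ (W.a i) (W.a j) * (W.g i w * W.g j w)
  have fsm : ∀ i j, ContDiff ℝ ∞ (f i j) := fun i j =>
    contDiff_const.mul ((W.smooth i).mul (W.smooth j))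
  have fcs : ∀ i j, HasCompactSupport (f i j) := fun i j => (gs i).mul_right.mul_left
  let ℓ : Fin m → Rn n × ℝ →L[ℝ] ℝ := fun i => freq i • phase (W.b i) (W.κ i)
  have hval : ∀ i c, ℓ i (c, 0) = inner ℝ (freq i • W.b i) c := by
    intro i c
    simp [ℓ, phase_apply, real_inner_smul_left]
  have hnorm : ∀ i, ‖freq i • W.b i‖ = freq i := by
    intro i
    rw [norm_smul, W.norm_b, mul_one, Real.norm_eq_abs, abs_of_nonneg]
    linarith [one_le_freq i]
  have hfreq : ∀ i j : Fin m, freq i = freq j → i = j := by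
    intro i j h
    simp only [freq, add_left_inj, Nat.cast_inj] at h
    exact Fin.ext h
  -- The spatial frequencies freq_i b_i have pairwise distinct positive norms, so no sum of two
  -- vanishes, and no difference of two with i ≠ j does. The derivative of the combined phase in the
  -- direction of its own spatial frequency is then nonzero.
  have hcp : ∀ i j, ∃ c, (ℓ i + ℓ j) (c, 0) ≠ 0 := by
    intro i j
    refine ⟨freq i • W.b i + freq j • W.b j, ?_⟩
    rw [add_apply, hval, hval, ← inner_add_left, real_inner_self_eq_norm_sq]
    refine pow_ne_zero _ (norm_ne_zero_iff.mpr fun h => ?_)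
    have hij : i = j := by
      refine hfreq i j ?_
      rw [← hnorm i, ← hnorm j, eq_neg_of_add_eq_zero_left h, norm_neg]
    subst hij
    rw [← two_smul ℝ, smul_eq_zero_iff_right two_ne_zero, ← norm_eq_zero, hnorm] at h
    linarith [one_le_freq i]
  have hcm : ∀ i j, i ≠ j → ∃ c, (ℓ i - ℓ j) (c, 0) ≠ 0 := by
    intro i j hij
    refine ⟨freq i • W.b i - freq j • W.b j, ?_⟩
    rw [sub_apply, hval, hval, ← inner_sub_left, real_inner_self_eq_norm_sq]
    refine pow_ne_zero _ (norm_ne_zero_iff.mpr fun h => hij (hfreq i j ?_))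
    rw [← hnorm i, ← hnorm j, sub_eq_zero.mp h]
  have hint : ∀ (i j : Fin m) (L : Rn n × ℝ →L[ℝ] ℝ) (t : ℝ),
      Integrable fun x => f i j (x, t) * Real.cos (L (x, t)) := fun i j L t =>
    integrable_slice (f := fun w => f i j w * Real.cos (L w))
      ((fsm i j).continuous.mul (Real.continuous_cos.comp L.continuous)) (fcs i j).mul_right t
  -- Every pair averages out except the difference phase for i = j, which is identically zero and
  -- leaves the mean energy.
  have hpair : ∀ i j, Decays fun N t =>
      (∫ x, f i j (x, t) * Real.cos ((N • (ℓ i + ℓ j)) (x, t)))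
      + ((∫ x, f i j (x, t) * Real.cos ((N • (ℓ i - ℓ j)) (x, t)))
        - if i = j then 1 / 2 * ∫ x, W.g i (x, t) ^ 2 else 0) := by
    intro i j
    obtain ⟨c, hc⟩ := hcp i j
    refine (decays_integral_osc (fsm i j) (fcs i j) _ hc).add ?_
    by_cases hij : i = j
    · subst hij
      refine Decays.zero.mono fun N _ t => le_of_eq ?_
      congr 1
      rw [if_pos rfl, ← integral_const_mul, sub_eq_zero]
      refine integral_congr_ae (Eventually.of_forall fun x => ?_)
      simp [f, W.norm_a, sq]
    · obtain ⟨c, hc⟩ := hcm i j hij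
      simpa [hij] using decays_integral_osc (fsm i j) (fcs i j) _ hc
  refine ((Decays.sum Finset.univ fun i _ => Decays.sum Finset.univ fun j _ => hpair i j).add
    (decays_slice_integral hC hE Ez)).mono fun N _ t => le_of_eq ?_
  congr 1
  have hint2 : ∀ i j, Integrable fun x => f i j (x, t) * Real.cos ((N • (ℓ i + ℓ j)) (x, t))
      + f i j (x, t) * Real.cos ((N • (ℓ i - ℓ j)) (x, t)) := fun i j =>
    (hint i j _ t).add (hint i j _ t)
  have elead : ∀ x, ‖W.lead N (x, t)‖ ^ 2 = ∑ i, ∑ j,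
      (f i j (x, t) * Real.cos ((N • (ℓ i + ℓ j)) (x, t))
        + f i j (x, t) * Real.cos ((N • (ℓ i - ℓ j)) (x, t))) := by
    intro x
    rw [← real_inner_self_eq_norm_sq, lead, sum_inner]
    refine Finset.sum_congr rfl fun i _ => ?_
    rw [inner_sum]
    refine Finset.sum_congr rfl fun j _ => ?_
    rw [real_inner_smul_left, real_inner_smul_right]
    have e1 : (N • (ℓ i + ℓ j)) (x, t) = ((freq i * N) • phase (W.b i) (W.κ i)) (x, t)
        + ((freq j * N) • phase (W.b j) (W.κ j)) (x, t) := by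
      simp only [ℓ, smul_apply, add_apply, smul_eq_mul]; ring
    have e2 : (N • (ℓ i - ℓ j)) (x, t) = ((freq i * N) • phase (W.b i) (W.κ i)) (x, t)
        - ((freq j * N) • phase (W.b j) (W.κ j)) (x, t) := by
      simp only [ℓ, smul_apply, sub_apply, smul_eq_mul]; ring
    rw [e1, e2, Real.cos_add, Real.cos_sub]
    simp only [f, osc]
    ring
  have ilead : Integrable fun x => ‖W.lead N (x, t)‖ ^ 2 := by
    simp only [elead]
    exact integrable_finsetSum _ fun i _ => integrable_finsetSum _ fun j _ =>
      hint2 i j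
  have ivel : Integrable fun x => ‖W.vel N x t‖ ^ 2 :=
    integrable_slice (f := fun w : Rn n × ℝ => ‖W.vel N w.1 w.2‖ ^ 2)
      ((W.contDiff_vel N).continuous.norm.pow 2) (HasCompactSupport.intro hC fun z hz => by
        rw [W.vel_eq_zero hcl h0 N (x := z.1) (t := z.2) hz]; simp) t
  have eI : ∫ x, E N (x, t) = (∫ x, ‖W.vel N x t‖ ^ 2) - ∫ x, ‖W.lead N (x, t)‖ ^ 2 :=
    integral_sub ivel ilead
  have eL : ∫ x, ‖W.lead N (x, t)‖ ^ 2 = ∑ i, ∑ j,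
      ((∫ x, f i j (x, t) * Real.cos ((N • (ℓ i + ℓ j)) (x, t)))
        + ∫ x, f i j (x, t) * Real.cos ((N • (ℓ i - ℓ j)) (x, t))) := by
    simp only [elead]
    rw [integral_finsetSum _ fun i _ => integrable_finsetSum _ fun j _ =>
      hint2 i j]
    refine Finset.sum_congr rfl fun i _ => ?_
    rw [integral_finsetSum _ fun j _ => hint2 i j]
    exact Finset.sum_congr rfl fun j _ => integral_add (hint i j _ t) (hint i j _ t)
  rw [eI, eL]
  simp only [← add_sub_assoc, Finset.sum_sub_distrib, Finset.sum_ite_eq, Finset.mem_univ, if_true]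
  ring

end WaveFamily


/-! ### The perturbation step. -/

/-- The fraction of the local gain density which one perturbation is guaranteed to realize. -/
def gainConst (n : ℕ) : ℝ := 1 / (8 * (8 * 2 ^ (n + 1) * n) ^ 2)

lemma gainConst_pos {n : ℕ} (hn : 0 < n) : 0 < gainConst n := by
  have : (0 : ℝ) < n := by exact_mod_cast hn
  unfold gainConst
  positivity

section Perturbation

variable {n : ℕ} {T : ℝ} {Ω : Set (Rn n)} {ebar : Rn n → ℝ → ℝ} {v₀ : Rn n → ℝ → Rn n}
  {u₀ : Rn n → ℝ → Matrix (Fin n) (Fin n) ℝ} {q₀ : Rn n → ℝ → ℝ} {v : Rn n → ℝ → Rn n}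
  {u : Rn n → ℝ → Matrix (Fin n) (Fin n) ℝ}

/-- Adding to a subsolution a wave family which keeps the gap form positive. -/
lemma Subsolution.add_waveFamily (h : Subsolution T Ω ebar v₀ u₀ q₀ v u) {m : ℕ}
    (W : WaveFamily n m) {C : Set (Rn n × ℝ)} (hC : IsCompact C) (hCU : C ⊆ Ω ×ˢ Ioo 0 T)
    (h0 : ∀ i z, z ∉ C → W.g i z = 0) (N : ℝ)
    (hpos : ∀ w ∈ C, ∀ y, ‖y‖ = 1 → 0 < quad (gapMat (ebar w.1 w.2)
      (v w.1 w.2 + W.vel N w.1 w.2) (u w.1 w.2 + W.stress N w.1 w.2)) y) :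
    Subsolution T Ω ebar v₀ u₀ q₀ (fun x t => v x t + W.vel N x t)
      (fun x t => u x t + W.stress N x t) where
  sol := h.sol.add (W.isSmoothLinearSolution T N)
  eq_off_compact := by
    obtain ⟨K, hK, hKU, hKe⟩ := h.eq_off_compact
    refine ⟨K ∪ C, hK.union hC, union_subset hKU hCU, fun x t hxt => ?_⟩
    have h1 : (x, t) ∉ K := fun hx => hxt (Or.inl hx)
    have h2 : (x, t) ∉ C := fun hx => hxt (Or.inr hx)
    rw [W.vel_eq_zero hC.isClosed h0 N h2, W.stress_eq_zero hC.isClosed h0 N h2, add_zero, add_zero]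
    exact hKe x t h1
  pos x hx t ht y hy := by
    by_cases hxt : (x, t) ∈ C
    · exact quad_pos_of_unit (hpos (x, t) hxt) hy
    · rw [W.vel_eq_zero hC.isClosed h0 N hxt, W.stress_eq_zero hC.isClosed h0 N hxt, add_zero,
        add_zero]
      exact h.pos x hx t ht y hy

/-- The perturbation step: a strict subsolution can be perturbed, by a velocity which is weakly
small uniformly in time, so as to gain a fixed fraction of the gap density at every time. -/
theorem Subsolution.exists_perturbation (hn : 2 ≤ n) (hΩ : IsOpen Ω)
    (he : ContinuousOn (fun p : Rn n × ℝ => ebar p.1 p.2) (Ω ×ˢ Ioo 0 T))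
    (h : Subsolution T Ω ebar v₀ u₀ q₀ v u) {C : Set (Rn n × ℝ)} (hC : IsCompact C)
    (hCU : C ⊆ Ω ×ˢ Ioo 0 T) {η : ℝ} (hη : 0 < η) (L : List (Rn n → ℝ → Rn n))
    (hL : ∀ Φ ∈ L, SmoothOnSlab T Φ) :
    ∃ v' u', Subsolution T Ω ebar v₀ u₀ q₀ v' u' ∧
      (∀ Φ ∈ L, ∀ t, |∫ x, inner ℝ (v' x t - v x t) (Φ x t)| ≤ η) ∧
      ∀ t, gainConst n * (∫ x in {x | (x, t) ∈ C}, gapDensity (ebar x t) (v x t)) - η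
        ≤ ∫ x, ‖v' x t - v x t‖ ^ 2 := by
  classical
  have hn0 : 0 < n := by omega
  have hU : IsOpen (Ω ×ˢ Ioo 0 T) := hΩ.prod isOpen_Ioo
  -- The overlap bound of the bump cover, which fixes the admissible amplitude of each wave.
  set K : ℝ := 2 ^ (n + 1) with hK
  have hK1 : 1 ≤ K := one_le_pow₀ (by norm_num)
  -- Bumps centred in C spill out of it; a thickening still inside Ω × ]0,T[ contains them, and all
  -- uniform bounds are taken there.
  obtain ⟨r₀, hr₀, hr₀U⟩ := hC.exists_cthickening_subset_open hU hCU
  set C' := Metric.cthickening r₀ C with hC'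
  have hC'c : IsCompact C' := hC.cthickening
  have hCC' : C ⊆ C' := Metric.self_subset_cthickening C
  obtain ⟨V, μ, hV, hμ, hVb, hμb⟩ := h.exists_compact_bounds he hC'c hr₀U
  -- δ and ε are chosen so that each of the two error terms in `quad_gapMat_perturb_pos` is at most
  -- μ/8.
  set δ := μ / (8 * (1 + 2 * K * V)) with hδ
  have hδ0 : 0 < δ := by positivity
  set ε := min 1 (μ / (8 * (2 * V + 2 * K * V + 2))) with hε
  have hε0 : 0 < ε := lt_min one_pos (by positivity)
  obtain ⟨r₁, hr₁, hr₁b⟩ := h.exists_radius hn0 he hC'c hr₀U hδ0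
  obtain ⟨m, ψ, z, ψs, ψ01, zC, ψd, ψcov, ψcard⟩ :=
    exists_bump_cover hC (lt_min hr₀ hr₁)
  have zU : ∀ i, z i ∈ Ω ×ˢ Ioo 0 T := fun i => hCU (zC i)
  -- Directions and amplitudes are frozen at the bump centres.
  choose a b κ ρ ha hb hab hdec hρ0 hρV hρ1 hρ2 hρ3 using fun i =>
    exists_oscillation_frame hn (h.sol.symm (z i).1 (z i).2 (zU i).2)
      (h.sol.traceless (z i).1 (z i).2 (zU i).2) (h.pos (z i).1 (zU i).1 (z i).2 (zU i).2) hK1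
  let W : WaveFamily n m :=
    { a := a, b := b, κ := κ, g := fun i w => ρ i * ψ i w, norm_a := ha, norm_b := hb,
      inner_ab := hab, smooth := fun i => contDiff_const.mul (ψs i) }
  have hWz : ∀ i w, w ∉ C' → W.g i w = 0 := by
    intro i w hw
    have : ψ i w = 0 := by
      by_contra hne
      exact hw (Metric.mem_cthickening_of_dist_le w (z i) r₀ C (zC i)
        ((ψd i w hne).trans (min_le_left _ _)))
    change ρ i * ψ i w = 0
    rw [this, mul_zero]
  -- Finitely many test fields, each requiring N large; induction on the list intersects the
  -- conditions.
  have ev3 : ∀ L' : List (Rn n → ℝ → Rn n), (∀ Φ ∈ L', SmoothOnSlab T Φ) →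
      ∀ᶠ N in atTop, ∀ Φ ∈ L', ∀ t, |∫ x, inner ℝ (W.vel N x t) (Φ x t)| ≤ η := by
    intro L'
    induction L' with
    | nil => intro _; simp
    | cons Φ L' ih =>
      intro hL'
      have h1 := (W.decays_integral_inner hC'c hWz (isOpen_slab T)
        (hr₀U.trans (prod_mono (subset_univ _) le_rfl)) (hL' Φ List.mem_cons_self)).eventually_le hη
      filter_upwards [h1, ih fun Ψ hΨ => hL' Ψ (List.mem_cons_of_mem _ hΨ)] with N h1 h2 Ψ hΨ t
      rcases List.mem_cons.mp hΨ with rfl | hΨ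
      · exact h1 t
      · exact h2 Ψ hΨ t
  obtain ⟨N, hN1, hN2, hN3, hN4⟩ := (((W.decays_vel_sub_lead hC'c hWz).eventually_le hε0).and
    (((W.decays_stress hC'c hWz).eventually_le hε0).and ((ev3 L hL).and
      ((W.decays_energy hC'c hWz).eventually_le hη)))).exists
  refine ⟨fun x t => v x t + W.vel N x t, fun x t => u x t + W.stress N x t,
    h.add_waveFamily W hC'c hr₀U hWz N ?_, ?_, ?_⟩
  · intro w hw y hy
    have hwU := hr₀U hw
    set s := Finset.univ.filter fun i => ψ i w ≠ 0 with hs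
    have hsd : ∀ i ∈ s, dist w (z i) ≤ r₁ := fun i hi =>
      (ψd i w (Finset.mem_filter.mp hi).2).trans (min_le_right _ _)
    have hrad := fun i hi => hr₁b w hw (z i) (hCC' (zC i)) (hsd i hi)
    have hg0 : ∀ i, i ∉ s → W.g i w = 0 := by
      intro i hi
      have : ψ i w = 0 := by simpa [hs] using hi
      change ρ i * ψ i w = 0
      rw [this, mul_zero]
    refine quad_gapMat_perturb_pos (K := K) (V := V) (μ := μ) (δ := δ) (ε := ε) hK1 hV.le hδ0.le
      hε0.le (min_le_left _ _) hy ((h.norm_le hn0 hwU.1 hwU.2).trans (hVb w hw)) (hμb w hw y hy) s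
      (by rw [hK]; exact_mod_cast ψcard w)
      (eh := fun i => ebar (z i).1 (z i).2) (α := fun i => W.g i w * W.osc N i w) (ρ := ρ) (κ := κ)
      (vh := fun i => v (z i).1 (z i).2) (a := a) (b := b)
      (Q := fun i => quad (gapMat (ebar (z i).1 (z i).2) (v (z i).1 (z i).2)
        (u (z i).1 (z i).2)) y)
      (fun i _ => hdec i) (fun i _ => ?_) (fun i _ => (hρV i).trans (hVb _ (hCC' (zC i))))
      (fun i _ => ha i) (fun i _ => h.norm_le hn0 (zU i).1 (zU i).2) (fun i _ => hρ1 i y)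
      (fun i _ => hρ2 i y) (fun i hi => (hrad i hi).2.1 y hy) (fun i hi => (hrad i hi).1) ?_ ?_ ?_
    · change |ρ i * ψ i w * Real.cos _| ≤ ρ i
      have h1 := ψ01 i w
      rw [abs_mul, abs_mul, abs_of_nonneg (hρ0 i), abs_of_nonneg h1.1, mul_assoc]
      exact mul_le_of_le_one_right (hρ0 i)
        (mul_le_one₀ h1.2 (abs_nonneg _) (Real.abs_cos_le_one _))
    · have e1 : ∑ i ∈ s, W.g i w * W.osc N i w * inner ℝ (a i) y = inner ℝ (W.lead N w) y := by
        rw [WaveFamily.lead, sum_inner]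
        simp only [real_inner_smul_left]
        refine Finset.sum_subset (Finset.subset_univ _) fun i _ hi => ?_
        rw [hg0 i hi, zero_mul, zero_mul]
      rw [e1, ← inner_sub_left]
      refine (abs_real_inner_le_norm _ _).trans ?_
      rw [hy, mul_one]
      exact (le_abs_self _).trans (hN1 w)
    · have e1 : ∑ i ∈ s, 2 * κ i * (W.g i w * W.osc N i w) * (inner ℝ (a i) y * inner ℝ (b i) y)
          = quad (∑ i, Matrix.of fun k l => W.κ i * (W.g i w * W.osc N i w)
            * (W.a i k * W.b i l + W.b i k * W.a i l)) y := by
        rw [quad_sum]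
        simp only [quad_sym_tensor]
        refine (Finset.sum_subset (Finset.subset_univ s) fun i _ hi => ?_).trans
          (Finset.sum_congr rfl fun i _ => ?_)
        · rw [hg0 i hi]; ring
        · change _ = 2 * (κ i * (W.g i w * W.osc N i w)) * _
          ring
      rw [e1, ← quad_sub_mat]
      exact (abs_quad_le _ hy).trans ((le_abs_self _).trans (hN2 w))
    · have h1 : (1 + 2 * K * V) * δ = μ / 8 := by rw [hδ]; field_simp
      have h2 : (2 * V + 2 * K * V + 2) * ε ≤ μ / 8 := by
        have h3 : ε ≤ μ / (8 * (2 * V + 2 * K * V + 2)) := min_le_right _ _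
        rw [le_div_iff₀ (by positivity)] at h3
        linarith
      linarith
  · intro Φ hΦ t
    simpa using hN3 Φ hΦ t
  · intro t
    have h1 := (abs_le.mp (hN4 t)).1
    have ig : ∀ i, Integrable fun x => W.g i (x, t) ^ 2 := fun i =>
      integrable_slice (f := fun w => W.g i w ^ 2) ((W.smooth i).continuous.pow 2)
        (HasCompactSupport.intro hC'c fun w hw => by rw [hWz i w hw]; simp) t
    have isum : Integrable fun x => ∑ i, 1 / 2 * W.g i (x, t) ^ 2 :=
      integrable_finsetSum _ fun i _ => (ig i).const_mul _
    have e1 : ∑ i, 1 / 2 * ∫ x, W.g i (x, t) ^ 2 = ∫ x, ∑ i, 1 / 2 * W.g i (x, t) ^ 2 := by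
      rw [integral_finsetSum _ fun i _ => (ig i).const_mul _]
      exact Finset.sum_congr rfl fun i _ => (integral_const_mul _ _).symm
    have h2 : gainConst n * (∫ x in {x | (x, t) ∈ C}, gapDensity (ebar x t) (v x t))
        ≤ ∫ x, ∑ i, 1 / 2 * W.g i (x, t) ^ 2 := by
      have nn : ∀ x, 0 ≤ ∑ i, 1 / 2 * W.g i (x, t) ^ 2 := fun x =>
        Finset.sum_nonneg fun i _ => by positivity
      rw [← integral_const_mul]
      refine le_trans ?_ (setIntegral_le_integral (s := {x | (x, t) ∈ C}) isum
        (Eventually.of_forall nn))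
      have hmeas : MeasurableSet {x | (x, t) ∈ C} :=
        (hC.isClosed.preimage (by fun_prop : Continuous fun x : Rn n => (x, t))).measurableSet
      have hpt : ∀ x ∈ {x | (x, t) ∈ C}, 0 ≤ gainConst n * gapDensity (ebar x t) (v x t) ∧
          gainConst n * gapDensity (ebar x t) (v x t) ≤ ∑ i, 1 / 2 * W.g i (x, t) ^ 2 := by
        intro x hx
        have hxU := hCU hx
        have hg := h.gap_pos hn0 hxU.1 hxU.2
        have he2 := h.two_mul_energy_pos hn0 hxU.1 hxU.2
        simp only at hg he2
        have hc := gainConst_pos hn0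
        refine ⟨by unfold gapDensity; positivity, ?_⟩
        -- One bump equal to 1 at the point already provides the required gain; the other terms are
        -- nonnegative.
        obtain ⟨i, hi⟩ := ψcov (x, t) hx
        have hd := (ψd i (x, t) (by rw [hi]; exact one_ne_zero)).trans (min_le_right _ _)
        have h3 := (hr₁b (x, t) (hCC' hx) (z i) (hCC' (zC i)) hd).2.2
        have h4 := hρ3 i
        simp only at h3
        have h5 : (2 * ebar x t - ‖v x t‖ ^ 2) / √(2 * ebar x t) ≤ 2 * (8 * K * n * ρ i) :=
          h3.trans (by linarith)
        have h6 : gapDensity (ebar x t) (v x t)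
            = ((2 * ebar x t - ‖v x t‖ ^ 2) / √(2 * ebar x t)) ^ 2 := by
          rw [gapDensity, div_pow, Real.sq_sqrt he2.le]
        have h7 : gapDensity (ebar x t) (v x t) ≤ (2 * (8 * K * n * ρ i)) ^ 2 := by
          rw [h6]
          exact pow_le_pow_left₀ (by positivity) h5 2
        have hn' : (0 : ℝ) < n := by exact_mod_cast hn0
        -- The definition of `gainConst` is made for this identity: the 2 inside the square is the
        -- factor from `exists_radius`, and 4/8 is the mean value 1/2 of cos².
        have h8 : gainConst n * (2 * (8 * K * n * ρ i)) ^ 2 = 1 / 2 * W.g i (x, t) ^ 2 := by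
          change _ = 1 / 2 * (ρ i * ψ i (x, t)) ^ 2
          rw [hi, gainConst, ← hK]
          field_simp
          ring
        calc gainConst n * gapDensity (ebar x t) (v x t)
            ≤ gainConst n * (2 * (8 * K * n * ρ i)) ^ 2 := mul_le_mul_of_nonneg_left h7 hc.le
          _ = 1 / 2 * W.g i (x, t) ^ 2 := h8
          _ ≤ _ := Finset.single_le_sum (f := fun i => 1 / 2 * W.g i (x, t) ^ 2)
            (fun j _ => by positivity) (Finset.mem_univ i)
      refine integral_mono_of_nonneg ?_ isum.integrableOn ?_
      · filter_upwards [ae_restrict_mem hmeas] with x hx using (hpt x hx).1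
      · filter_upwards [ae_restrict_mem hmeas] with x hx using (hpt x hx).2
    rw [e1] at h1
    simp only [add_sub_cancel_left]
    linarith

end Perturbation


/-! ### Jointly measurable limits of slicewise Cauchy sequences. -/

section MeasurableLimit

open scoped ENNReal

variable {X P F : Type*} [MeasurableSpace X] [MeasurableSpace P] {μ : Measure X} [SFinite μ]
  [NormedAddCommGroup F] [MeasurableSpace F] [BorelSpace F]

lemma measurable_eLpNorm_slice {f : X × P → F} (hf : Measurable f) :
    Measurable fun t => eLpNorm (fun x => f (x, t)) 2 μ := by
  simp only [eLpNorm_eq_lintegral_rpow_enorm_toReal (two_ne_zero) (ENNReal.ofNat_ne_top)]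
  exact ((hf.enorm.pow_const _).lintegral_prod_left' (μ := μ)).pow_const _

/-- A sequence of measurable functions which is Cauchy in `L²` for every value of the parameter
has a jointly measurable limit, for every value of the parameter. -/
theorem exists_measurable_limit [SecondCountableTopology F] [CompleteSpace F] (f : ℕ → X × P → F) (hf : ∀ k, Measurable (f k))
    (hc : ∀ t, ∀ ε : ℝ≥0∞, 0 < ε → ∃ k, ∀ m, k ≤ m → ∀ l, k ≤ l →
      eLpNorm (fun x => f m (x, t) - f l (x, t)) 2 μ ≤ ε) :
    ∃ v : X × P → F, Measurable v ∧
      ∀ t, Tendsto (fun k => eLpNorm (fun x => f k (x, t) - v (x, t)) 2 μ) atTop (𝓝 0) := by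
  classical
  let ε : ℕ → ℝ≥0∞ := fun i => 2⁻¹ ^ i
  have hε : ∀ i, 0 < ε i := fun i => ENNReal.pow_pos (by simp) i
  let p : ℕ → P → ℕ → Prop := fun i t k => ∀ m, k ≤ m → ∀ l, k ≤ l →
    eLpNorm (fun x => f m (x, t) - f l (x, t)) 2 μ ≤ ε i
  have hp : ∀ i t, ∃ k, p i t k := fun i t => hc t (ε i) (hε i)
  -- κ_i(t) is the least index beyond which the slices at t are within 2⁻ⁱ of each other. Taking the
  -- least one makes it measurable in t and monotone in i.
  obtain ⟨κ, hκ, hκm, hmono⟩ : ∃ κ : ℕ → P → ℕ, (∀ i t, p i t (κ i t)) ∧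
      (∀ i, Measurable (κ i)) ∧ ∀ t i j, i ≤ j → κ i t ≤ κ j t := by
    refine ⟨fun i t => Nat.find (hp i t), fun i t => Nat.find_spec (hp i t), fun i => ?_,
      fun t i j hij => Nat.find_min' (hp i t) fun m hm l hl =>
        (Nat.find_spec (hp j t) m hm l hl).trans (pow_le_pow_right_of_le_one' (by simp) hij)⟩
    refine measurable_find (hp i) fun k => ?_
    have : {t | p i t k} = ⋂ m, ⋂ (_ : k ≤ m), ⋂ l, ⋂ (_ : k ≤ l),
        {t | eLpNorm (fun x => f m (x, t) - f l (x, t)) 2 μ ≤ ε i} := by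
      ext t; simp [p]
    rw [this]
    exact MeasurableSet.iInter fun m => MeasurableSet.iInter fun _ => MeasurableSet.iInter fun l =>
      MeasurableSet.iInter fun _ => measurableSet_le
        (measurable_eLpNorm_slice (f := fun q => f m q - f l q) ((hf m).sub (hf l)))
        measurable_const
  -- The subsequence depends on t, but measurably, so it stays jointly measurable. On every slice it
  -- is rapidly Cauchy and hence converges almost everywhere.
  let h : ℕ → X × P → F := fun i q => f (κ i q.2) q
  have hm : ∀ i, Measurable (h i) := by
    intro i
    have h1 : Measurable fun r : (X × P) × ℕ => f r.2 r.1 :=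
      measurable_from_prod_countable_left fun k => hf k
    exact h1.comp (measurable_id.prodMk ((hκm i).comp measurable_snd))
  have slice : ∀ (g : X × P → F), Measurable g → ∀ t,
      AEStronglyMeasurable (fun x => g (x, t)) μ := fun g hg t =>
    (hg.comp (measurable_id.prodMk measurable_const)).aestronglyMeasurable
  refine ⟨fun q => limUnder atTop fun i => h i q,
    (StronglyMeasurable.limUnder fun i => (hm i).stronglyMeasurable).measurable, fun t => ?_⟩
  -- The factor 2 only makes the inequality strict.
  have hcau : ∀ N n m : ℕ, N ≤ n → N ≤ m →
      eLpNorm ((fun x => h n (x, t)) - fun x => h m (x, t)) 2 μ < 2 * ε N := by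
    intro N n m hn hm
    have e : eLpNorm (fun x => f (κ n t) (x, t) - f (κ m t) (x, t)) 2 μ ≤ ε N :=
      hκ N t (κ n t) (hmono t N n hn) (κ m t) (hmono t N m hm)
    change eLpNorm (fun x => f (κ n t) (x, t) - f (κ m t) (x, t)) 2 μ < 2 * ε N
    refine lt_of_le_of_lt e ?_
    have h1 : ε N ≠ ⊤ := by simp [ε]
    rw [two_mul]
    exact ENNReal.lt_add_right h1 (hε N).ne'
  have hsum : ∑' i, 2 * ε i ≠ ⊤ := by
    rw [ENNReal.tsum_mul_left, ENNReal.tsum_geometric]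
    exact ENNReal.mul_ne_top (by simp) (by simp)
  have hae := Lp.ae_tendsto_of_cauchy_eLpNorm (μ := μ) (p := 2) (fun i => slice (h i) (hm i) t)
    (by norm_num) hsum hcau
  have hlim : ∀ᵐ x ∂μ, Tendsto (fun i => h i (x, t)) atTop
      (𝓝 (limUnder atTop fun i => h i (x, t))) := by
    filter_upwards [hae] with x hx
    exact tendsto_nhds_limUnder hx
  rw [ENNReal.tendsto_atTop_zero]
  intro δ hδ
  obtain ⟨N, hN⟩ : ∃ N, ε N ≤ δ := by
    have : Tendsto ε atTop (𝓝 0) := ENNReal.tendsto_pow_atTop_nhds_zero_of_lt_one (by simp)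
    exact ((ENNReal.tendsto_atTop_zero.mp this) δ hδ).imp fun N h => h N le_rfl
  refine ⟨κ N t, fun k hk => ?_⟩
  -- Fatou along the diagonal sequence shows that the original sequence converges to the limit,
  -- without passing to a subsequence.
  have h1 := Lp.eLpNorm_lim_le_liminf_eLpNorm (μ := μ) (p := 2)
    (f := fun i x => f k (x, t) - h i (x, t))
    (fun i => (slice (f k) (hf k) t).sub (slice (h i) (hm i) t))
    (fun x => f k (x, t) - limUnder atTop fun i => h i (x, t)) (by
      filter_upwards [hlim] with x hx
      exact tendsto_const_nhds.sub hx)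
  refine h1.trans (le_trans ?_ hN)
  refine liminf_le_of_frequently_le' (Eventually.frequently ?_)
  filter_upwards [eventually_ge_atTop N] with i hi
  have e : eLpNorm (fun x => f k (x, t) - f (κ i t) (x, t)) 2 μ ≤ ε N :=
    hκ N t k hk (κ i t) (hmono t N i hi)
  exact e

end MeasurableLimit


/-! ### Weak formulation of the linear system. -/

/-- The density of the linear system tested against `φ`. -/
def linDensity {n : ℕ} (v : Rn n → ℝ → Rn n) (u : Rn n → ℝ → Matrix (Fin n) (Fin n) ℝ)
    (q : Rn n → ℝ → ℝ) (φ : Rn n × ℝ → Rn n) (p : Rn n × ℝ) : ℝ :=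
  inner ℝ (v p.1 p.2) (fderiv ℝ φ p (0, 1))
    + (∑ i, ∑ j, u p.1 p.2 i j * fderiv ℝ φ p (basisVec j, 0) i) + q p.1 p.2 * divX φ p

section WeakFormulation

variable {n : ℕ} {T : ℝ} {v : Rn n → ℝ → Rn n} {u : Rn n → ℝ → Matrix (Fin n) (Fin n) ℝ}
  {q : Rn n → ℝ → ℝ} {φ : Rn n × ℝ → Rn n}

lemma integrable_fderiv_apply {g : Rn n → ℝ} (hg : ContDiff ℝ 1 g) (hc : HasCompactSupport g)
    (e : Rn n) : Integrable fun x => fderiv ℝ g x e :=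
  ((hg.continuous_fderiv (by simp)).clm_apply continuous_const).integrable_of_hasCompactSupport
    (hc.fderiv_apply ℝ e)

lemma integral_fderiv_apply_eq_zero {g : Rn n → ℝ} (hg : ContDiff ℝ 1 g)
    (hc : HasCompactSupport g) (e : Rn n) : ∫ x, fderiv ℝ g x e = 0 := by
  have h := integral_mul_fderiv_eq_neg_fderiv_mul_of_integrable (f := fun _ : Rn n => (1 : ℝ))
    (g := g) (v := e) (μ := volume) (by simp) (by simpa using integrable_fderiv_apply hg hc e)
    (by simpa using hg.continuous.integrable_of_hasCompactSupport hc) (by simp)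
    (fun x _ => hg.differentiable (by simp) x)
  simpa using h

lemma SmoothOnSlab.contDiff_slice {F : Type*} [NormedAddCommGroup F] [NormedSpace ℝ F]
    {f : Rn n → ℝ → F} (hf : SmoothOnSlab T f) {t : ℝ} (ht : t ∈ Ioo 0 T) :
    ContDiff ℝ ∞ fun x => f x t := by
  rw [contDiff_iff_contDiffAt]
  exact fun x => ContDiffAt.comp (f := fun y : Rn n => (y, t)) x (hf.contDiffAt x ht)
    (contDiff_id.prodMk contDiff_const).contDiffAt

lemma coord_fderiv_apply {V : Type*} [NormedAddCommGroup V] [NormedSpace ℝ V] {f : V → Rn n}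
    {z : V} (hf : DifferentiableAt ℝ f z) (e : V) (i : Fin n) :
    fderiv ℝ (fun w => f w i) z e = fderiv ℝ f z e i := by
  have := ((EuclideanSpace.proj (𝕜 := ℝ) i).hasFDerivAt.comp z hf.hasFDerivAt).fderiv
  change fderiv ℝ ((EuclideanSpace.proj (𝕜 := ℝ) i) ∘ f) z e = _
  rw [this]
  rfl

/-- Smooth solutions of the linear system tested against a smooth field of compact spatial
support. -/
lemma IsSmoothLinearSolution.hasDerivAt_integral (h : IsSmoothLinearSolution T v u q)
    (hφ : ContDiff ℝ ∞ φ) {S : Set (Rn n)} (hS : IsCompact S) (hφS : ∀ x t, x ∉ S → φ (x, t) = 0)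
    {t : ℝ} (ht : t ∈ Ioo 0 T) :
    HasDerivAt (fun s => ∫ x, inner ℝ (v x s) (φ (x, s)))
      (∫ x, linDensity v u q φ (x, t)) t := by
  let G : Rn n × ℝ → ℝ := fun p => inner ℝ (v p.1 p.2) (φ p)
  have hG : ContDiffOn ℝ ∞ G (univ ×ˢ Ioo 0 T) := ContDiffOn.inner ℝ h.smooth_v hφ.contDiffOn
  have hGd : ∀ x, ∀ s ∈ Ioo 0 T, DifferentiableAt ℝ G (x, s) := fun x s hs =>
    (hG.contDiffAt ((isOpen_slab T).mem_nhds ⟨mem_univ x, hs⟩)).differentiableAt (by simp)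
  have hG' : ContinuousOn (fun p => fderiv ℝ G p (0, 1)) (univ ×ˢ Ioo 0 T) :=
    (hG.continuousOn_fderiv_of_isOpen (isOpen_slab T) (by simp)).clm_apply continuousOn_const
  have hder : ∀ x, ∀ s ∈ Ioo 0 T, HasDerivAt (fun s => G (x, s)) (fderiv ℝ G (x, s) (0, 1)) s :=
    fun x s hs => hasDerivAt_slice (hGd x s hs)
  have hG0 : ∀ x, x ∉ S → ∀ s, G (x, s) = 0 := fun x hx s => by simp [G, hφS x s hx]
  have hG'0 : ∀ x, x ∉ S → ∀ s ∈ Ioo 0 T, fderiv ℝ G (x, s) (0, 1) = 0 := by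
    intro x hx s hs
    have h1 := hder x s hs
    simp only [hG0 x hx] at h1
    exact h1.unique (hasDerivAt_const s 0)
  -- The field is smooth only on the open slab. A closed time interval inside ]0,T[ gives a uniform
  -- bound on the time derivative over the compact set S.
  set r := min t (T - t) / 2 with hr
  have hr0 : 0 < r := by
    have : 0 < min t (T - t) := lt_min ht.1 (by linarith [ht.2])
    positivity
  have hsub : Icc (t - r) (t + r) ⊆ Ioo 0 T := by
    intro s hs
    have h1 : min t (T - t) ≤ t := min_le_left _ _
    have h2 : min t (T - t) ≤ T - t := min_le_right _ _
    constructor <;> linarith [hs.1, hs.2, ht.1, ht.2]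
  obtain ⟨B, hB⟩ := (hS.prod isCompact_Icc).exists_bound_of_continuousOn
    (hG'.mono (prod_mono (subset_univ S) hsub))
  have hslice : ∀ s ∈ Ioo 0 T, Continuous fun x => G (x, s) := fun s hs =>
    (SmoothOnSlab.contDiff_slice (f := fun x s => G (x, s)) hG hs).continuous
  have hcs : ∀ s, HasCompactSupport fun x => G (x, s) := fun s =>
    HasCompactSupport.intro hS fun x hx => hG0 x hx s
  have hG'c : Continuous fun x => fderiv ℝ G (x, t) (0, 1) := by
    refine hG'.comp_continuous (f := fun x : Rn n => (x, t)) (by fun_prop) fun x => ⟨mem_univ _, ht⟩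
  have key := (hasDerivAt_integral_of_dominated_loc_of_deriv_le (μ := volume)
    (F := fun s x => G (x, s)) (F' := fun s x => fderiv ℝ G (x, s) (0, 1))
    (bound := S.indicator fun _ => B) (Icc_mem_nhds (by linarith) (by linarith))
    (by
      filter_upwards [Ioo_mem_nhds ht.1 ht.2] with s hs
      exact (hslice s hs).aestronglyMeasurable)
    ((hslice t ht).integrable_of_hasCompactSupport (hcs t))
    hG'c.aestronglyMeasurable
    (Eventually.of_forall fun x s hs => by
      by_cases hx : x ∈ S
      · rw [indicator_of_mem hx]; exact hB (x, s) ⟨hx, hs⟩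
      · rw [indicator_of_notMem hx, hG'0 x hx s (hsub hs), norm_zero])
    ((integrable_indicator_iff hS.measurableSet).mpr
      (integrableOn_const hS.measure_lt_top.ne))
    (Eventually.of_forall fun x s hs => hder x s (hsub hs)))
  have hval : ∫ x, fderiv ℝ G (x, t) (0, 1) = ∫ x, linDensity v u q φ (x, t) := by
    have hφt : ContDiff ℝ ∞ fun x => φ (x, t) := hφ.comp (contDiff_id.prodMk contDiff_const)
    have hφi : ∀ i, ContDiff ℝ ∞ fun x => φ (x, t) i := fun i =>
      (EuclideanSpace.proj (𝕜 := ℝ) i).contDiff.comp hφt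
    have cu : ∀ i j, ContDiff ℝ ∞ fun x => u x t i j := fun i j =>
      SmoothOnSlab.contDiff_slice (h.smooth_u i j) ht
    have cq : ContDiff ℝ ∞ fun x => q x t := SmoothOnSlab.contDiff_slice h.smooth_q ht
    have c1 : ∀ i j, ContDiff ℝ 1 fun x => u x t i j * φ (x, t) i := fun i j =>
      ((cu i j).mul (hφi i)).of_le (by simp)
    have c2 : ∀ i, ContDiff ℝ 1 fun x => q x t * φ (x, t) i := fun i =>
      (cq.mul (hφi i)).of_le (by simp)
    have s1 : ∀ i j, HasCompactSupport fun x => u x t i j * φ (x, t) i := fun i j =>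
      HasCompactSupport.intro hS fun x hx => by simp [hφS x t hx]
    have s2 : ∀ i, HasCompactSupport fun x => q x t * φ (x, t) i := fun i =>
      HasCompactSupport.intro hS fun x hx => by simp [hφS x t hx]
    -- By the momentum equation the tested density differs from ∂ₜ(v·φ) only by spatial derivatives
    -- of compactly supported functions, whose integrals vanish.
    have hpt : ∀ x, linDensity v u q φ (x, t) = fderiv ℝ G (x, t) (0, 1)
        + (∑ i, ∑ j, fderiv ℝ (fun y => u y t i j * φ (y, t) i) x (basisVec j)
          + ∑ i, fderiv ℝ (fun y => q y t * φ (y, t) i) x (basisVec i)) := by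
      intro x
      have hφd : DifferentiableAt ℝ φ (x, t) := hφ.differentiable (by simp) _
      have hvd := h.smooth_v.differentiableAt x ht
      have e1 : fderiv ℝ G (x, t) (0, 1) = inner ℝ (v x t) (fderiv ℝ φ (x, t) (0, 1))
          + ∑ i, deriv (fun s => v x s i) t * φ (x, t) i := by
        have h1 := fderiv_inner_apply ℝ hvd hφd (0, 1)
        have h2 : ∀ i, deriv (fun s => v x s i) t
            = fderiv ℝ (fun p : Rn n × ℝ => v p.1 p.2) (x, t) (0, 1) i := by
          intro i
          rw [(hasDerivAt_slice ((h.smooth_v.coord i).differentiableAt x ht)).deriv]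
          exact coord_fderiv_apply hvd _ i
        simp only [h2, ← inner_eq_sum]
        exact h1
      have e2 : ∀ i j, fderiv ℝ (fun y => u y t i j * φ (y, t) i) x (basisVec j)
          = u x t i j * fderiv ℝ φ (x, t) (basisVec j, 0) i
            + fderiv ℝ (fun y => u y t i j) x (basisVec j) * φ (x, t) i := by
        intro i j
        rw [fderiv_fun_mul ((cu i j).differentiable (by simp) x)
          ((hφi i).differentiable (by simp) x), ← coord_fderiv_apply hφd,
          ← fderiv_slice (f := fun w => φ w i)
            ((EuclideanSpace.proj (𝕜 := ℝ) i).differentiableAt.comp _ hφd)]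
        simp
        ring
      have e3 : ∀ i, fderiv ℝ (fun y => q y t * φ (y, t) i) x (basisVec i)
          = q x t * fderiv ℝ φ (x, t) (basisVec i, 0) i
            + fderiv ℝ (fun y => q y t) x (basisVec i) * φ (x, t) i := by
        intro i
        rw [fderiv_fun_mul (cq.differentiable (by simp) x)
          ((hφi i).differentiable (by simp) x), ← coord_fderiv_apply hφd,
          ← fderiv_slice (f := fun w => φ w i)
            ((EuclideanSpace.proj (𝕜 := ℝ) i).differentiableAt.comp _ hφd)]
        simp
        ring
      have e4 : ∑ i, (deriv (fun s => v x s i) t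
          + (∑ j, fderiv ℝ (fun y => u y t i j) x (basisVec j))
          + fderiv ℝ (fun y => q y t) x (basisVec i)) * φ (x, t) i = 0 :=
        Finset.sum_eq_zero fun i _ => by rw [h.momentum x t ht i, zero_mul]
      simp only [add_mul, Finset.sum_add_distrib, Finset.sum_mul] at e4
      simp only [e1, e2, e3, linDensity, divX, Finset.sum_add_distrib, Finset.mul_sum]
      linarith
    have i1 : ∀ i j, Integrable fun x =>
        fderiv ℝ (fun y => u y t i j * φ (y, t) i) x (basisVec j) := fun i j =>
      integrable_fderiv_apply (c1 i j) (s1 i j) _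
    have i2 : ∀ i, Integrable fun x =>
        fderiv ℝ (fun y => q y t * φ (y, t) i) x (basisVec i) := fun i =>
      integrable_fderiv_apply (c2 i) (s2 i) _
    have i3 := integrable_finsetSum Finset.univ fun i _ =>
      integrable_finsetSum Finset.univ fun j _ => i1 i j
    have i4 := integrable_finsetSum Finset.univ fun i _ => i2 i
    have i5 : Integrable fun x => ∑ i, ∑ j, fderiv ℝ (fun y => u y t i j * φ (y, t) i) x (basisVec j)
        + ∑ i, fderiv ℝ (fun y => q y t * φ (y, t) i) x (basisVec i) := i3.add i4
    simp only [hpt]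
    rw [integral_add key.1 i5, integral_add i3 i4,
      integral_finsetSum _ fun i _ => integrable_finsetSum Finset.univ fun j _ => i1 i j,
      integral_finsetSum _ fun i _ => i2 i]
    have z1 : ∑ i, ∫ x, ∑ j, fderiv ℝ (fun y => u y t i j * φ (y, t) i) x (basisVec j) = 0 := by
      refine Finset.sum_eq_zero fun i _ => ?_
      rw [integral_finsetSum _ fun j _ => i1 i j]
      exact Finset.sum_eq_zero fun j _ => integral_fderiv_apply_eq_zero (c1 i j) (s1 i j) _
    have z2 : ∑ i, ∫ x, fderiv ℝ (fun y => q y t * φ (y, t) i) x (basisVec i) = 0 :=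
      Finset.sum_eq_zero fun i _ => integral_fderiv_apply_eq_zero (c2 i) (s2 i) _
    rw [z1, z2]
    simp
  rw [← hval]
  exact key.2

lemma IsSmoothLinearSolution.weaklyDivFree (h : IsSmoothLinearSolution T v u q) {t : ℝ}
    (ht : t ∈ Ioo 0 T) : WeaklyDivFree fun x => v x t := by
  intro φ hφ hc
  have cv : ∀ i, ContDiff ℝ ∞ fun x => v x t i := fun i =>
    SmoothOnSlab.contDiff_slice (h.smooth_v.coord i) ht
  have c1 : ∀ i, ContDiff ℝ 1 fun x => φ x * v x t i := fun i =>
    (hφ.mul (cv i)).of_le (by simp)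
  have s1 : ∀ i, HasCompactSupport fun x => φ x * v x t i := fun i => hc.mul_right
  have hpt : ∀ x, fderiv ℝ φ x (v x t)
      -- The term φ div v vanishes, so the integrand is the divergence of φv.
      = ∑ i, fderiv ℝ (fun y => φ y * v y t i) x (basisVec i) := by
    intro x
    have e : ∀ i, fderiv ℝ (fun y => φ y * v y t i) x (basisVec i)
        = φ x * fderiv ℝ (fun y => v y t i) x (basisVec i)
          + v x t i * fderiv ℝ φ x (basisVec i) := by
      intro i
      rw [fderiv_fun_mul (hφ.differentiable (by simp) x) ((cv i).differentiable (by simp) x)]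
      simp
    simp only [e, Finset.sum_add_distrib, ← Finset.mul_sum, h.div_free x t ht, mul_zero, zero_add]
    conv_lhs => rw [eq_sum_basisVec (v x t), map_sum]
    simp
  simp only [hpt]
  rw [integral_finsetSum _ fun i _ => integrable_fderiv_apply (c1 i) (s1 i) _]
  exact Finset.sum_eq_zero fun i _ => integral_fderiv_apply_eq_zero (c1 i) (s1 i) _

lemma continuous_test_slice (hφ : ContDiff ℝ ∞ φ) (t : ℝ) : Continuous fun x => φ (x, t) :=
  hφ.continuous.comp (by fun_prop)

lemma integrable_inner_of_memLp {X E : Type*} [MeasurableSpace X] {μ : Measure X}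
    [NormedAddCommGroup E] [InnerProductSpace ℝ E] {f g : X → E} (hf : MemLp f 2 μ)
    (hg : MemLp g 2 μ) : Integrable (fun x => inner ℝ (f x) (g x)) μ := by
  refine (L2.integrable_inner (𝕜 := ℝ) (hf.toLp f) (hg.toLp g)).congr ?_
  filter_upwards [hf.coeFn_toLp, hg.coeFn_toLp] with x h1 h2
  rw [h1, h2]

/-- Testing a bounded weakly continuous field against a time-dependent test field gives a
continuous function of time. -/
lemma ContinuousInL2w.continuousOn_integral (hw : ContinuousInL2w T v) {B : ℝ}
    (hB : ∀ t ∈ Icc 0 T, ∫ x, ‖v x t‖ ^ 2 ≤ B) (hφ : ContDiff ℝ ∞ φ) (hc : HasCompactSupport φ) :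
    ContinuousOn (fun t => ∫ x, inner ℝ (v x t) (φ (x, t))) (Icc 0 T) := by
  intro t₀ ht₀
  have hml : ∀ t, MemLp (fun x => φ (x, t)) 2 volume := fun t =>
    (continuous_test_slice hφ t).memLp_of_hasCompactSupport (hasCompactSupport_slice hc t)
  set S := Prod.fst '' tsupport φ with hS
  have hSc : IsCompact S := IsCompact.image hc continuous_fst
  have hφS : ∀ x t, x ∉ S → φ (x, t) = 0 := fun x t hx => by
    by_contra h0
    exact hx ⟨(x, t), subset_tsupport _ h0, rfl⟩
  have hint : ∀ t ∈ Icc 0 T, ∀ s, Integrable fun x => inner ℝ (v x t) (φ (x, s)) := fun t ht s =>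
    integrable_inner_of_memLp (hw.memLp t ht) (hml s)
  have hint2 : ∀ t ∈ Icc 0 T, Integrable fun x => ‖v x t‖ ^ 2 := fun t ht =>
    (hw.memLp t ht).integrable_norm_pow (by norm_num)
  have hbd : ∀ t ∈ Icc 0 T, ∀ θ : ℝ, (∀ x, ‖φ (x, t) - φ (x, t₀)‖ ≤ θ) →
      |∫ x, inner ℝ (v x t) (φ (x, t) - φ (x, t₀))| ≤ θ * (volume.real S + B) := by
    intro t ht θ hθ
    have hθ0 : 0 ≤ θ := (norm_nonneg _).trans (hθ 0)
    have i1 : Integrable fun x => θ * (S.indicator (fun _ => (1 : ℝ)) x + ‖v x t‖ ^ 2) :=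
      (((integrable_indicator_iff hSc.measurableSet).mpr
        (integrableOn_const hSc.measure_lt_top.ne)).add (hint2 t ht)).const_mul θ
    rw [← Real.norm_eq_abs]
    -- |v| ≤ 1 + |v|² gives a bound in terms of the measure of S and the energy, uniform in time.
    refine (norm_integral_le_of_norm_le i1 (Eventually.of_forall fun x => ?_)).trans ?_
    · by_cases hx : x ∈ S
      · rw [indicator_of_mem hx]
        refine (norm_inner_le_norm _ _).trans ?_
        rw [mul_comm]
        refine mul_le_mul (hθ x) ?_ (norm_nonneg _) hθ0
        nlinarith [sq_nonneg (‖v x t‖ - 1)]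
      · rw [hφS x t hx, hφS x t₀ hx, sub_zero, inner_zero_right, norm_zero,
          indicator_of_notMem hx]
        positivity
    · rw [integral_const_mul, integral_add ((integrable_indicator_iff hSc.measurableSet).mpr
        (integrableOn_const hSc.measure_lt_top.ne)) (hint2 t ht),
        integral_indicator_const _ hSc.measurableSet, smul_eq_mul, mul_one]
      exact mul_le_mul_of_nonneg_left (by linarith [hB t ht]) hθ0
  have hsplit : ∀ t ∈ Icc 0 T, ∫ x, inner ℝ (v x t) (φ (x, t))
      = (∫ x, inner ℝ (v x t) (φ (x, t₀))) + ∫ x, inner ℝ (v x t) (φ (x, t) - φ (x, t₀)) := by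
    intro t ht
    rw [← integral_add (hint t ht t₀) (by
      simp only [inner_sub_right]; exact (hint t ht t).sub (hint t ht t₀))]
    simp only [inner_sub_right, add_sub_cancel]
  have hunif := hc.uniformContinuous_of_continuous hφ.continuous
  have hsmall : Tendsto (fun t => ∫ x, inner ℝ (v x t) (φ (x, t) - φ (x, t₀)))
      (𝓝[Icc 0 T] t₀) (𝓝 0) := by
    have hB0 : 0 ≤ volume.real S + B := by
      have : 0 ≤ ∫ x, ‖v x t₀‖ ^ 2 := integral_nonneg fun x => by positivity
      have := hB t₀ ht₀
      have : 0 ≤ volume.real S := measureReal_nonneg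
      linarith
    rw [Metric.tendsto_nhds]
    intro ε hε
    obtain ⟨δ, hδ, hδ'⟩ := Metric.uniformContinuous_iff.mp hunif
      (ε / (volume.real S + B + 1)) (by positivity)
    filter_upwards [self_mem_nhdsWithin, mem_nhdsWithin_of_mem_nhds (Metric.ball_mem_nhds t₀ hδ)]
      with t ht htδ
    rw [Real.dist_eq, sub_zero]
    refine (hbd t ht (ε / (volume.real S + B + 1)) fun x => ?_).trans_lt ?_
    · rw [← dist_eq_norm]
      refine (hδ' ?_).le
      rw [Prod.dist_eq, dist_self, max_lt_iff]
      exact ⟨hδ, htδ⟩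
    · rw [div_mul_eq_mul_div, div_lt_iff₀ (by positivity)]
      nlinarith
  have h0 : ∫ x, inner ℝ (v x t₀) (φ (x, t₀))
      = (∫ x, inner ℝ (v x t₀) (φ (x, t₀))) + 0 := (add_zero _).symm
  change Tendsto _ _ (𝓝 (∫ x, inner ℝ (v x t₀) (φ (x, t₀))))
  rw [h0]
  refine Tendsto.congr' ?_ ((hw.continuous _ (hml t₀) t₀ ht₀).tendsto.add hsmall)
  filter_upwards [self_mem_nhdsWithin] with t ht
  exact (hsplit t ht).symm

lemma restrict_slab_eq_prod : (volume : Measure (Rn n × ℝ)).restrict (univ ×ˢ Ioo 0 T)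
    = (volume : Measure (Rn n)).prod ((volume : Measure ℝ).restrict (Ioo 0 T)) := by
  rw [Measure.volume_eq_prod, ← Measure.prod_restrict, Measure.restrict_univ]

/-- The weak formulation on `[0,T[` of the linear system. -/
theorem IsSmoothLinearSolution.integral_linDensity (hT : 0 < T)
    (h : IsSmoothLinearSolution T v u q) (hw : ContinuousInL2w T v) {B : ℝ}
    (hB : ∀ t ∈ Icc 0 T, ∫ x, ‖v x t‖ ^ 2 ≤ B) (hφ : ContDiff ℝ ∞ φ) (hc : HasCompactSupport φ)
    (hsupp : tsupport φ ⊆ univ ×ˢ Iio T)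
    (hint : IntegrableOn (linDensity v u q φ) (univ ×ˢ Ioo 0 T)) :
    (∫ p in univ ×ˢ Ioo 0 T, linDensity v u q φ p) + ∫ x, inner ℝ (v x 0) (φ (x, 0)) = 0 := by
  have hSc : IsCompact (Prod.fst '' tsupport φ) := IsCompact.image hc continuous_fst
  have hφS : ∀ x t, x ∉ Prod.fst '' tsupport φ → φ (x, t) = 0 := fun x t hx => by
    by_contra h0
    exact hx ⟨(x, t), subset_tsupport _ h0, rfl⟩
  rw [IntegrableOn, restrict_slab_eq_prod] at hint
  rw [restrict_slab_eq_prod, integral_prod_symm _ hint]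
  have hint' := hint.integral_prod_right
  -- At the endpoints only continuity is available, and only continuity is needed; it comes from
  -- weak continuity of v. No smoothness up to t = 0 enters.
  have hFTC := intervalIntegral.integral_eq_sub_of_hasDerivAt_of_le hT.le
    (hw.continuousOn_integral hB hφ hc)
    (fun t ht => h.hasDerivAt_integral hφ hSc hφS ht)
    ((intervalIntegrable_iff_integrableOn_Ioo_of_le hT.le).mpr hint')
  rw [intervalIntegral.integral_of_le hT.le, integral_Ioc_eq_integral_Ioo] at hFTC
  rw [hFTC]
  have hT0 : ∀ x, φ (x, T) = 0 := by
    intro x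
    by_contra h0
    exact lt_irrefl T (hsupp (subset_tsupport _ h0)).2
  simp [hT0]

end WeakFormulation


/-! ### The background subsolution and uniform bounds. -/

/-- The energy density extended by zero off `Ω`. -/
def extEnergy {n : ℕ} (Ω : Set (Rn n)) (ebar : Rn n → ℝ → ℝ) (x : Rn n) (t : ℝ) : ℝ :=
  Ω.indicator (fun y => ebar y t) x

/-- A strict subsolution `(v₀, u₀, q₀)` of finite energy, below a prescribed energy density. -/
structure Background {n : ℕ} (T : ℝ) (Ω : Set (Rn n)) (ebar : Rn n → ℝ → ℝ)
    (v₀ : Rn n → ℝ → Rn n) (u₀ : Rn n → ℝ → Matrix (Fin n) (Fin n) ℝ)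
    (q₀ : Rn n → ℝ → ℝ) : Prop where
  two_le : 2 ≤ n
  T_pos : 0 < T
  isOpen : IsOpen Ω
  continuousOn_energy : ContinuousOn (fun p : Rn n × ℝ => ebar p.1 p.2) (Ω ×ˢ Ioo 0 T)
  energy : ContinuousInL1 T Ω ebar
  weak : ContinuousInL2w T v₀
  support : ∀ t ∈ Ioo 0 T, (tsupport fun x => (v₀ x t, u₀ x t)) ⊆ Ω
  subsol : Subsolution T Ω ebar v₀ u₀ q₀ v₀ u₀

section Bounds

variable {n : ℕ} {T : ℝ} {Ω : Set (Rn n)} {ebar : Rn n → ℝ → ℝ} {v₀ v : Rn n → ℝ → Rn n}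
  {u₀ u : Rn n → ℝ → Matrix (Fin n) (Fin n) ℝ} {q₀ : Rn n → ℝ → ℝ}

lemma Background.pos (H : Background T Ω ebar v₀ u₀ q₀) : 0 < n := by
  have := H.two_le
  omega

/-- Perturbations stay inside Ω and the background is supported in Ω, so all bounds with the energy
extended by zero hold on the whole space. -/
lemma Subsolution.eq_zero (h : Subsolution T Ω ebar v₀ u₀ q₀ v u)
    (H : Background T Ω ebar v₀ u₀ q₀) {x : Rn n} (hx : x ∉ Ω) {t : ℝ} (ht : t ∈ Ioo 0 T) :
    v x t = 0 ∧ u x t = 0 := by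
  have h0 : (v₀ x t, u₀ x t) = 0 := by
    by_contra h0
    exact hx (H.support t ht (subset_tsupport (fun x => (v₀ x t, u₀ x t)) h0))
  obtain ⟨K, -, hKU, hK⟩ := h.eq_off_compact
  obtain ⟨e1, e2⟩ := hK x t fun hm => hx (hKU hm).1
  rw [e1, e2]
  exact ⟨congrArg Prod.fst h0, congrArg Prod.snd h0⟩

lemma Subsolution.eq_of_notMem (h : Subsolution T Ω ebar v₀ u₀ q₀ v u) (x : Rn n) {t : ℝ}
    (ht : t ∉ Ioo 0 T) : v x t = v₀ x t := by
  obtain ⟨K, -, hKU, hK⟩ := h.eq_off_compact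
  exact (hK x t fun hm => ht (hKU hm).2).1

lemma Subsolution.norm_sq_le (h : Subsolution T Ω ebar v₀ u₀ q₀ v u)
    (H : Background T Ω ebar v₀ u₀ q₀) (x : Rn n) {t : ℝ} (ht : t ∈ Ioo 0 T) :
    ‖v x t‖ ^ 2 ≤ 2 * extEnergy Ω ebar x t := by
  by_cases hx : x ∈ Ω
  · rw [extEnergy, indicator_of_mem hx]
    linarith [h.gap_pos H.pos hx ht]
  · rw [extEnergy, indicator_of_notMem hx, (h.eq_zero H hx ht).1]
    simp

lemma Background.extEnergy_nonneg (H : Background T Ω ebar v₀ u₀ q₀) (x : Rn n) {t : ℝ}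
    (ht : t ∈ Ioo 0 T) : 0 ≤ extEnergy Ω ebar x t := by
  have := H.subsol.norm_sq_le H x ht
  nlinarith [sq_nonneg ‖v₀ x t‖]

lemma Subsolution.abs_gapMat_le (h : Subsolution T Ω ebar v₀ u₀ q₀ v u)
    (H : Background T Ω ebar v₀ u₀ q₀) (x : Rn n) {t : ℝ} (ht : t ∈ Ioo 0 T) (i j : Fin n) :
    |gapMat (extEnergy Ω ebar x t) (v x t) (u x t) i j|
      ≤ 2 * extEnergy Ω ebar x t - ‖v x t‖ ^ 2 := by
  by_cases hx : x ∈ Ω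
  · rw [extEnergy, indicator_of_mem hx, ← trace_gapMat H.pos _ _ (h.sol.traceless x t ht)]
    exact abs_entry_le_trace (gapMat_isSymm _ _ (h.sol.symm x t ht))
      (quad_nonneg_of_pos (h.pos x hx t ht)) i j
  · rw [extEnergy, indicator_of_notMem hx, (h.eq_zero H hx ht).1, (h.eq_zero H hx ht).2]
    simp [gapMat_apply]

/-- Solve for u in the gap matrix: the gap entry, v_i v_j and the diagonal term are each at most 2ē
in absolute value. -/
lemma Subsolution.abs_entry_le (h : Subsolution T Ω ebar v₀ u₀ q₀ v u)
    (H : Background T Ω ebar v₀ u₀ q₀) (x : Rn n) {t : ℝ} (ht : t ∈ Ioo 0 T) (i j : Fin n) :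
    |u x t i j| ≤ 6 * extEnergy Ω ebar x t := by
  have h1 := h.abs_gapMat_le H x ht i j
  have h2 := h.norm_sq_le H x ht
  have h0 := H.extEnergy_nonneg x ht
  have h3 : |v x t i * v x t j| ≤ ‖v x t‖ ^ 2 := by
    rw [abs_mul, sq]
    exact mul_le_mul (abs_apply_le_norm _ _) (abs_apply_le_norm _ _) (abs_nonneg _) (norm_nonneg _)
  have h4 : |if i = j then 2 * extEnergy Ω ebar x t / n else 0| ≤ 2 * extEnergy Ω ebar x t := by
    split_ifs
    · rw [abs_of_nonneg (by positivity)]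
      have : (1 : ℝ) ≤ n := by exact_mod_cast H.pos
      exact div_le_self (by positivity) this
    · simpa using h0
  rw [gapMat_apply] at h1
  rw [abs_le] at *
  constructor <;> linarith [sq_nonneg ‖v x t‖]

/-- The difference of a subsolution and the reference field, as a test field. -/
lemma Subsolution.contDiff_sub (h : Subsolution T Ω ebar v₀ u₀ q₀ v u)
    (H : Background T Ω ebar v₀ u₀ q₀) :
    ContDiff ℝ ∞ (fun p : Rn n × ℝ => v p.1 p.2 - v₀ p.1 p.2) ∧
      HasCompactSupport (fun p : Rn n × ℝ => v p.1 p.2 - v₀ p.1 p.2) := by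
  obtain ⟨K, hK, hKU, hKe⟩ := h.eq_off_compact
  have h0 : ∀ z : Rn n × ℝ, z ∉ K → v z.1 z.2 - v₀ z.1 z.2 = 0 := fun z hz => by
    rw [(hKe z.1 z.2 hz).1, sub_self]
  have hts := tsupport_subset_of_forall_notMem hK.isClosed h0
  exact ⟨contDiff_of_contDiffOn_of_tsupport (isOpen_slab T)
    (ContDiffOn.sub h.sol.smooth_v H.subsol.sol.smooth_v)
    (hts.trans (hKU.trans (prod_mono (subset_univ _) le_rfl))),
    hK.of_isClosed_subset (isClosed_tsupport _) hts⟩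

lemma Subsolution.weak (h : Subsolution T Ω ebar v₀ u₀ q₀ v u)
    (H : Background T Ω ebar v₀ u₀ q₀) : ContinuousInL2w T v := by
  obtain ⟨hd, hc⟩ := h.contDiff_sub H
  set δ : Rn n × ℝ → Rn n := fun p => v p.1 p.2 - v₀ p.1 p.2 with hδ
  have hv : ∀ x t, v x t = v₀ x t + δ (x, t) := fun x t => by simp [hδ]
  have hml : ∀ t, MemLp (fun x => δ (x, t)) 2 volume := fun t =>
    (continuous_test_slice hd t).memLp_of_hasCompactSupport (hasCompactSupport_slice hc t)
  refine ⟨fun t ht => ?_, fun φ hφ => ?_⟩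
  · simp only [hv]
    exact (H.weak.memLp t ht).add (hml t)
  · have e : ∀ t ∈ Icc 0 T, ∫ x, inner ℝ (v x t) (φ x)
        = (∫ x, inner ℝ (v₀ x t) (φ x)) + ∫ x, inner ℝ (δ (x, t)) (φ x) := fun t ht => by
      rw [← integral_add (integrable_inner_of_memLp (H.weak.memLp t ht) hφ)
        (integrable_inner_of_memLp (hml t) hφ)]
      simp only [hv, inner_add_left]
    refine ((H.weak.continuous φ hφ).add (Continuous.continuousOn ?_)).congr e
    obtain ⟨B, hB⟩ := hd.continuous.bounded_above_of_compact_support hc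
    set S := Prod.fst '' tsupport δ
    have hSc : IsCompact S := IsCompact.image hc continuous_fst
    refine continuous_of_dominated (bound := fun x => S.indicator (fun x => B * ‖φ x‖) x)
      (fun t => (integrable_inner_of_memLp (hml t) hφ).aestronglyMeasurable)
      (fun t => Eventually.of_forall fun x => ?_) ?_ (Eventually.of_forall fun x => ?_)
    · by_cases hx : x ∈ S
      · rw [indicator_of_mem hx]
        exact (norm_inner_le_norm (𝕜 := ℝ) _ _).trans
          (mul_le_mul_of_nonneg_right (hB _) (norm_nonneg _))
      · rw [indicator_of_notMem hx]
        have : δ (x, t) = 0 := by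
          by_contra h0
          exact hx ⟨(x, t), subset_tsupport _ h0, rfl⟩
        simp [this]
    · rw [integrable_indicator_iff hSc.measurableSet]
      have hφS := hφ.restrict S
      have : IsFiniteMeasure (volume.restrict S) := ⟨by simpa using hSc.measure_lt_top⟩
      exact ((hφS.integrable (by norm_num)).norm).const_mul B
    · have := hd.continuous
      fun_prop

lemma Background.exists_energy_bound (H : Background T Ω ebar v₀ u₀ q₀) :
    ∃ G, ∀ t ∈ Icc 0 T, ∫ x in Ω, |ebar x t| ≤ G := by
  have hc : ContinuousOn (fun t => ∫ x in Ω, |ebar x t|) (Icc 0 T) := by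
    intro t₀ ht₀
    have h0 := H.energy.continuous t₀ ht₀
    rw [ContinuousWithinAt, tendsto_iff_norm_sub_tendsto_zero]
    refine squeeze_zero' (Eventually.of_forall fun t => norm_nonneg _) ?_ h0
    filter_upwards [self_mem_nhdsWithin] with t ht
    have i1 := (H.energy.integrable t ht)
    have i2 := (H.energy.integrable t₀ ht₀)
    rw [← integral_sub i1.abs i2.abs]
    refine (norm_integral_le_integral_norm _).trans (integral_mono (i1.abs.sub i2.abs).norm
      (i1.sub i2).abs fun x => ?_)
    exact abs_abs_sub_abs_le _ _
  obtain ⟨G, hG⟩ := (isCompact_Icc.image_of_continuousOn hc).bddAbove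
  exact ⟨G, fun t ht => hG ⟨t, ht, rfl⟩⟩

lemma Background.integrable_extEnergy_slice (H : Background T Ω ebar v₀ u₀ q₀) {t : ℝ}
    (ht : t ∈ Icc 0 T) : Integrable fun x => extEnergy Ω ebar x t :=
  (integrable_indicator_iff H.isOpen.measurableSet).mpr (H.energy.integrable t ht)

lemma Background.integral_norm_extEnergy (H : Background T Ω ebar v₀ u₀ q₀) (t : ℝ) :
    ∫ x, ‖extEnergy Ω ebar x t‖ = ∫ x in Ω, |ebar x t| := by
  rw [← integral_indicator H.isOpen.measurableSet]
  refine integral_congr_ae (Eventually.of_forall fun x => ?_)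
  simp only [extEnergy, norm_indicator_eq_indicator_norm, Real.norm_eq_abs]

/-- Joint measurability comes from continuity on Ω × ]0,T[, and Tonelli applies because the spatial
L¹ norms are bounded on the compact interval [0,T]. -/
lemma Background.integrable_extEnergy (H : Background T Ω ebar v₀ u₀ q₀) :
    IntegrableOn (fun p : Rn n × ℝ => extEnergy Ω ebar p.1 p.2) (univ ×ˢ Ioo 0 T) := by
  obtain ⟨G, hG⟩ := H.exists_energy_bound
  have hm : AEStronglyMeasurable (fun p : Rn n × ℝ => extEnergy Ω ebar p.1 p.2)
      (volume.restrict (univ ×ˢ Ioo 0 T)) := by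
    have hU : MeasurableSet (Ω ×ˢ Ioo 0 T : Set (Rn n × ℝ)) :=
      H.isOpen.measurableSet.prod measurableSet_Ioo
    have h1 : AEStronglyMeasurable ((Ω ×ˢ Ioo 0 T).indicator fun p : Rn n × ℝ => ebar p.1 p.2)
        (volume.restrict (univ ×ˢ Ioo 0 T)) :=
      ((aestronglyMeasurable_indicator_iff hU).mpr
        (H.continuousOn_energy.aestronglyMeasurable hU)).restrict
    refine h1.congr ?_
    filter_upwards [self_mem_ae_restrict (isOpen_slab T).measurableSet] with p hp
    by_cases hx : p.1 ∈ Ω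
    · rw [indicator_of_mem (show p ∈ Ω ×ˢ Ioo 0 T from ⟨hx, hp.2⟩), extEnergy, indicator_of_mem hx]
    · rw [indicator_of_notMem (show p ∉ Ω ×ˢ Ioo 0 T from fun h => hx h.1), extEnergy, indicator_of_notMem hx]
  rw [IntegrableOn, restrict_slab_eq_prod] at *
  rw [integrable_prod_iff' hm]
  refine ⟨?_, ?_⟩
  · filter_upwards [self_mem_ae_restrict measurableSet_Ioo] with t ht
    exact H.integrable_extEnergy_slice (Ioo_subset_Icc_self ht)
  · refine Integrable.of_bound hm.norm.prod_swap.integral_prod_right' G ?_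
    filter_upwards [self_mem_ae_restrict measurableSet_Ioo] with t ht
    rw [Real.norm_of_nonneg (integral_nonneg fun x => norm_nonneg _),
      H.integral_norm_extEnergy]
    exact hG t (Ioo_subset_Icc_self ht)

lemma Subsolution.integral_norm_sq_le (h : Subsolution T Ω ebar v₀ u₀ q₀ v u)
    (H : Background T Ω ebar v₀ u₀ q₀) {t : ℝ} (ht : t ∈ Ioo 0 T) :
    ∫ x, ‖v x t‖ ^ 2 ≤ 2 * ∫ x, extEnergy Ω ebar x t := by
  rw [← integral_const_mul]
  have hi := H.integrable_extEnergy_slice (Ioo_subset_Icc_self ht)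
  exact integral_mono (((h.weak H).memLp t (Ioo_subset_Icc_self ht)).integrable_norm_pow (by norm_num))
    (hi.const_mul 2) fun x => h.norm_sq_le H x ht

/-- Subsolutions are uniformly bounded in `L²`. -/
lemma Background.exists_bound (H : Background T Ω ebar v₀ u₀ q₀) :
    ∃ B, 0 ≤ B ∧ (∀ v u, Subsolution T Ω ebar v₀ u₀ q₀ v u →
      ∀ t ∈ Icc 0 T, ∫ x, ‖v x t‖ ^ 2 ≤ B) ∧
      ∀ t ∈ Ioo 0 T, 2 * ∫ x, extEnergy Ω ebar x t ≤ B := by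
  obtain ⟨G, hG⟩ := H.exists_energy_bound
  have hG0 : 0 ≤ G := (integral_nonneg fun x => abs_nonneg _).trans (hG 0 ⟨le_rfl, H.T_pos.le⟩)
  have n0 : 0 ≤ ∫ x, ‖v₀ x 0‖ ^ 2 := integral_nonneg fun x => by positivity
  have nT : 0 ≤ ∫ x, ‖v₀ x T‖ ^ 2 := integral_nonneg fun x => by positivity
  have hE : ∀ t ∈ Ioo 0 T, ∫ x, extEnergy Ω ebar x t ≤ G := fun t ht => by
    refine ((Real.le_norm_self _).trans (norm_integral_le_integral_norm _)).trans ?_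
    rw [H.integral_norm_extEnergy]
    exact hG t (Ioo_subset_Icc_self ht)
  -- The energy inequality holds only inside ]0,T[; at the two endpoints the velocity equals v₀,
  -- whose energies are added separately.
  refine ⟨2 * G + (∫ x, ‖v₀ x 0‖ ^ 2) + ∫ x, ‖v₀ x T‖ ^ 2, by positivity, fun v u h t ht => ?_,
    fun t ht => by linarith [hE t ht]⟩
  by_cases ht' : t ∈ Ioo 0 T
  · have := h.integral_norm_sq_le H ht'
    linarith [hE t ht']
  · simp only [h.eq_of_notMem _ ht']
    rcases ht.1.eq_or_lt with rfl | h0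
    · linarith
    · have : t = T := le_antisymm ht.2 (not_lt.mp fun h => ht' ⟨h0, h⟩)
      subst this
      linarith

end Bounds


/-! ### Convergence from almost orthogonal increments. -/

lemma sum_Ico_half_pow_le {k l : ℕ} (h : k ≤ l) :
    ∑ m ∈ Finset.Ico k l, (1 / 2 : ℝ) ^ (m + 1) ≤ (1 / 2) ^ k := by
  have : ∑ m ∈ Finset.Ico k l, (1 / 2 : ℝ) ^ (m + 1) = (1 / 2) ^ k - (1 / 2) ^ l := by
    induction l, h using Nat.le_induction with
    | base => simp
    | succ l hl ih => rw [Finset.sum_Ico_succ_top hl, ih]; ring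
  rw [this]
  linarith [pow_pos (show (0 : ℝ) < 1 / 2 by norm_num) l]

section Hilbert

variable {E : Type*} [NormedAddCommGroup E] [InnerProductSpace ℝ E]

lemma abs_inner_sub_le {f : ℕ → E} {ε : ℝ} (hε : 0 ≤ ε) {g : E} {k l : ℕ} (hkl : k ≤ l)
    (h : ∀ m, k ≤ m → |inner ℝ (f (m + 1) - f m) g| ≤ ε * (1 / 2) ^ (m + 1)) :
    |inner ℝ (f l - f k) g| ≤ ε * (1 / 2) ^ k := by
  rw [← Finset.sum_Ico_sub f hkl, sum_inner]
  refine (Finset.abs_sum_le_sum_abs _ _).trans ?_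
  refine (Finset.sum_le_sum fun m hm => h m (Finset.mem_Ico.mp hm).1).trans ?_
  rw [← Finset.mul_sum]
  exact mul_le_mul_of_nonneg_left (sum_Ico_half_pow_le hkl) hε

/-- A bounded sequence with almost orthogonal increments converges, and the energy gains tend to
zero. -/
theorem cauchySeq_of_almost_orthogonal {f : ℕ → E} {a : ℕ → ℝ} {ε c B : ℝ} (hε : 0 ≤ ε)
    (hc : 0 < c) (ha : ∀ k, 0 ≤ a k) (hB : ∀ k, ‖f k‖ ^ 2 ≤ B)
    (horth : ∀ j k, j ≤ k → |inner ℝ (f (k + 1) - f k) (f j)| ≤ ε * (1 / 2) ^ (k + 1))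
    (hgain : ∀ k, c * a k - ε * (1 / 2) ^ (k + 1) ≤ ‖f (k + 1) - f k‖ ^ 2) :
    CauchySeq f ∧ Tendsto a atTop (𝓝 0) := by
  have hsq : ∀ x y : E, ‖x - y‖ ^ 2 = ‖x‖ ^ 2 - ‖y‖ ^ 2 - 2 * inner ℝ (x - y) y := fun x y => by
    rw [norm_sub_sq_real, inner_sub_left, real_inner_self_eq_norm_sq]
    ring
  -- The energies increase up to an error 3ε 2^−(k+1) per step: one share from the gain and two from
  -- the cross term. The correction, whose step difference is exactly this error, makes F monotone.
  set F : ℕ → ℝ := fun k => ‖f k‖ ^ 2 - 3 * ε * (1 / 2) ^ k with hF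
  have hstep : ∀ k, c * a k ≤ F (k + 1) - F k := fun k => by
    have h1 := hgain k
    have h2 := (abs_le.mp (horth k k le_rfl)).1
    rw [hsq] at h1
    simp only [hF, pow_succ] at h1 h2 ⊢
    linarith
  have hmono : Monotone F := monotone_nat_of_le_succ fun k => by
    linarith [hstep k, mul_nonneg hc.le (ha k)]
  have hbdd : BddAbove (range F) := by
    refine ⟨B, ?_⟩
    rintro _ ⟨k, rfl⟩
    have := hB k
    have : 0 ≤ 3 * ε * (1 / 2) ^ k := by positivity
    simp only [hF]
    linarith
  have hlim := tendsto_atTop_ciSup hmono hbdd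
  have hpow : Tendsto (fun k : ℕ => (1 / 2 : ℝ) ^ k) atTop (𝓝 0) :=
    tendsto_pow_atTop_nhds_zero_of_lt_one (by norm_num) (by norm_num)
  constructor
  · have hcl : ∀ k l, k ≤ l → ‖f l - f k‖ ^ 2 ≤ F l - F k + 2 * ε * (1 / 2) ^ k := by
      intro k l hkl
      have h2 := (abs_le.mp (abs_inner_sub_le hε hkl fun m hm => horth k m hm)).1
      have h3 : (0 : ℝ) ≤ ε * (1 / 2) ^ k - ε * (1 / 2) ^ l := by
        rw [← mul_sub]
        exact mul_nonneg hε (sub_nonneg.mpr (pow_le_pow_of_le_one (by norm_num) (by norm_num) hkl))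
      rw [hsq]
      simp only [hF]
      linarith
    rw [Metric.cauchySeq_iff']
    intro δ hδ
    have h0 : Tendsto (fun k => (⨆ i, F i) - F k + 2 * ε * (1 / 2) ^ k) atTop (𝓝 0) := by
      have := (hlim.const_sub (⨆ i, F i)).add (hpow.const_mul (2 * ε))
      simpa using this
    obtain ⟨k, hk⟩ := (h0.eventually_lt_const (show 0 < δ ^ 2 by positivity)).exists
    refine ⟨k, fun l hl => ?_⟩
    rw [dist_eq_norm]
    refine lt_of_pow_lt_pow_left₀ 2 hδ.le (((hcl k l hl).trans ?_).trans_lt hk)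
    linarith [le_ciSup hbdd l]
  · have h0 : Tendsto (fun k => c⁻¹ * (F (k + 1) - F k)) atTop (𝓝 0) := by
      have := ((hlim.comp (tendsto_add_atTop_nat 1)).sub hlim).const_mul c⁻¹
      simpa using this
    refine squeeze_zero ha (fun k => ?_) h0
    rw [← div_eq_inv_mul, le_div_iff₀ hc]
    linarith [hstep k]

end Hilbert

/-- Exhaustion of an open set by compact sets. -/
lemma exists_compact_exhaustion {X : Type*} [PseudoMetricSpace X] [ProperSpace X] [Nonempty X]
    {U : Set X} (hU : IsOpen U) : ∃ C : ℕ → Set X, (∀ k, IsCompact (C k)) ∧ (∀ k, C k ⊆ U) ∧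
      ∀ x ∈ U, ∀ᶠ k in atTop, x ∈ C k := by
  obtain ⟨F, hF, hFU, hFe, hFm⟩ := hU.exists_iUnion_isClosed
  obtain ⟨o⟩ := ‹Nonempty X›
  refine ⟨fun k => F k ∩ Metric.closedBall o k,
    fun k => (isCompact_closedBall o k).inter_left (hF k),
    fun k => inter_subset_left.trans (hFU k), fun x hx => ?_⟩
  rw [← hFe] at hx
  obtain ⟨k, hk⟩ := mem_iUnion.mp hx
  filter_upwards [eventually_ge_atTop k, eventually_ge_atTop ⌈dist x o⌉₊] with m hm hm'
  exact ⟨hFm hm hk, Metric.mem_closedBall.mpr (Nat.ceil_le.mp hm')⟩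

/-! ### Iterating the perturbation step. -/

section Iteration

variable {n : ℕ} {T : ℝ} {Ω : Set (Rn n)} {ebar : Rn n → ℝ → ℝ} {v₀ v : Rn n → ℝ → Rn n}
  {u₀ u : Rn n → ℝ → Matrix (Fin n) (Fin n) ℝ} {q₀ : Rn n → ℝ → ℝ}

/-- Iterated perturbations, with increments almost orthogonal to all earlier fields. -/
theorem Subsolution.exists_sequence (h : Subsolution T Ω ebar v₀ u₀ q₀ v u)
    (H : Background T Ω ebar v₀ u₀ q₀) {g : Rn n → ℝ → Rn n} (hg : SmoothOnSlab T g)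
    {C : ℕ → Set (Rn n × ℝ)} (hC : ∀ k, IsCompact (C k)) (hCU : ∀ k, C k ⊆ Ω ×ˢ Ioo 0 T)
    {η : ℕ → ℝ} (hη : ∀ k, 0 < η k) :
    ∃ (V : ℕ → Rn n → ℝ → Rn n) (U : ℕ → Rn n → ℝ → Matrix (Fin n) (Fin n) ℝ), V 0 = v ∧
      (∀ k, Subsolution T Ω ebar v₀ u₀ q₀ (V k) (U k)) ∧
      (∀ j k, j ≤ k → ∀ t, |∫ x, inner ℝ (V (k + 1) x t - V k x t) (V j x t)| ≤ η k) ∧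
      (∀ k t, |∫ x, inner ℝ (V (k + 1) x t - V k x t) (g x t)| ≤ η k) ∧
      ∀ k t, gainConst n * (∫ x in {x | (x, t) ∈ C k}, gapDensity (ebar x t) (V k x t)) - η k
        ≤ ∫ x, ‖V (k + 1) x t - V k x t‖ ^ 2 := by
  -- The state carries the list of fields against which all later increments must be small; each
  -- step prepends its new velocity.
  let St := {s : (Rn n → ℝ → Rn n) × (Rn n → ℝ → Matrix (Fin n) (Fin n) ℝ) ×
    List (Rn n → ℝ → Rn n) // Subsolution T Ω ebar v₀ u₀ q₀ s.1 s.2.1 ∧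
      ∀ Φ ∈ s.2.2, SmoothOnSlab T Φ}
  have hstep : ∀ k (s : St), ∃ s' : St, s'.1.2.2 = s'.1.1 :: s.1.2.2 ∧
      (∀ Φ ∈ s.1.2.2, ∀ t, |∫ x, inner ℝ (s'.1.1 x t - s.1.1 x t) (Φ x t)| ≤ η k) ∧
      ∀ t, gainConst n * (∫ x in {x | (x, t) ∈ C k}, gapDensity (ebar x t) (s.1.1 x t)) - η k
        ≤ ∫ x, ‖s'.1.1 x t - s.1.1 x t‖ ^ 2 := by
    intro k s
    obtain ⟨v', u', hs, h1, h2⟩ := s.2.1.exists_perturbation H.two_le H.isOpen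
      H.continuousOn_energy (hC k) (hCU k) (hη k) s.1.2.2 s.2.2
    refine ⟨⟨(v', u', v' :: s.1.2.2), hs, fun Φ hΦ => ?_⟩, rfl, h1, h2⟩
    rcases List.mem_cons.mp hΦ with rfl | hΦ
    · exact hs.sol.smooth_v
    · exact s.2.2 Φ hΦ
  choose next hn1 hn2 hn3 using hstep
  let s₀ : St := ⟨(v, u, [v, g]), h, fun Φ hΦ => by
    simp only [List.mem_cons, List.not_mem_nil, or_false] at hΦ
    rcases hΦ with rfl | rfl
    · exact h.sol.smooth_v
    · exact hg⟩
  let S : ℕ → St := fun k => Nat.rec s₀ (fun k s => next k s) k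
  have hS : ∀ k, S (k + 1) = next k (S k) := fun k => rfl
  have hmono : ∀ j k, j ≤ k → ∀ Φ ∈ (S j).1.2.2, Φ ∈ (S k).1.2.2 := by
    intro j k hjk
    induction k, hjk using Nat.le_induction with
    | base => exact fun Φ hΦ => hΦ
    | succ k hk ih =>
      intro Φ hΦ
      rw [hS, hn1]
      exact List.mem_cons_of_mem _ (ih Φ hΦ)
  have hself : ∀ j, (S j).1.1 ∈ (S j).1.2.2 := by
    intro j
    cases j with
    | zero => exact List.mem_cons_self
    | succ j => rw [hS, hn1]; exact List.mem_cons_self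
  refine ⟨fun k => (S k).1.1, fun k => (S k).1.2.1, rfl, fun k => (S k).2.1,
    fun j k hjk t => hn2 k (S k) _ (hmono j k hjk _ (hself j)) t,
    fun k t => hn2 k (S k) g (hmono 0 k (Nat.zero_le k) g ?_) t, fun k t => hn3 k (S k) t⟩
  exact List.mem_cons_of_mem _ List.mem_cons_self

end Iteration


/-! ### L² tools. -/

lemma tendsto_toLp {X E : Type*} [MeasurableSpace X] {μ : Measure X} [NormedAddCommGroup E]
    {f : ℕ → X → E} {g : X → E} (hf : ∀ k, MemLp (f k) 2 μ)
    (hg : MemLp g 2 μ)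
    (h : Tendsto (fun k => eLpNorm (fun x => f k x - g x) 2 μ) atTop (𝓝 0)) :
    Tendsto (fun k => (hf k).toLp (f k)) atTop (𝓝 (hg.toLp g)) := by
  rw [tendsto_iff_edist_tendsto_0]
  refine h.congr fun k => ?_
  rw [Lp.edist_toLp_toLp]
  rfl

section LpTools

variable {X E : Type*} [MeasurableSpace X] {μ : Measure X} [NormedAddCommGroup E]
  [InnerProductSpace ℝ E]

lemma inner_toLp {f g : X → E} (hf : MemLp f 2 μ) (hg : MemLp g 2 μ) :
    inner ℝ (hf.toLp f) (hg.toLp g) = ∫ x, inner ℝ (f x) (g x) ∂μ := by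
  rw [L2.inner_def]
  refine integral_congr_ae ?_
  filter_upwards [hf.coeFn_toLp, hg.coeFn_toLp] with x h1 h2
  rw [h1, h2]

lemma norm_toLp_sq {f : X → E} (hf : MemLp f 2 μ) : ‖hf.toLp f‖ ^ 2 = ∫ x, ‖f x‖ ^ 2 ∂μ := by
  rw [← real_inner_self_eq_norm_sq, inner_toLp hf hf]
  simp only [real_inner_self_eq_norm_sq]

lemma abs_integral_inner_le {f g : X → E} (hf : MemLp f 2 μ) (hg : MemLp g 2 μ) :
    |∫ x, inner ℝ (f x) (g x) ∂μ| ≤ √(∫ x, ‖f x‖ ^ 2 ∂μ) * √(∫ x, ‖g x‖ ^ 2 ∂μ) := by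
  rw [← inner_toLp hf hg, ← norm_toLp_sq hf, ← norm_toLp_sq hg, Real.sqrt_sq (norm_nonneg _),
    Real.sqrt_sq (norm_nonneg _)]
  exact abs_real_inner_le_norm _ _

lemma eLpNorm_eq_ofReal_sqrt {f : X → E} (hf : MemLp f 2 μ) :
    eLpNorm f 2 μ = ENNReal.ofReal (√(∫ x, ‖f x‖ ^ 2 ∂μ)) := by
  rw [← norm_toLp_sq hf, Real.sqrt_sq (norm_nonneg _), Lp.norm_toLp,
    ENNReal.ofReal_toReal hf.eLpNorm_ne_top]

lemma tendsto_integral_inner_inner {f f' : ℕ → X → E} {g g' : X → E} (hf : ∀ k, MemLp (f k) 2 μ)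
    (hg : MemLp g 2 μ) (hf' : ∀ k, MemLp (f' k) 2 μ) (hg' : MemLp g' 2 μ)
    (h : Tendsto (fun k => eLpNorm (fun x => f k x - g x) 2 μ) atTop (𝓝 0))
    (h' : Tendsto (fun k => eLpNorm (fun x => f' k x - g' x) 2 μ) atTop (𝓝 0)) :
    Tendsto (fun k => ∫ x, inner ℝ (f k x) (f' k x) ∂μ) atTop
      (𝓝 (∫ x, inner ℝ (g x) (g' x) ∂μ)) := by
  have := (tendsto_toLp hf hg h).inner (𝕜 := ℝ) (tendsto_toLp hf' hg' h')
  simpa only [inner_toLp] using this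

lemma tendsto_integral_inner {f : ℕ → X → E} {g φ : X → E} (hf : ∀ k, MemLp (f k) 2 μ)
    (hg : MemLp g 2 μ) (hφ : MemLp φ 2 μ)
    (h : Tendsto (fun k => eLpNorm (fun x => f k x - g x) 2 μ) atTop (𝓝 0)) :
    Tendsto (fun k => ∫ x, inner ℝ (f k x) (φ x) ∂μ) atTop (𝓝 (∫ x, inner ℝ (g x) (φ x) ∂μ)) :=
  tendsto_integral_inner_inner hf hg (fun _ => hφ) hφ h (by simp)

end LpTools

lemma memLp_of_tendsto {X E : Type*} [MeasurableSpace X] {μ : Measure X} [NormedAddCommGroup E]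
    {f : ℕ → X → E} {g : X → E} (hf : ∀ k, MemLp (f k) 2 μ)
    (hg : AEStronglyMeasurable g μ)
    (h : Tendsto (fun k => eLpNorm (fun x => f k x - g x) 2 μ) atTop (𝓝 0)) : MemLp g 2 μ := by
  obtain ⟨k, hk⟩ := (h.eventually_lt_const (show (0 : ENNReal) < 1 by simp)).exists
  have h1 : MemLp (fun x => f k x - g x) 2 μ :=
    ⟨(hf k).aestronglyMeasurable.sub hg, hk.trans ENNReal.one_lt_top⟩
  refine ((hf k).sub h1).ae_eq (Eventually.of_forall fun x => ?_)
  simp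

lemma gapDensity_nonneg {n : ℕ} {e : ℝ} (v : Rn n) (he : 0 ≤ e) : 0 ≤ gapDensity e v := by
  unfold gapDensity
  positivity

lemma gapDensity_le {n : ℕ} {e : ℝ} {v : Rn n} (he : 0 < 2 * e) (h : ‖v‖ ^ 2 ≤ 2 * e) :
    gapDensity e v ≤ 2 * e := by
  rw [gapDensity, div_le_iff₀ he, ← sq]
  exact pow_le_pow_left₀ (by linarith) (by linarith [sq_nonneg ‖v‖]) 2

lemma eq_of_gapDensity_eq_zero {n : ℕ} {e : ℝ} {v : Rn n} (he : 0 < 2 * e)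
    (h : gapDensity e v = 0) : ‖v‖ ^ 2 = 2 * e := by
  rw [gapDensity, div_eq_zero_iff, or_iff_left he.ne', sq_eq_zero_iff] at h
  linarith

/-! ### The strong limit attains the prescribed energy. -/

section Limit

variable {n : ℕ} {T : ℝ} {Ω : Set (Rn n)} {ebar : Rn n → ℝ → ℝ} {v₀ v : Rn n → ℝ → Rn n}
  {u₀ u : Rn n → ℝ → Matrix (Fin n) (Fin n) ℝ} {q₀ : Rn n → ℝ → ℝ}

lemma Subsolution.memLp (h : Subsolution T Ω ebar v₀ u₀ q₀ v u)
    (H : Background T Ω ebar v₀ u₀ q₀) {t : ℝ} (ht : t ∈ Ioo 0 T) :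
    MemLp (fun x => v x t) 2 volume := (h.weak H).memLp t (Ioo_subset_Icc_self ht)

lemma Subsolution.integrable_gapDensity (h : Subsolution T Ω ebar v₀ u₀ q₀ v u)
    (H : Background T Ω ebar v₀ u₀ q₀) {C : Set (Rn n × ℝ)} (hC : IsCompact C)
    (hCU : C ⊆ Ω ×ˢ Ioo 0 T) {t : ℝ} (ht : t ∈ Ioo 0 T) :
    IntegrableOn (fun x => gapDensity (ebar x t) (v x t)) {x | (x, t) ∈ C} := by
  have hm : MeasurableSet {x | (x, t) ∈ C} := hC.isClosed.measurableSet.preimage (by fun_prop)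
  have hsub : ∀ x ∈ {x | (x, t) ∈ C}, x ∈ Ω := fun x hx => (hCU hx).1
  refine Integrable.mono' (((H.energy.integrable t (Ioo_subset_Icc_self ht)).mono_set
    hsub).const_mul 2) (ContinuousOn.aestronglyMeasurable ?_ hm) ?_
  · have h1 : ContinuousOn (fun x => ebar x t) {x | (x, t) ∈ C} :=
      H.continuousOn_energy.comp (f := fun x : Rn n => (x, t)) (by fun_prop) fun x hx => hCU hx
    have h2 : ContinuousOn (fun x => v x t) {x | (x, t) ∈ C} :=
      (SmoothOnSlab.contDiff_slice h.sol.smooth_v ht).continuous.continuousOn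
    exact (((continuousOn_const.mul h1).sub (h2.norm.pow 2)).pow 2).div (continuousOn_const.mul h1)
      fun x hx => (h.two_mul_energy_pos H.pos (hsub x hx) ht).ne'
  · filter_upwards [self_mem_ae_restrict hm] with x hx
    have h2 := h.two_mul_energy_pos H.pos (hsub x hx) ht
    rw [Real.norm_of_nonneg (gapDensity_nonneg _ (by linarith))]
    exact gapDensity_le h2 (by linarith [h.gap_pos H.pos (hsub x hx) ht])

/-- If the gaps tend to zero, an `L²` limit of subsolutions attains the prescribed energy. -/
lemma Background.norm_sq_eq_of_tendsto (H : Background T Ω ebar v₀ u₀ q₀)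
    {V : ℕ → Rn n → ℝ → Rn n} {U : ℕ → Rn n → ℝ → Matrix (Fin n) (Fin n) ℝ}
    (hV : ∀ k, Subsolution T Ω ebar v₀ u₀ q₀ (V k) (U k)) {C : ℕ → Set (Rn n × ℝ)}
    (hC : ∀ k, IsCompact (C k)) (hCU : ∀ k, C k ⊆ Ω ×ˢ Ioo 0 T)
    (hCe : ∀ z ∈ Ω ×ˢ Ioo 0 T, ∀ᶠ k in atTop, z ∈ C k) {t : ℝ} (ht : t ∈ Ioo 0 T)
    {w : Rn n → Rn n} (hw : AEStronglyMeasurable w volume)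
    (hlim : Tendsto (fun k => eLpNorm (fun x => V k x t - w x) 2 volume) atTop (𝓝 0))
    (hgap : Tendsto (fun k => ∫ x in {x | (x, t) ∈ C k}, gapDensity (ebar x t) (V k x t)) atTop
      (𝓝 0)) : ∀ᵐ x, ‖w x‖ ^ 2 = 2 * extEnergy Ω ebar x t := by
  -- Two successive extractions: along the final subsequence the velocities converge to w, and the
  -- gap densities to 0, almost everywhere.
  obtain ⟨ns, hns, hae⟩ := (tendstoInMeasure_of_tendsto_eLpNorm two_ne_zero
    (fun k => ((hV k).memLp H ht).aestronglyMeasurable) hw hlim).exists_seq_tendsto_ae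
  set a : ℕ → Rn n → ℝ := fun k =>
    {x | (x, t) ∈ C k}.indicator fun x => gapDensity (ebar x t) (V k x t) with ha
  have hm : ∀ k, MeasurableSet {x | (x, t) ∈ C k} := fun k =>
    (hC k).isClosed.measurableSet.preimage (by fun_prop)
  have hai : ∀ k, Integrable (a k) := fun k =>
    (integrable_indicator_iff (hm k)).mpr ((hV k).integrable_gapDensity H (hC k) (hCU k) ht)
  have ha0 : ∀ k x, 0 ≤ a k x := fun k x => indicator_nonneg (fun x hx =>
    gapDensity_nonneg _ (by linarith [(hV k).two_mul_energy_pos H.pos (hCU k hx).1 ht])) x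
  have hal : Tendsto (fun k => eLpNorm (fun x => a (ns k) x - 0) 1 volume) atTop (𝓝 0) := by
    have h1 := ENNReal.tendsto_ofReal (hgap.comp hns.tendsto_atTop)
    rw [ENNReal.ofReal_zero] at h1
    refine h1.congr fun k => ?_
    simp only [sub_zero, Function.comp_apply]
    rw [eLpNorm_one_eq_lintegral_enorm, ← ofReal_integral_norm_eq_lintegral_enorm (hai _),
      ← integral_indicator (hm _)]
    exact congrArg _ (integral_congr_ae (Eventually.of_forall fun x =>
      (Real.norm_of_nonneg (ha0 (ns k) x)).symm))
  obtain ⟨ms, hms, hae'⟩ := (tendstoInMeasure_of_tendsto_eLpNorm one_ne_zero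
    (fun k => (hai (ns k)).aestronglyMeasurable) aestronglyMeasurable_const
    hal).exists_seq_tendsto_ae
  filter_upwards [hae, hae'] with x h1 h2
  by_cases hx : x ∈ Ω
  · rw [extEnergy, indicator_of_mem hx]
    have he := (hV 0).two_mul_energy_pos H.pos hx ht
    refine eq_of_gapDensity_eq_zero he (tendsto_nhds_unique ?_ h2)
    have h3 : Tendsto (fun k => gapDensity (ebar x t) (V (ns (ms k)) x t)) atTop
        (𝓝 (gapDensity (ebar x t) (w x))) := by
      have h1' := h1.comp hms.tendsto_atTop
      exact (((h1'.norm.pow 2).const_sub _).pow 2).div_const _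
    -- A given point of Ω × ]0,T[ lies in C k for all large k, so the cutoff in the gap integral
    -- disappears.
    refine h3.congr' ?_
    filter_upwards [(hns.comp hms).tendsto_atTop.eventually (hCe (x, t) ⟨hx, ht⟩)] with k hk
    exact (indicator_of_mem (show x ∈ {x | (x, t) ∈ C (ns (ms k))} from hk)
      fun x => gapDensity (ebar x t) (V (ns (ms k)) x t)).symm
  · rw [extEnergy, indicator_of_notMem hx]
    have h3 : w x = 0 := tendsto_nhds_unique h1 (by
      simp only [((hV _).eq_zero H hx ht).1]
      exact tendsto_const_nhds)
    rw [h3]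
    simp

/-- A sequence of subsolutions converging strongly, at every time, to a field attaining the
prescribed energy, and staying weakly close to the initial subsolution. -/
theorem Subsolution.exists_limit (h : Subsolution T Ω ebar v₀ u₀ q₀ v u)
    (H : Background T Ω ebar v₀ u₀ q₀) {g : Rn n → ℝ → Rn n} (hg : SmoothOnSlab T g) {ε : ℝ}
    (hε : 0 < ε) :
    ∃ (V : ℕ → Rn n → ℝ → Rn n) (U : ℕ → Rn n → ℝ → Matrix (Fin n) (Fin n) ℝ)
      (w : Rn n × ℝ → Rn n), (∀ k, Subsolution T Ω ebar v₀ u₀ q₀ (V k) (U k)) ∧ Measurable w ∧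
      (∀ t ∈ Ioo 0 T,
        Tendsto (fun k => eLpNorm (fun x => V k x t - w (x, t)) 2 volume) atTop (𝓝 0)) ∧
      (∀ t ∈ Ioo 0 T, ∀ᵐ x, ‖w (x, t)‖ ^ 2 = 2 * extEnergy Ω ebar x t) ∧
      ∀ t ∈ Ioo 0 T, MemLp (fun x => g x t) 2 volume →
        |∫ x, inner ℝ (w (x, t) - v x t) (g x t)| ≤ ε := by
  have hU : IsOpen (Ω ×ˢ Ioo 0 T : Set (Rn n × ℝ)) := H.isOpen.prod isOpen_Ioo
  obtain ⟨C, hC, hCU, hCe⟩ := exists_compact_exhaustion hU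
  -- The errors sum to ε. The same choice serves the convergence lemma and, by telescoping, the
  -- closeness to v tested against g.
  obtain ⟨V, U, hV0, hV, horth, hortg, hgain⟩ := h.exists_sequence H hg hC hCU
    (η := fun k => ε * (1 / 2) ^ (k + 1)) fun k => by positivity
  have hf : ∀ t ∈ Ioo 0 T, ∀ k, MemLp (fun x => V k x t) 2 volume := fun t ht k =>
    (hV k).memLp H ht
  have hconv : ∀ t (ht : t ∈ Ioo 0 T), CauchySeq (fun k => (hf t ht k).toLp _) ∧
      Tendsto (fun k => ∫ x in {x | (x, t) ∈ C k}, gapDensity (ebar x t) (V k x t)) atTop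
        (𝓝 0) := by
    intro t ht
    refine cauchySeq_of_almost_orthogonal hε.le (gainConst_pos H.pos) (fun k => ?_)
      (B := 2 * ∫ x, extEnergy Ω ebar x t) (fun k => ?_) (fun j k hjk => ?_) fun k => ?_
    · refine setIntegral_nonneg ((hC k).isClosed.measurableSet.preimage (by fun_prop))
        fun x hx => gapDensity_nonneg _ ?_
      linarith [(hV k).two_mul_energy_pos H.pos (hCU k hx).1 ht]
    · rw [norm_toLp_sq]
      exact (hV k).integral_norm_sq_le H ht
    · rw [← MemLp.toLp_sub, inner_toLp]
      exact horth j k hjk t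
    · rw [← MemLp.toLp_sub, norm_toLp_sq]
      exact hgain k t
  -- The fields are controlled only on the slab. Extension by zero makes them jointly measurable,
  -- and trivially Cauchy for the other times.
  obtain ⟨w, hwm, hw⟩ := exists_measurable_limit (μ := (volume : Measure (Rn n)))
    (fun k => (univ ×ˢ Ioo 0 T : Set (Rn n × ℝ)).indicator fun p => V k p.1 p.2)
    (fun k => by
      classical
      rw [← piecewise_eq_indicator]
      exact ContinuousOn.measurable_piecewise (ContDiffOn.continuousOn (hV k).sol.smooth_v)
        continuousOn_const (isOpen_slab T).measurableSet)
    (by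
      intro t δ hδ
      by_cases ht : t ∈ Ioo 0 T
      · obtain ⟨k, hk⟩ := EMetric.cauchySeq_iff.mp (hconv t ht).1 δ hδ
        refine ⟨k, fun m hm l hl => ?_⟩
        have := (hk m hm l hl).le
        rw [Lp.edist_toLp_toLp] at this
        have he : ∀ m x, (univ ×ˢ Ioo 0 T : Set (Rn n × ℝ)).indicator
            (fun p => V m p.1 p.2) (x, t) = V m x t := fun m x =>
          indicator_of_mem (show (x, t) ∈ univ ×ˢ Ioo 0 T from ⟨mem_univ _, ht⟩) _
        simp only [he]
        exact this
      · refine ⟨0, fun m _ l _ => ?_⟩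
        have : ∀ m x, (univ ×ˢ Ioo 0 T : Set (Rn n × ℝ)).indicator
            (fun p => V m p.1 p.2) (x, t) = 0 := fun m x => indicator_of_notMem (fun h => ht h.2) _
        simp [this])
  have hw' : ∀ t ∈ Ioo 0 T,
      Tendsto (fun k => eLpNorm (fun x => V k x t - w (x, t)) 2 volume) atTop (𝓝 0) := by
    intro t ht
    refine (hw t).congr fun k => ?_
    congr 1
    ext1 x
    rw [indicator_of_mem (show (x, t) ∈ univ ×ˢ Ioo 0 T from ⟨mem_univ _, ht⟩)]
  have hwt : ∀ t, AEStronglyMeasurable (fun x => w (x, t)) volume := fun t =>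
    (hwm.comp measurable_prodMk_right).aestronglyMeasurable
  refine ⟨V, U, w, hV, hwm, hw', fun t ht => H.norm_sq_eq_of_tendsto hV hC hCU hCe ht (hwt t)
    (hw' t ht) (hconv t ht).2, fun t ht hgt => ?_⟩
  have hwL := memLp_of_tendsto (hf t ht) (hwt t) (hw' t ht)
  have hlim := ((tendsto_integral_inner (hf t ht) hwL hgt (hw' t ht)).sub_const
    (∫ x, inner ℝ (v x t) (g x t))).abs
  have hvt := h.memLp H ht
  simp only [inner_sub_left]
  rw [integral_sub (integrable_inner_of_memLp hwL hgt) (integrable_inner_of_memLp hvt hgt)]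
  refine le_of_tendsto hlim (Eventually.of_forall fun k => ?_)
  have := abs_inner_sub_le (f := fun k => (hf t ht k).toLp _) hε.le (g := hgt.toLp _)
    (Nat.zero_le k) fun m _ => by
      rw [← MemLp.toLp_sub, inner_toLp]
      exact hortg m t
  rw [← MemLp.toLp_sub, inner_toLp, pow_zero, mul_one] at this
  refine le_trans (le_of_eq ?_) this
  congr 1
  rw [← integral_sub (integrable_inner_of_memLp (hf t ht k) hgt)
    (integrable_inner_of_memLp hvt hgt)]
  simp only [Pi.sub_apply, inner_sub_left, hV0]

end Limit


/-! ### Bounds for tested densities. -/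

/-- The density of the weak formulation for a limit of subsolutions, without background
pressure. -/
def limitDensity {n : ℕ} (w : Rn n × ℝ → Rn n) (φ : Rn n × ℝ → Rn n) (p : Rn n × ℝ) : ℝ :=
  inner ℝ (w p) (fderiv ℝ φ p (0, 1)) + inner ℝ (w p) (fderiv ℝ φ p (w p, 0))
    - ‖w p‖ ^ 2 / n * divX φ p

section TestFields

variable {n : ℕ} {φ : Rn n × ℝ → Rn n} {Λ : ℝ}

lemma exists_fderiv_bound (hφ : ContDiff ℝ ∞ φ) (hc : HasCompactSupport φ) :
    ∃ Λ, 0 ≤ Λ ∧ ∀ p, ‖fderiv ℝ φ p‖ ≤ Λ := by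
  obtain ⟨Λ, hΛ⟩ := (hφ.continuous_fderiv (by simp)).bounded_above_of_compact_support
    (hc.fderiv (𝕜 := ℝ))
  exact ⟨Λ, (norm_nonneg _).trans (hΛ 0), hΛ⟩

lemma fderiv_eq_zero_of_notMem {p : Rn n × ℝ} (hp : p ∉ tsupport φ) : fderiv ℝ φ p = 0 := by
  by_contra h
  exact hp (support_fderiv_subset ℝ h)

lemma norm_fderiv_apply_time_le (hΛ : ∀ p, ‖fderiv ℝ φ p‖ ≤ Λ) (p : Rn n × ℝ) :
    ‖fderiv ℝ φ p (0, 1)‖ ≤ Λ := by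
  refine ((fderiv ℝ φ p).le_opNorm _).trans ?_
  rw [Prod.norm_mk, norm_zero, norm_one, max_eq_right zero_le_one, mul_one]
  exact hΛ p

lemma norm_fderiv_apply_space_le (hΛ : ∀ p, ‖fderiv ℝ φ p‖ ≤ Λ) (p : Rn n × ℝ) (y : Rn n) :
    ‖fderiv ℝ φ p (y, 0)‖ ≤ Λ * ‖y‖ := by
  refine ((fderiv ℝ φ p).le_opNorm _).trans ?_
  rw [Prod.norm_mk, norm_zero, max_eq_left (norm_nonneg _)]
  exact mul_le_mul_of_nonneg_right (hΛ p) (norm_nonneg _)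

lemma norm_basisVec (j : Fin n) : ‖(basisVec j : Rn n)‖ = 1 := by
  simp [basisVec]

lemma abs_fderiv_entry_le (hΛ : ∀ p, ‖fderiv ℝ φ p‖ ≤ Λ) (p : Rn n × ℝ) (i j : Fin n) :
    |fderiv ℝ φ p (basisVec j, 0) i| ≤ Λ := by
  refine (abs_apply_le_norm _ i).trans ((norm_fderiv_apply_space_le hΛ p _).trans ?_)
  rw [norm_basisVec, mul_one]

lemma abs_divX_le (hΛ : ∀ p, ‖fderiv ℝ φ p‖ ≤ Λ) (p : Rn n × ℝ) : |divX φ p| ≤ n * Λ := by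
  refine (Finset.abs_sum_le_sum_abs _ _).trans
    ((Finset.sum_le_sum fun i _ => abs_fderiv_entry_le hΛ p i i).trans ?_)
  simp

lemma abs_sum_mul_fderiv_le (hΛ : ∀ p, ‖fderiv ℝ φ p‖ ≤ Λ) (p : Rn n × ℝ)
    {M : Matrix (Fin n) (Fin n) ℝ} {m : ℝ} (hM : ∀ i j, |M i j| ≤ m) :
    |∑ i, ∑ j, M i j * fderiv ℝ φ p (basisVec j, 0) i| ≤ n ^ 2 * Λ * m := by
  have h : ∀ i j, |M i j * fderiv ℝ φ p (basisVec j, 0) i| ≤ m * Λ := fun i j => by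
    rw [abs_mul]
    exact mul_le_mul (hM i j) (abs_fderiv_entry_le hΛ p i j) (abs_nonneg _)
      ((abs_nonneg _).trans (hM i j))
  refine (Finset.abs_sum_le_sum_abs _ _).trans ((Finset.sum_le_sum fun i _ =>
    (Finset.abs_sum_le_sum_abs _ _).trans (Finset.sum_le_sum fun j _ => h i j)).trans ?_)
  simp only [Finset.sum_const, Finset.card_univ, Fintype.card_fin, nsmul_eq_mul]
  exact le_of_eq (by ring)

lemma abs_inner_time_le (hΛ : ∀ p, ‖fderiv ℝ φ p‖ ≤ Λ) (p : Rn n × ℝ) (y : Rn n) :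
    |inner ℝ y (fderiv ℝ φ p (0, 1))|
      ≤ Λ * ((tsupport φ).indicator (fun _ => (1 : ℝ)) p + ‖y‖ ^ 2) := by
  have hΛ0 : 0 ≤ Λ := (norm_nonneg _).trans (hΛ p)
  by_cases hp : p ∈ tsupport φ
  · rw [indicator_of_mem hp]
    refine (abs_real_inner_le_norm _ _).trans ?_
    have := mul_le_mul_of_nonneg_left (norm_fderiv_apply_time_le hΛ p) (norm_nonneg y)
    nlinarith [sq_nonneg (‖y‖ - 1), mul_nonneg hΛ0 (sq_nonneg (‖y‖ - 1))]
  · rw [fderiv_eq_zero_of_notMem hp, indicator_of_notMem hp]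
    simp only [zero_apply, inner_zero_right, abs_zero, zero_add]
    positivity

lemma abs_limitDensity_le (hn : 0 < n) (hΛ : ∀ p, ‖fderiv ℝ φ p‖ ≤ Λ) (w : Rn n × ℝ → Rn n)
    (p : Rn n × ℝ) : |limitDensity w φ p|
      ≤ Λ * ((tsupport φ).indicator (fun _ => (1 : ℝ)) p + 3 * ‖w p‖ ^ 2) := by
  have h1 := abs_inner_time_le hΛ p (w p)
  have h2 : |inner ℝ (w p) (fderiv ℝ φ p (w p, 0))| ≤ Λ * ‖w p‖ ^ 2 := by
    refine (abs_real_inner_le_norm _ _).trans ?_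
    have := mul_le_mul_of_nonneg_left (norm_fderiv_apply_space_le hΛ p (w p)) (norm_nonneg (w p))
    linarith
  have h3 : |‖w p‖ ^ 2 / n * divX φ p| ≤ Λ * ‖w p‖ ^ 2 := by
    rw [abs_mul, abs_of_nonneg (by positivity)]
    have hn' : (0 : ℝ) < n := by exact_mod_cast hn
    refine (mul_le_mul_of_nonneg_left (abs_divX_le hΛ p) (by positivity)).trans (le_of_eq ?_)
    field_simp
  unfold limitDensity
  rw [abs_le] at *
  constructor <;> linarith

lemma abs_linDensity_le (hΛ : ∀ p, ‖fderiv ℝ φ p‖ ≤ Λ) {v : Rn n → ℝ → Rn n}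
    {u : Rn n → ℝ → Matrix (Fin n) (Fin n) ℝ} {m : ℝ} (p : Rn n × ℝ)
    (hu : ∀ i j, |u p.1 p.2 i j| ≤ 6 * m) (hv : ‖v p.1 p.2‖ ^ 2 ≤ 2 * m) :
    |linDensity v u 0 φ p|
      ≤ Λ * ((tsupport φ).indicator (fun _ => (1 : ℝ)) p + (2 + 6 * n ^ 2) * m) := by
  have hΛ0 : 0 ≤ Λ := (norm_nonneg _).trans (hΛ p)
  have h1 := abs_inner_time_le hΛ p (v p.1 p.2)
  have h2 := abs_sum_mul_fderiv_le hΛ p hu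
  have h3 := mul_le_mul_of_nonneg_left hv hΛ0
  unfold linDensity
  simp only [Pi.zero_apply, zero_mul, add_zero]
  rw [abs_le] at *
  constructor <;> linarith

lemma linDensity_eq_add (v : Rn n → ℝ → Rn n) (u : Rn n → ℝ → Matrix (Fin n) (Fin n) ℝ)
    (q : Rn n → ℝ → ℝ) (p : Rn n × ℝ) :
    linDensity v u q φ p = linDensity v u 0 φ p + q p.1 p.2 * divX φ p := by
  simp [linDensity]

lemma fderiv_apply_space_coord (p : Rn n × ℝ) (y : Rn n) (i : Fin n) :
    fderiv ℝ φ p (y, 0) i = ∑ j, y j * fderiv ℝ φ p (basisVec j, 0) i := by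
  have h : ((y, 0) : Rn n × ℝ) = ∑ j, y j • ((basisVec j, 0) : Rn n × ℝ) := by
    refine Prod.ext ?_ ?_
    · rw [Prod.fst_sum]
      exact eq_sum_basisVec y
    · rw [Prod.snd_sum]
      simp
  rw [h, map_sum]
  simp only [map_smul, WithLp.ofLp_sum, Finset.sum_apply, PiLp.smul_apply, smul_eq_mul]

/-- The linear density in terms of the gap matrix. -/
lemma linDensity_eq_gapMat (v : Rn n → ℝ → Rn n) (u : Rn n → ℝ → Matrix (Fin n) (Fin n) ℝ)
    (e : ℝ) (p : Rn n × ℝ) :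
    linDensity v u 0 φ p = inner ℝ (v p.1 p.2) (fderiv ℝ φ p (0, 1))
      + inner ℝ (v p.1 p.2) (fderiv ℝ φ p (v p.1 p.2, 0)) - 2 * e / n * divX φ p
      + ∑ i, ∑ j, gapMat e (v p.1 p.2) (u p.1 p.2) i j * fderiv ℝ φ p (basisVec j, 0) i := by
  have h1 : inner ℝ (v p.1 p.2) (fderiv ℝ φ p (v p.1 p.2, 0))
      = ∑ i, ∑ j, v p.1 p.2 i * v p.1 p.2 j * fderiv ℝ φ p (basisVec j, 0) i := by
    rw [inner_eq_sum]
    refine Finset.sum_congr rfl fun i _ => ?_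
    rw [fderiv_apply_space_coord, Finset.mul_sum]
    simp only [mul_assoc]
  have h2 : 2 * e / n * divX φ p
      = ∑ i, ∑ j, (if i = j then 2 * e / n else 0) * fderiv ℝ φ p (basisVec j, 0) i := by
    simp only [divX, Finset.mul_sum, ite_mul, zero_mul, Finset.sum_ite_eq, Finset.mem_univ, if_true]
  simp only [gapMat_apply, add_mul, sub_mul, Finset.sum_add_distrib, Finset.sum_sub_distrib]
  rw [← h1, ← h2]
  simp only [linDensity, Pi.zero_apply, zero_mul]
  ring

end TestFields

/-! ### Convergence of the tested densities at a fixed time. -/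

section LimitFormulation

variable {n : ℕ} {T : ℝ} {Ω : Set (Rn n)} {ebar : Rn n → ℝ → ℝ} {v₀ v : Rn n → ℝ → Rn n}
  {u₀ u : Rn n → ℝ → Matrix (Fin n) (Fin n) ℝ} {q₀ : Rn n → ℝ → ℝ} {φ : Rn n × ℝ → Rn n}
  {V : ℕ → Rn n → ℝ → Rn n} {U : ℕ → Rn n → ℝ → Matrix (Fin n) (Fin n) ℝ} {w : Rn n × ℝ → Rn n}

lemma integrable_tsupport_indicator (hc : HasCompactSupport φ) :
    Integrable ((tsupport φ).indicator fun _ : Rn n × ℝ => (1 : ℝ)) :=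
  (integrable_indicator_iff (IsCompact.measurableSet hc)).mpr
    (integrableOn_const (show IsCompact (tsupport φ) from hc).measure_lt_top.ne)

lemma integrable_tsupport_indicator_slice (hc : HasCompactSupport φ) (t : ℝ) :
    Integrable (fun x => (tsupport φ).indicator (fun _ : Rn n × ℝ => (1 : ℝ)) (x, t)) ∧
      ∫ x, (tsupport φ).indicator (fun _ : Rn n × ℝ => (1 : ℝ)) (x, t)
        ≤ volume.real (Prod.fst '' tsupport φ) := by
  have hS : IsCompact (Prod.fst '' tsupport φ) := IsCompact.image hc continuous_fst
  have hm : MeasurableSet {x | (x, t) ∈ tsupport φ} :=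
    (isClosed_tsupport φ).measurableSet.preimage (by fun_prop)
  have hsub : {x | (x, t) ∈ tsupport φ} ⊆ Prod.fst '' tsupport φ := fun x hx => ⟨(x, t), hx, rfl⟩
  have he : (fun x => (tsupport φ).indicator (fun _ : Rn n × ℝ => (1 : ℝ)) (x, t))
      = {x | (x, t) ∈ tsupport φ}.indicator fun _ => 1 := rfl
  have hlt : volume {x | (x, t) ∈ tsupport φ} < ⊤ := (measure_mono hsub).trans_lt hS.measure_lt_top
  rw [he]
  refine ⟨(integrable_indicator_iff hm).mpr (integrableOn_const hlt.ne), ?_⟩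
  rw [integral_indicator_const _ hm, smul_eq_mul, mul_one]
  exact measureReal_mono hsub hS.measure_lt_top.ne

lemma Subsolution.integrable_linDensity (h : Subsolution T Ω ebar v₀ u₀ q₀ v u)
    (H : Background T Ω ebar v₀ u₀ q₀) (hφ : ContDiff ℝ ∞ φ) (hc : HasCompactSupport φ) :
    IntegrableOn (linDensity v u 0 φ) (univ ×ˢ Ioo 0 T) := by
  obtain ⟨Λ, hΛ0, hΛ⟩ := exists_fderiv_bound hφ hc
  have hI : Integrable ((tsupport φ).indicator fun _ : Rn n × ℝ => (1 : ℝ))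
      (volume.restrict (univ ×ˢ Ioo 0 T)) := (integrable_tsupport_indicator hc).restrict
  refine Integrable.mono' ((hI.add
    (H.integrable_extEnergy.const_mul (2 + 6 * (n : ℝ) ^ 2))).const_mul Λ)
    (ContinuousOn.aestronglyMeasurable ?_ (isOpen_slab T).measurableSet) ?_
  · have hd := hφ.continuous_fderiv (by simp)
    have h1 := ContDiffOn.continuousOn h.sol.smooth_v
    have h2 : ∀ i j, ContinuousOn (fun p : Rn n × ℝ => u p.1 p.2 i j) (univ ×ˢ Ioo 0 T) :=
      fun i j => ContDiffOn.continuousOn (h.sol.smooth_u i j)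
    unfold linDensity
    simp only [Pi.zero_apply, zero_mul, add_zero]
    refine (h1.inner (hd.clm_apply continuous_const).continuousOn).add
      (continuousOn_finsetSum _ fun i _ => continuousOn_finsetSum _ fun j _ => (h2 i j).mul ?_)
    have := (hd.clm_apply (continuous_const (y := ((basisVec j, 0) : Rn n × ℝ))))
    exact Continuous.continuousOn (by fun_prop)
  · filter_upwards [self_mem_ae_restrict (isOpen_slab T).measurableSet] with p hp
    exact abs_linDensity_le hΛ p (h.abs_entry_le H p.1 hp.2) (h.norm_sq_le H p.1 hp.2)

lemma Subsolution.integrable_linDensity_slice (h : Subsolution T Ω ebar v₀ u₀ q₀ v u)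
    (hφ : ContDiff ℝ ∞ φ) (hc : HasCompactSupport φ) {t : ℝ} (ht : t ∈ Ioo 0 T) :
    Integrable fun x => linDensity v u 0 φ (x, t) := by
  have hd := hφ.continuous_fderiv (by simp)
  have h1 := (SmoothOnSlab.contDiff_slice h.sol.smooth_v ht).continuous
  have h2 : ∀ i j, Continuous fun x => u x t i j :=
    fun i j => (SmoothOnSlab.contDiff_slice (h.sol.smooth_u i j) ht).continuous
  refine Continuous.integrable_of_hasCompactSupport ?_ (HasCompactSupport.intro
    (IsCompact.image hc continuous_fst) (fun x hx => ?_))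
  · unfold linDensity
    simp only [Pi.zero_apply, zero_mul, add_zero]
    have e : ∀ p : Rn n × ℝ, Continuous fun x : Rn n => fderiv ℝ φ (x, t) p := fun p =>
      (hd.comp (by fun_prop : Continuous fun x : Rn n => (x, t))).clm_apply continuous_const
    refine (h1.inner (e _)).add
      (continuous_finsetSum _ fun i _ => continuous_finsetSum _ fun j _ => (h2 i j).mul ?_)
    have := e (basisVec j, 0)
    fun_prop
  · have : (x, t) ∉ tsupport φ := fun hm => hx ⟨(x, t), hm, rfl⟩
    simp [linDensity, fderiv_eq_zero_of_notMem this]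

lemma aestronglyMeasurable_fderiv_apply (hφ : ContDiff ℝ ∞ φ) (t : ℝ) {f : Rn n → Rn n}
    (hf : AEStronglyMeasurable f volume) :
    AEStronglyMeasurable (fun x => fderiv ℝ φ (x, t) (f x, 0)) volume := by
  have hd := hφ.continuous_fderiv (by simp)
  have hcont : Continuous fun z : Rn n × Rn n => fderiv ℝ φ (z.1, t) (z.2, 0) :=
    (hd.comp (by fun_prop)).clm_apply (by fun_prop)
  exact hcont.comp_aestronglyMeasurable (aestronglyMeasurable_id.prodMk hf)

/-- Convergence of the linear densities at a fixed time. -/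
lemma Background.tendsto_integral_linDensity (H : Background T Ω ebar v₀ u₀ q₀)
    (hV : ∀ k, Subsolution T Ω ebar v₀ u₀ q₀ (V k) (U k)) (hw : Measurable w) {t : ℝ}
    (ht : t ∈ Ioo 0 T)
    (hlim : Tendsto (fun k => eLpNorm (fun x => V k x t - w (x, t)) 2 volume) atTop (𝓝 0))
    (hen : ∀ᵐ x, ‖w (x, t)‖ ^ 2 = 2 * extEnergy Ω ebar x t) (hφ : ContDiff ℝ ∞ φ)
    (hc : HasCompactSupport φ) :
    Tendsto (fun k => ∫ x, linDensity (V k) (U k) 0 φ (x, t)) atTop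
      (𝓝 (∫ x, limitDensity w φ (x, t))) := by
  obtain ⟨Λ, hΛ0, hΛ⟩ := exists_fderiv_bound hφ hc
  have hd := hφ.continuous_fderiv (by simp)
  have hd' : ∀ p : Rn n × ℝ, Continuous fun x : Rn n => fderiv ℝ φ (x, t) p := fun p =>
    (hd.comp (by fun_prop : Continuous fun x : Rn n => (x, t))).clm_apply continuous_const
  have hf : ∀ k, MemLp (fun x => V k x t) 2 volume := fun k => (hV k).memLp H ht
  have hwt : AEStronglyMeasurable (fun x => w (x, t)) volume :=
    (hw.comp measurable_prodMk_right).aestronglyMeasurable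
  have hwL := memLp_of_tendsto hf hwt hlim
  have hE := H.integrable_extEnergy_slice (Ioo_subset_Icc_self ht)
  have hψ : MemLp (fun x => fderiv ℝ φ (x, t) (0, 1)) 2 volume :=
    (hd' _).memLp_of_hasCompactSupport
      (hasCompactSupport_slice (f := fun p => fderiv ℝ φ p (0, 1)) (hc.fderiv_apply ℝ _) t)
  have hA : ∀ {f : Rn n → Rn n}, MemLp f 2 volume →
      MemLp (fun x => fderiv ℝ φ (x, t) (f x, 0)) 2 volume := fun {f} hf =>
    MemLp.of_le_mul (c := Λ) hf (aestronglyMeasurable_fderiv_apply hφ t hf.1)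
      (Eventually.of_forall fun x => norm_fderiv_apply_space_le hΛ _ _)
  have hAlim : Tendsto (fun k => eLpNorm (fun x => fderiv ℝ φ (x, t) (V k x t, 0)
      - fderiv ℝ φ (x, t) (w (x, t), 0)) 2 volume) atTop (𝓝 0) := by
    have h1 := ENNReal.Tendsto.const_mul (a := ENNReal.ofReal Λ) hlim (Or.inr (by simp))
    rw [mul_zero] at h1
    refine tendsto_of_tendsto_of_tendsto_of_le_of_le tendsto_const_nhds h1
      (fun k => zero_le) fun k => ?_
    refine eLpNorm_le_mul_eLpNorm_of_ae_le_mul (Eventually.of_forall fun x => ?_) 2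
    rw [← map_sub, Prod.mk_sub_mk, sub_zero]
    exact norm_fderiv_apply_space_le hΛ _ _
  have hdiv : Integrable fun x => 2 * extEnergy Ω ebar x t / n * divX φ (x, t) := by
    refine Integrable.mul_bdd (c := n * Λ) ((hE.const_mul 2).div_const _) ?_
      (Eventually.of_forall fun x => abs_divX_le hΛ _)
    refine Continuous.aestronglyMeasurable (continuous_finsetSum _ fun i _ => ?_)
    have := hd' (basisVec i, 0)
    fun_prop
  have l1 := tendsto_integral_inner hf hwL hψ hlim
  have l2 := tendsto_integral_inner_inner hf hwL (fun k => hA (hf k)) (hA hwL) hlim hAlim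
  -- The gap entries are bounded by 2ē − |V_k|², whose integral tends to ∫2ē − ∫|w|² = 0 by strong
  -- convergence and saturation of the energy.
  have l3 : Tendsto (fun k => ∫ x, ∑ i, ∑ j, gapMat (extEnergy Ω ebar x t) (V k x t) (U k x t) i j
      * fderiv ℝ φ (x, t) (basisVec j, 0) i) atTop (𝓝 0) := by
    have h1 := tendsto_integral_inner_inner hf hwL hf hwL hlim hlim
    simp only [real_inner_self_eq_norm_sq] at h1
    have h2 := ((h1.const_sub (∫ x, 2 * extEnergy Ω ebar x t)).const_mul (n ^ 2 * Λ))
    rw [integral_congr_ae hen, sub_self, mul_zero] at h2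
    refine squeeze_zero_norm (fun k => ?_) h2
    have i1 := (hf k).integrable_norm_pow (two_ne_zero)
    rw [← integral_sub (hE.const_mul 2) i1, ← integral_const_mul]
    exact norm_integral_le_of_norm_le (((hE.const_mul 2).sub i1).const_mul _)
      (Eventually.of_forall fun x => abs_sum_mul_fderiv_le hΛ (x, t)
        ((hV k).abs_gapMat_le H x ht))
  have l4 := ((l1.add l2).sub_const (∫ x, 2 * extEnergy Ω ebar x t / n * divX φ (x, t))).add l3
  have i1 : ∀ {f : Rn n → Rn n}, MemLp f 2 volume →
      Integrable fun x => inner ℝ (f x) (fderiv ℝ φ (x, t) (0, 1)) := fun hf =>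
    integrable_inner_of_memLp hf hψ
  have i2 : ∀ {f : Rn n → Rn n}, MemLp f 2 volume →
      Integrable fun x => inner ℝ (f x) (fderiv ℝ φ (x, t) (f x, 0)) := fun hf =>
    integrable_inner_of_memLp hf (hA hf)
  have i4 : ∀ {f : Rn n → Rn n}, MemLp f 2 volume →
      Integrable fun x => inner ℝ (f x) (fderiv ℝ φ (x, t) (0, 1))
        + inner ℝ (f x) (fderiv ℝ φ (x, t) (f x, 0)) := fun hf => (i1 hf).add (i2 hf)
  have e1 : ∫ x, limitDensity w φ (x, t) = (∫ x, inner ℝ (w (x, t)) (fderiv ℝ φ (x, t) (0, 1)))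
      + (∫ x, inner ℝ (w (x, t)) (fderiv ℝ φ (x, t) (w (x, t), 0)))
      - (∫ x, 2 * extEnergy Ω ebar x t / n * divX φ (x, t)) + 0 := by
    rw [add_zero, ← integral_add (i1 hwL) (i2 hwL),
      ← integral_sub (i4 hwL) hdiv]
    refine integral_congr_ae ?_
    filter_upwards [hen] with x hx
    rw [limitDensity, hx]
  rw [e1]
  refine l4.congr fun k => ?_
  have i3 := (hV k).integrable_linDensity_slice hφ hc ht
  have e2 : ∀ x, ∑ i, ∑ j, gapMat (extEnergy Ω ebar x t) (V k x t) (U k x t) i j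
      * fderiv ℝ φ (x, t) (basisVec j, 0) i = linDensity (V k) (U k) 0 φ (x, t)
        - (inner ℝ (V k x t) (fderiv ℝ φ (x, t) (0, 1))
          + inner ℝ (V k x t) (fderiv ℝ φ (x, t) (V k x t, 0))
          - 2 * extEnergy Ω ebar x t / n * divX φ (x, t)) := fun x => by
    rw [linDensity_eq_gapMat (V k) (U k) (extEnergy Ω ebar x t) (x, t)]
    ring
  simp only [e2]
  rw [integral_sub i3 ((i4 (hf k)).sub hdiv : Integrable fun x =>
      inner ℝ (V k x t) (fderiv ℝ φ (x, t) (0, 1))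
        + inner ℝ (V k x t) (fderiv ℝ φ (x, t) (V k x t, 0))
        - 2 * extEnergy Ω ebar x t / n * divX φ (x, t)), integral_sub (i4 (hf k)) hdiv,
    integral_add (i1 (hf k)) (i2 (hf k))]
  ring

end LimitFormulation


/-! ### Passage to the limit on the slab: Euler and the pressure. -/

section SlabLimit

variable {n : ℕ} {T : ℝ} {Ω : Set (Rn n)} {ebar : Rn n → ℝ → ℝ} {v₀ v : Rn n → ℝ → Rn n}
  {u₀ u : Rn n → ℝ → Matrix (Fin n) (Fin n) ℝ} {q₀ : Rn n → ℝ → ℝ} {φ : Rn n × ℝ → Rn n}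
  {V : ℕ → Rn n → ℝ → Rn n} {U : ℕ → Rn n → ℝ → Matrix (Fin n) (Fin n) ℝ} {w : Rn n × ℝ → Rn n}

lemma integral_norm_sq_eq_of_energy
    (hen : ∀ t ∈ Ioo 0 T, ∀ᵐ x, ‖w (x, t)‖ ^ 2 = 2 * extEnergy Ω ebar x t) {t : ℝ}
    (ht : t ∈ Ioo 0 T) : ∫ x, ‖w (x, t)‖ ^ 2 = 2 * ∫ x, extEnergy Ω ebar x t := by
  rw [integral_congr_ae (hen t ht), integral_const_mul]

lemma Background.integrable_norm_sq (H : Background T Ω ebar v₀ u₀ q₀) (hw : Measurable w)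
    (hen : ∀ t ∈ Ioo 0 T, ∀ᵐ x, ‖w (x, t)‖ ^ 2 = 2 * extEnergy Ω ebar x t) :
    IntegrableOn (fun p => ‖w p‖ ^ 2) (univ ×ˢ Ioo 0 T) := by
  obtain ⟨B, -, -, hB⟩ := H.exists_bound
  have hm : Measurable fun p => ‖w p‖ ^ 2 := hw.norm.pow_const 2
  rw [IntegrableOn, restrict_slab_eq_prod, integrable_prod_iff' hm.aestronglyMeasurable]
  refine ⟨?_, Integrable.of_bound
    hm.norm.aestronglyMeasurable.prod_swap.integral_prod_right' B ?_⟩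
  · filter_upwards [self_mem_ae_restrict measurableSet_Ioo] with t ht
    exact ((H.integrable_extEnergy_slice (Ioo_subset_Icc_self ht)).const_mul 2).congr
      ((hen t ht).mono fun x hx => hx.symm)
  · filter_upwards [self_mem_ae_restrict measurableSet_Ioo] with t ht
    rw [Real.norm_of_nonneg (integral_nonneg fun x => norm_nonneg _)]
    simp only [norm_pow, norm_norm]
    rw [integral_norm_sq_eq_of_energy hen ht]
    exact hB t ht

lemma Background.integrable_limitDensity (H : Background T Ω ebar v₀ u₀ q₀) (hw : Measurable w)
    (hen : ∀ t ∈ Ioo 0 T, ∀ᵐ x, ‖w (x, t)‖ ^ 2 = 2 * extEnergy Ω ebar x t)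
    (hφ : ContDiff ℝ ∞ φ) (hc : HasCompactSupport φ) :
    IntegrableOn (limitDensity w φ) (univ ×ˢ Ioo 0 T) := by
  obtain ⟨Λ, hΛ0, hΛ⟩ := exists_fderiv_bound hφ hc
  have hd := hφ.continuous_fderiv (by simp)
  have hI : Integrable ((tsupport φ).indicator fun _ : Rn n × ℝ => (1 : ℝ))
      (volume.restrict (univ ×ˢ Ioo 0 T)) := (integrable_tsupport_indicator hc).restrict
  refine Integrable.mono' ((hI.add ((H.integrable_norm_sq hw hen).const_mul 3)).const_mul Λ)
    (Measurable.aestronglyMeasurable ?_)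
    (Eventually.of_forall fun p => abs_limitDensity_le H.pos hΛ w p)
  have hcont : Continuous fun z : (Rn n × ℝ) × Rn n => fderiv ℝ φ z.1 (z.2, 0) :=
    (hd.comp continuous_fst).clm_apply (by fun_prop)
  have h2 : Measurable fun p => fderiv ℝ φ p (w p, 0) :=
    hcont.measurable.comp (measurable_id.prodMk hw)
  have h1 : Measurable fun p => fderiv ℝ φ p (0, 1) :=
    (hd.clm_apply continuous_const).measurable
  have h3 : Measurable (divX φ) := by
    refine Continuous.measurable (continuous_finsetSum _ fun i _ => ?_)
    have := hd.clm_apply (continuous_const (y := ((basisVec i, 0) : Rn n × ℝ)))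
    fun_prop
  exact ((hw.inner h1).add (hw.inner h2)).sub (((hw.norm.pow_const 2).div_const _).mul h3)

/-- The weak formulation on `[0,T[` passes to the limit. -/
theorem Background.integral_limitDensity (H : Background T Ω ebar v₀ u₀ q₀)
    (hV : ∀ k, Subsolution T Ω ebar v₀ u₀ q₀ (V k) (U k)) (hw : Measurable w)
    (hlim : ∀ t ∈ Ioo 0 T,
      Tendsto (fun k => eLpNorm (fun x => V k x t - w (x, t)) 2 volume) atTop (𝓝 0))
    (hen : ∀ t ∈ Ioo 0 T, ∀ᵐ x, ‖w (x, t)‖ ^ 2 = 2 * extEnergy Ω ebar x t)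
    (hφ : ContDiff ℝ ∞ φ) (hc : HasCompactSupport φ) (hsupp : tsupport φ ⊆ univ ×ˢ Iio T)
    (hq : IntegrableOn (fun p => q₀ p.1 p.2 * divX φ p) (univ ×ˢ Ioo 0 T)) :
    (∫ p in univ ×ˢ Ioo 0 T, (limitDensity w φ p + q₀ p.1 p.2 * divX φ p))
      + ∫ x, inner ℝ (v₀ x 0) (φ (x, 0)) = 0 := by
  obtain ⟨B, hB0, hB, hEB⟩ := H.exists_bound
  obtain ⟨Λ, hΛ0, hΛ⟩ := exists_fderiv_bound hφ hc
  have hL := fun k => (hV k).integrable_linDensity H hφ hc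
  have hW := H.integrable_limitDensity hw hen hφ hc
  -- The right-hand side does not depend on k, since all subsolutions share q₀ and the value at t =
  -- 0.
  have hk : ∀ k, (∫ p in univ ×ˢ Ioo 0 T, linDensity (V k) (U k) 0 φ p)
      = -((∫ p in univ ×ˢ Ioo 0 T, q₀ p.1 p.2 * divX φ p)
        + ∫ x, inner ℝ (v₀ x 0) (φ (x, 0))) := by
    intro k
    have hi : IntegrableOn (linDensity (V k) (U k) q₀ φ) (univ ×ˢ Ioo 0 T) := by
      refine Integrable.congr ((hL k).add hq) (Eventually.of_forall fun p => ?_)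
      exact (linDensity_eq_add (V k) (U k) q₀ p).symm
    have h1 := (hV k).sol.integral_linDensity H.T_pos ((hV k).weak H) (hB _ _ (hV k)) hφ hc
      hsupp hi
    simp only [linDensity_eq_add (V k) (U k) q₀] at h1
    rw [integral_add (hL k) hq] at h1
    simp only [(hV k).eq_of_notMem _ (show (0 : ℝ) ∉ Ioo 0 T from fun h => lt_irrefl _ h.1)] at h1
    linarith
  have hconv : Tendsto (fun k => ∫ p in univ ×ˢ Ioo 0 T, linDensity (V k) (U k) 0 φ p) atTop
      (𝓝 (∫ p in univ ×ˢ Ioo 0 T, limitDensity w φ p)) := by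
    simp only [IntegrableOn, restrict_slab_eq_prod] at hL hW ⊢
    rw [integral_prod_symm _ hW]
    simp only [integral_prod_symm _ (hL _)]
    -- L² convergence is not uniform in time; the slice integrals are dominated by the uniform
    -- energy bound B.
    refine tendsto_integral_of_dominated_convergence
      (fun _ => Λ * (volume.real (Prod.fst '' tsupport φ) + (2 + 6 * n ^ 2) * B))
      (fun k => (hL k).integral_prod_right.aestronglyMeasurable) (integrable_const _)
      (fun k => ?_) ?_
    · filter_upwards [self_mem_ae_restrict measurableSet_Ioo] with t ht
      obtain ⟨hS, hS'⟩ := integrable_tsupport_indicator_slice hc t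
      have hE := (H.integrable_extEnergy_slice (Ioo_subset_Icc_self ht)).const_mul
        (2 + 6 * (n : ℝ) ^ 2)
      have hE0 : 0 ≤ ∫ x, extEnergy Ω ebar x t :=
        integral_nonneg fun x => H.extEnergy_nonneg x ht
      refine (norm_integral_le_of_norm_le ((hS.add hE).const_mul Λ)
        (Eventually.of_forall fun x => abs_linDensity_le hΛ (x, t)
          ((hV k).abs_entry_le H x ht) ((hV k).norm_sq_le H x ht))).trans ?_
      rw [integral_const_mul]
      refine mul_le_mul_of_nonneg_left ?_ hΛ0
      refine (integral_add hS hE).trans_le ?_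
      rw [integral_const_mul]
      have h3 : ∫ x, extEnergy Ω ebar x t ≤ B := by linarith [hEB t ht]
      exact add_le_add hS' (mul_le_mul_of_nonneg_left h3 (by positivity))
    · filter_upwards [self_mem_ae_restrict measurableSet_Ioo] with t ht
      exact H.tendsto_integral_linDensity hV hw ht (hlim t ht) (hen t ht) hφ hc
  have huniq := tendsto_nhds_unique hconv (by simp only [hk]; exact tendsto_const_nhds)
  rw [integral_add hW hq, huniq]
  ring

/-- The limit field, with the reference values outside `]0,T[`. -/
def timeExtend {n : ℕ} (T : ℝ) (v₀ : Rn n → ℝ → Rn n) (w : Rn n × ℝ → Rn n) (x : Rn n) (t : ℝ) :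
    Rn n := open Classical in if t ∈ Ioo 0 T then w (x, t) else v₀ x t

lemma timeExtend_of_mem {t : ℝ} (ht : t ∈ Ioo 0 T) (x : Rn n) :
    timeExtend T v₀ w x t = w (x, t) := if_pos ht

lemma timeExtend_of_notMem {t : ℝ} (ht : t ∉ Ioo 0 T) (x : Rn n) :
    timeExtend T v₀ w x t = v₀ x t := if_neg ht

lemma timeExtend_momentumDensity {p : Rn n × ℝ} (hp : p.2 ∈ Ioo 0 T) :
    momentumDensity (timeExtend T v₀ w) φ p
      = limitDensity w φ p + ‖w p‖ ^ 2 / n * divX φ p := by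
  simp only [momentumDensity, timeExtend_of_mem hp, limitDensity]
  ring

/-- A sequence of subsolutions which converges strongly to a field of the prescribed energy. -/
structure StrongLimit (T : ℝ) (Ω : Set (Rn n)) (ebar : Rn n → ℝ → ℝ)
    (v₀ : Rn n → ℝ → Rn n) (u₀ : Rn n → ℝ → Matrix (Fin n) (Fin n) ℝ)
    (q₀ : Rn n → ℝ → ℝ) (V : ℕ → Rn n → ℝ → Rn n)
    (U : ℕ → Rn n → ℝ → Matrix (Fin n) (Fin n) ℝ) (w : Rn n × ℝ → Rn n) : Prop where
  background : Background T Ω ebar v₀ u₀ q₀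
  subsol : ∀ k, Subsolution T Ω ebar v₀ u₀ q₀ (V k) (U k)
  measurable : Measurable w
  tendsto : ∀ t ∈ Ioo 0 T,
    Tendsto (fun k => eLpNorm (fun x => V k x t - w (x, t)) 2 volume) atTop (𝓝 0)
  energy : ∀ t ∈ Ioo 0 T, ∀ᵐ x, ‖w (x, t)‖ ^ 2 = 2 * extEnergy Ω ebar x t

lemma StrongLimit.memLp (h : StrongLimit T Ω ebar v₀ u₀ q₀ V U w) {t : ℝ} (ht : t ∈ Ioo 0 T) :
    MemLp (fun x => w (x, t)) 2 volume :=
  memLp_of_tendsto (fun k => (h.subsol k).memLp h.background ht)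
    (h.measurable.comp measurable_prodMk_right).aestronglyMeasurable (h.tendsto t ht)

lemma StrongLimit.weaklyDivFree (h : StrongLimit T Ω ebar v₀ u₀ q₀ V U w) {t : ℝ}
    (ht : t ∈ Ioo 0 T) : WeaklyDivFree fun x => w (x, t) := by
  intro ψ hψ hc
  have hg : Continuous (gradient ψ) :=
    (InnerProductSpace.toDual ℝ (Rn n)).symm.continuous.comp (hψ.continuous_fderiv (by simp))
  have hgc : HasCompactSupport (gradient ψ) := by
    refine hc.mono' fun x hx => ?_
    refine support_fderiv_subset ℝ (f := ψ) fun h0 => hx ?_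
    simp [gradient, h0]
  have he : ∀ y x, fderiv ℝ ψ x y = inner ℝ y (gradient ψ x) := fun y x => by
    rw [real_inner_comm, gradient, InnerProductSpace.toDual_symm_apply]
  have hl := tendsto_integral_inner (fun k => (h.subsol k).memLp h.background ht) (h.memLp ht)
    (hg.memLp_of_hasCompactSupport hgc) (h.tendsto t ht)
  have hz : ∀ k, ∫ x, inner ℝ (V k x t) (gradient ψ x) = 0 := fun k => by
    simp only [← he]
    exact (h.subsol k).sol.weaklyDivFree ht ψ hψ hc
  simp only [hz] at hl
  simp only [he]
  exact tendsto_nhds_unique tendsto_const_nhds hl |>.symm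

/-- Test fields are divergence-free on [0,T[, so both the q₀ term and the |w|²/n term drop out, and
no integrability of q₀ near t = 0 is required. -/
lemma StrongLimit.isWeakSolution (h : StrongLimit T Ω ebar v₀ u₀ q₀ V U w) :
    IsWeakSolution T (fun x => v₀ x 0) (timeExtend T v₀ w) where
  locL2 K hK hKs := by
    have h1 : MemLp (fun p : Rn n × ℝ => timeExtend T v₀ w p.1 p.2) 2
        (volume.restrict (univ ×ˢ Ico 0 T)) := by
      have e : (volume : Measure (Rn n × ℝ)).restrict (univ ×ˢ Ico 0 T)
          = volume.restrict (univ ×ˢ Ioo 0 T) := by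
        rw [restrict_slab_eq_prod, Measure.volume_eq_prod, ← Measure.prod_restrict,
          Measure.restrict_univ, Measure.restrict_congr_set Ioo_ae_eq_Ico]
      rw [e]
      have h2 : MemLp w 2 (volume.restrict (univ ×ˢ Ioo 0 T)) :=
        (memLp_two_iff_integrable_sq_norm h.measurable.aestronglyMeasurable).mpr
          (h.background.integrable_norm_sq h.measurable h.energy)
      refine h2.ae_eq ?_
      filter_upwards [self_mem_ae_restrict (isOpen_slab T).measurableSet] with p hp
      exact (timeExtend_of_mem hp.2 p.1).symm
    exact h1.mono_measure (Measure.restrict_mono hKs le_rfl)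
  div_free := by
    filter_upwards [self_mem_ae_restrict measurableSet_Ioo] with t ht
    simp only [timeExtend_of_mem ht]
    exact h.weaklyDivFree ht
  momentum φ hφ hc hs hdiv := by
    have hz : ∀ p ∈ (univ ×ˢ Ioo 0 T : Set (Rn n × ℝ)), divX φ p = 0 := fun p hp =>
      hdiv p.1 p.2 ⟨hp.2.1.le, hp.2.2⟩
    have hq : IntegrableOn (fun p : Rn n × ℝ => q₀ p.1 p.2 * divX φ p) (univ ×ˢ Ioo 0 T) :=
      IntegrableOn.congr_fun integrableOn_zero (fun p hp => by simp [hz p hp])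
        (isOpen_slab T).measurableSet
    refine Eq.trans ?_ (h.background.integral_limitDensity h.subsol h.measurable h.tendsto
      h.energy hφ hc hs hq)
    congr 1
    refine setIntegral_congr_fun (isOpen_slab T).measurableSet fun p hp => ?_
    simp only [timeExtend_momentumDensity hp.2, hz p hp, mul_zero]

lemma StrongLimit.hasPressure (h : StrongLimit T Ω ebar v₀ u₀ q₀ V U w) :
    HasPressure T (timeExtend T v₀ w)
      (fun x t => q₀ x t - 1 / (n : ℝ) * ‖timeExtend T v₀ w x t‖ ^ 2) where
  locInt := by
    have h1 : LocallyIntegrableOn (fun z : Rn n × ℝ => q₀ z.1 z.2) (univ ×ˢ Ioo 0 T) :=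
      (ContDiffOn.continuousOn h.background.subsol.sol.smooth_q).locallyIntegrableOn
        (isOpen_slab T).measurableSet
    have h2 : IntegrableOn (fun z : Rn n × ℝ => 1 / (n : ℝ) * ‖timeExtend T v₀ w z.1 z.2‖ ^ 2)
        (univ ×ˢ Ioo 0 T) := by
      refine ((h.background.integrable_norm_sq h.measurable h.energy).congr_fun (fun p hp => ?_)
        (isOpen_slab T).measurableSet).const_mul (1 / (n : ℝ))
      simp only [timeExtend_of_mem hp.2]
    exact h1.sub h2.locallyIntegrableOn
  momentum φ hφ hc hs := by
    have hs' : tsupport φ ⊆ univ ×ˢ Iio T := fun p hp => ⟨mem_univ _, (hs hp).2.2⟩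
    have hφ0 : ∀ x, φ (x, 0) = 0 := fun x => by
      by_contra h0
      exact lt_irrefl (0 : ℝ) (hs (subset_tsupport _ h0)).2.1
    -- Here the divergence need not vanish, but the support is a compact subset of the open slab,
    -- where q₀ is continuous.
    have hq : IntegrableOn (fun p : Rn n × ℝ => q₀ p.1 p.2 * divX φ p) (univ ×ˢ Ioo 0 T) := by
      have hd := hφ.continuous_fderiv (by simp)
      have h3 : Continuous (divX φ) := by
        refine continuous_finsetSum _ fun i _ => ?_
        have := hd.clm_apply (continuous_const (y := ((basisVec i, 0) : Rn n × ℝ)))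
        fun_prop
      refine IntegrableOn.of_forall_sdiff_eq_zero (s := tsupport φ)
        (ContinuousOn.integrableOn_compact hc
          (((ContDiffOn.continuousOn h.background.subsol.sol.smooth_q).mono hs).mul
            h3.continuousOn)) (isOpen_slab T).measurableSet fun p hp => ?_
      simp [divX, fderiv_eq_zero_of_notMem hp.2]
    have key := h.background.integral_limitDensity h.subsol h.measurable h.tendsto h.energy hφ hc
      hs' hq
    simp only [hφ0, inner_zero_right, integral_zero, add_zero] at key
    refine Eq.trans ?_ key
    refine setIntegral_congr_fun (isOpen_slab T).measurableSet fun p hp => ?_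
    simp only [timeExtend_momentumDensity hp.2, timeExtend_of_mem hp.2]
    ring

end SlabLimit


/-! ### Weak continuity in time. -/

section WeakContinuity

variable {n : ℕ} {T : ℝ} {Ω : Set (Rn n)} {ebar : Rn n → ℝ → ℝ} {v₀ v : Rn n → ℝ → Rn n}
  {u₀ u : Rn n → ℝ → Matrix (Fin n) (Fin n) ℝ} {q₀ : Rn n → ℝ → ℝ} {φ : Rn n × ℝ → Rn n}
  {V : ℕ → Rn n → ℝ → Rn n} {U : ℕ → Rn n → ℝ → Matrix (Fin n) (Fin n) ℝ} {w : Rn n × ℝ → Rn n}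

lemma fderiv_comp_fst {ψ : Rn n → Rn n} (hψ : ContDiff ℝ ∞ ψ) (p : Rn n × ℝ) :
    fderiv ℝ (fun p : Rn n × ℝ => ψ p.1) p
      = (fderiv ℝ ψ p.1).comp (ContinuousLinearMap.fst ℝ (Rn n) ℝ) :=
  (HasFDerivAt.comp p (hψ.differentiable (by simp) p.1).hasFDerivAt hasFDerivAt_fst).fderiv

/-- Subsolutions depend on time in a uniformly Lipschitz way, when tested against smooth fields. -/
lemma Background.exists_lipschitz (H : Background T Ω ebar v₀ u₀ q₀) {ψ : Rn n → Rn n}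
    (hψ : ContDiff ℝ ∞ ψ) (hc : HasCompactSupport ψ) :
    ∃ L, 0 ≤ L ∧ ∀ v u, Subsolution T Ω ebar v₀ u₀ q₀ v u → ∀ s ∈ Icc 0 T, ∀ t ∈ Icc 0 T, s < t →
      |(∫ x, inner ℝ (v x t - v₀ x t) (ψ x)) - ∫ x, inner ℝ (v x s - v₀ x s) (ψ x)|
        ≤ L * (t - s) := by
  obtain ⟨B, hB0, -, hEB⟩ := H.exists_bound
  obtain ⟨Λ, hΛ⟩ := (hψ.continuous_fderiv (by simp)).bounded_above_of_compact_support
    (hc.fderiv (𝕜 := ℝ))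
  have hΛ0 : 0 ≤ Λ := (norm_nonneg _).trans (hΛ 0)
  have hψL : MemLp ψ 2 volume := hψ.continuous.memLp_of_hasCompactSupport hc
  set Φ : Rn n × ℝ → Rn n := fun p => ψ p.1 with hΦ
  have hΦs : ContDiff ℝ ∞ Φ := hψ.comp contDiff_fst
  have hΦΛ : ∀ p, ‖fderiv ℝ Φ p‖ ≤ Λ := fun p => by
    rw [fderiv_comp_fst hψ]
    refine (ContinuousLinearMap.opNorm_comp_le _ _).trans ?_
    exact (mul_le_of_le_one_right (norm_nonneg _) (ContinuousLinearMap.norm_fst_le _ _ _)).trans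
      (hΛ _)
  refine ⟨n ^ 2 * Λ * (6 * B), by positivity, fun v u h s hs t ht hst => ?_⟩
  -- In the difference with the background the pressure q₀, on which no bound is available, cancels.
  -- The time derivative is then controlled by the stresses, hence by the energy.
  have hsol := h.sol.add_smul H.subsol.sol (-1)
  set d : Rn n → ℝ → Rn n := fun x t => v x t + (-1 : ℝ) • v₀ x t with hd
  have hdv : ∀ x t, v x t - v₀ x t = d x t := fun x t => by
    simp [hd, sub_eq_add_neg]
  simp only [hdv]
  have hcont : ContinuousOn (fun t => ∫ x, inner ℝ (d x t) (ψ x)) (Icc 0 T) := by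
    refine (((h.weak H).continuous ψ hψL).sub (H.weak.continuous ψ hψL)).congr fun t ht => ?_
    simp only [← hdv, inner_sub_left]
    exact integral_sub (integrable_inner_of_memLp ((h.weak H).memLp t ht) hψL)
      (integrable_inner_of_memLp (H.weak.memLp t ht) hψL)
  have hsub : Icc s t ⊆ Icc 0 T := Icc_subset_Icc hs.1 ht.2
  have hsub' : Ioo s t ⊆ Ioo 0 T := Ioo_subset_Ioo hs.1 ht.2
  -- The test field does not depend on time and so has no compact support in space-time; the
  -- derivative formula only asks for compact spatial support.
  obtain ⟨r, hr, hslope⟩ := exists_hasDerivAt_eq_slope (fun t => ∫ x, inner ℝ (d x t) (ψ x)) _ hst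
    (hcont.mono hsub) fun r hr => hsol.hasDerivAt_integral hΦs hc
      (fun x _ hx => image_eq_zero_of_notMem_tsupport (f := ψ) hx) (hsub' hr)
  have hr' := hsub' hr
  rw [eq_div_iff (sub_pos.mpr hst).ne'] at hslope
  rw [← hslope, abs_mul, abs_of_pos (sub_pos.mpr hst)]
  refine mul_le_mul_of_nonneg_right ?_ (sub_pos.mpr hst).le
  have hE := H.integrable_extEnergy_slice (Ioo_subset_Icc_self hr')
  rw [← Real.norm_eq_abs]
  refine (norm_integral_le_of_norm_le ((hE.const_mul 12).const_mul (n ^ 2 * Λ))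
    (Eventually.of_forall fun x => ?_)).trans ?_
  · have h0 : fderiv ℝ Φ (x, r) (0, 1) = 0 := by
      rw [fderiv_comp_fst hψ]
      simp
    rw [linDensity, h0, inner_zero_right, zero_add, neg_one_mul, add_neg_cancel, zero_mul, add_zero,
      Real.norm_eq_abs]
    refine abs_sum_mul_fderiv_le hΦΛ (x, r) fun i j => ?_
    have h1 := h.abs_entry_le H x hr' i j
    have h2 := H.subsol.abs_entry_le H x hr' i j
    simp only [Matrix.add_apply, Matrix.smul_apply, smul_eq_mul]
    rw [abs_le] at *
    constructor <;> linarith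
  · rw [integral_const_mul, integral_const_mul]
    refine mul_le_mul_of_nonneg_left ?_ (by positivity)
    linarith [hEB r hr']

lemma StrongLimit.memLp_timeExtend (h : StrongLimit T Ω ebar v₀ u₀ q₀ V U w) {t : ℝ}
    (ht : t ∈ Icc 0 T) : MemLp (fun x => timeExtend T v₀ w x t) 2 volume := by
  by_cases ht' : t ∈ Ioo 0 T
  · simp only [timeExtend_of_mem ht']
    exact h.memLp ht'
  · simp only [timeExtend_of_notMem ht']
    exact h.background.weak.memLp t ht

lemma StrongLimit.tendsto_integral_sub (h : StrongLimit T Ω ebar v₀ u₀ q₀ V U w)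
    {ψ : Rn n → Rn n} (hψ : MemLp ψ 2 volume) {t : ℝ} (ht : t ∈ Icc 0 T) :
    Tendsto (fun k => ∫ x, inner ℝ (V k x t - v₀ x t) (ψ x)) atTop
      (𝓝 ((∫ x, inner ℝ (timeExtend T v₀ w x t) (ψ x)) - ∫ x, inner ℝ (v₀ x t) (ψ x))) := by
  have e : ∀ k, ∫ x, inner ℝ (V k x t - v₀ x t) (ψ x)
      = (∫ x, inner ℝ (V k x t) (ψ x)) - ∫ x, inner ℝ (v₀ x t) (ψ x) := fun k => by
    simp only [inner_sub_left]
    exact integral_sub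
      (integrable_inner_of_memLp (((h.subsol k).weak h.background).memLp t ht) hψ)
      (integrable_inner_of_memLp (h.background.weak.memLp t ht) hψ)
  simp only [e]
  refine Tendsto.sub_const ?_ _
  by_cases ht' : t ∈ Ioo 0 T
  · simp only [timeExtend_of_mem ht']
    exact tendsto_integral_inner (fun k => (h.subsol k).memLp h.background ht') (h.memLp ht') hψ
      (h.tendsto t ht')
  · simp only [timeExtend_of_notMem ht', (h.subsol _).eq_of_notMem _ ht']
    exact tendsto_const_nhds

lemma StrongLimit.exists_bound (h : StrongLimit T Ω ebar v₀ u₀ q₀ V U w) :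
    ∃ B, 0 ≤ B ∧ ∀ t ∈ Icc 0 T, ∫ x, ‖timeExtend T v₀ w x t‖ ^ 2 ≤ B := by
  obtain ⟨B, hB0, hB, hEB⟩ := h.background.exists_bound
  refine ⟨B, hB0, fun t ht => ?_⟩
  by_cases ht' : t ∈ Ioo 0 T
  · simp only [timeExtend_of_mem ht']
    rw [integral_norm_sq_eq_of_energy h.energy ht']
    exact hEB t ht'
  · simp only [timeExtend_of_notMem ht']
    exact hB _ _ h.background.subsol t ht

/-- Against smooth compactly supported fields, the Lipschitz bound for v − v₀ survives the limit,
endpoints included. General L² fields follow by approximation, uniformly in time because the energy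
is bounded. -/
lemma StrongLimit.continuousInL2w (h : StrongLimit T Ω ebar v₀ u₀ q₀ V U w) :
    ContinuousInL2w T (timeExtend T v₀ w) := by
  refine ⟨fun t ht => h.memLp_timeExtend ht, fun φ hφ => ?_⟩
  have hsmooth : ∀ ψ : Rn n → Rn n, ContDiff ℝ ∞ ψ → HasCompactSupport ψ →
      ContinuousOn (fun t => ∫ x, inner ℝ (timeExtend T v₀ w x t) (ψ x)) (Icc 0 T) := by
    intro ψ hψ hc
    have hψL : MemLp ψ 2 volume := hψ.continuous.memLp_of_hasCompactSupport hc
    obtain ⟨L, hL0, hL⟩ := h.background.exists_lipschitz hψ hc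
    set F : ℝ → ℝ := fun t => (∫ x, inner ℝ (timeExtend T v₀ w x t) (ψ x))
      - ∫ x, inner ℝ (v₀ x t) (ψ x) with hF
    have hlt : ∀ s ∈ Icc 0 T, ∀ t ∈ Icc 0 T, s < t → |F t - F s| ≤ L * (t - s) :=
      fun s hs t ht hst => le_of_tendsto
        ((h.tendsto_integral_sub hψL ht).sub (h.tendsto_integral_sub hψL hs)).abs
        (Eventually.of_forall fun k => hL _ _ (h.subsol k) s hs t ht hst)
    have hlip : LipschitzOnWith L.toNNReal F (Icc 0 T) := by
      refine LipschitzOnWith.of_dist_le_mul fun t ht s hs => ?_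
      rw [Real.coe_toNNReal _ hL0, Real.dist_eq, Real.dist_eq]
      rcases lt_trichotomy s t with hst | rfl | hst
      · rw [abs_of_pos (sub_pos.mpr hst)]
        exact hlt s hs t ht hst
      · simp
      · rw [abs_sub_comm, abs_sub_comm t s, abs_of_pos (sub_pos.mpr hst)]
        exact hlt t ht s hs hst
    refine (hlip.continuousOn.add (h.background.weak.continuous ψ hψL)).congr fun t ht => ?_
    simp [hF]
  obtain ⟨B, hB0, hB⟩ := h.exists_bound
  refine continuousOn_of_uniform_approx_of_continuousOn fun N hN => ?_
  obtain ⟨ε, hε, hεN⟩ := Metric.mem_uniformity_dist.mp hN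
  obtain ⟨ψ, hc, hψ, happ⟩ := hφ.exist_eLpNorm_sub_le (p := 2) (by simp) (by norm_num)
    (show 0 < ε / (√B + 1) by positivity)
  have hψL : MemLp ψ 2 volume := hψ.continuous.memLp_of_hasCompactSupport hc
  refine ⟨_, hsmooth ψ hψ hc, fun t ht => hεN ?_⟩
  have hw := h.memLp_timeExtend ht
  rw [Real.dist_eq, ← integral_sub (integrable_inner_of_memLp hw hφ)
    (integrable_inner_of_memLp hw hψL)]
  simp only [← inner_sub_right]
  refine (abs_integral_inner_le hw (hφ.sub hψL)).trans_lt ?_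
  rw [eLpNorm_eq_ofReal_sqrt (hφ.sub hψL), ENNReal.ofReal_le_ofReal_iff (by positivity)] at happ
  refine (mul_le_mul (Real.sqrt_le_sqrt (hB t ht)) happ (Real.sqrt_nonneg _)
    (Real.sqrt_nonneg _)).trans_lt ?_
  rw [mul_div_assoc', div_lt_iff₀ (by positivity)]
  nlinarith [Real.sqrt_nonneg B]

end WeakContinuity


/-! ### Infinitely many distinct limits. -/

section Multiplicity

variable {n : ℕ} {T : ℝ} {Ω : Set (Rn n)} {ebar : Rn n → ℝ → ℝ} {v₀ v : Rn n → ℝ → Rn n}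
  {u₀ u : Rn n → ℝ → Matrix (Fin n) (Fin n) ℝ} {q₀ : Rn n → ℝ → ℝ}

/-- Subsolutions can be interpolated with the reference subsolution. -/
lemma Subsolution.interpolate (h : Subsolution T Ω ebar v₀ u₀ q₀ v u)
    (H : Background T Ω ebar v₀ u₀ q₀) {c : ℝ} (hc : 0 ≤ c) (hc1 : c ≤ 1) :
    Subsolution T Ω ebar v₀ u₀ q₀ (fun x t => v₀ x t + c • (v x t + (-1 : ℝ) • v₀ x t))
      (fun x t => u₀ x t + c • (u x t + (-1 : ℝ) • u₀ x t)) where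
  sol := by
    have h1 := H.subsol.sol.add_smul (h.sol.add_smul H.subsol.sol (-1)) c
    simpa using h1
  eq_off_compact := by
    obtain ⟨K, hK, hKU, he⟩ := h.eq_off_compact
    refine ⟨K, hK, hKU, fun x t hx => ?_⟩
    obtain ⟨e1, e2⟩ := he x t hx
    rw [e1, e2]
    simp
  pos x hx t ht y hy := by
    have h0 := H.subsol.pos x hx t ht y hy
    have h1 := h.pos x hx t ht y hy
    rw [quad_gapMat] at h0 h1 ⊢
    simp only [quad_add_mat, quad_smul_mat, inner_add_left, real_inner_smul_left]
    set a : ℝ := inner ℝ (v₀ x t) y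
    set b : ℝ := inner ℝ (v x t) y
    -- Concavity of the gap form: the interpolated form exceeds the convex combination by exactly
    -- this term, because the square (v·y)² enters with a minus sign.
    have h2 : 0 ≤ c * (1 - c) * (b - a) ^ 2 := by
      have : 0 ≤ 1 - c := by linarith
      positivity
    rcases hc.eq_or_lt with rfl | hc
    · simpa using h0
    · have h3 := mul_pos hc h1
      have h4 := mul_nonneg (show 0 ≤ 1 - c by linarith) h0.le
      linarith

/-- There is a subsolution different from the reference one at a given time. -/
lemma Background.exists_ne (H : Background T Ω ebar v₀ u₀ q₀) (hne : Ω.Nonempty) {t : ℝ}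
    (ht : t ∈ Ioo 0 T) : ∃ v u, Subsolution T Ω ebar v₀ u₀ q₀ v u ∧
      0 < ∫ x, ‖v x t - v₀ x t‖ ^ 2 := by
  obtain ⟨x₀, hx₀⟩ := hne
  obtain ⟨r, hr, hrΩ⟩ := Metric.nhds_basis_closedBall.mem_iff.mp (H.isOpen.mem_nhds hx₀)
  -- A compact set concentrated at the single time t suffices, since the guaranteed gain is stated
  -- time by time.
  set C : Set (Rn n × ℝ) := Metric.closedBall x₀ r ×ˢ {t} with hC
  have hCc : IsCompact C := (isCompact_closedBall x₀ r).prod isCompact_singleton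
  have hCU : C ⊆ Ω ×ˢ Ioo 0 T := prod_mono hrΩ (singleton_subset_iff.mpr ht)
  have hslice : {x | (x, t) ∈ C} = Metric.closedBall x₀ r := by
    ext x
    simp [hC]
  have hi := H.subsol.integrable_gapDensity H hCc hCU ht
  have hgain : 0 < ∫ x in {x | (x, t) ∈ C}, gapDensity (ebar x t) (v₀ x t) := by
    have hpos : ∀ x ∈ Metric.closedBall x₀ r, 0 < gapDensity (ebar x t) (v₀ x t) := fun x hx =>
      div_pos (pow_pos (H.subsol.gap_pos H.pos (hrΩ hx) ht) 2)
        (H.subsol.two_mul_energy_pos H.pos (hrΩ hx) ht)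
    rw [hslice] at hi ⊢
    rw [setIntegral_pos_iff_support_of_nonneg_ae _ hi]
    · refine (Metric.measure_ball_pos volume x₀ hr).trans_le (measure_mono fun x hx => ?_)
      have hx' := Metric.ball_subset_closedBall hx
      exact ⟨(hpos x hx').ne', hx'⟩
    · filter_upwards [self_mem_ae_restrict Metric.isClosed_closedBall.measurableSet] with x hx
      exact (hpos x hx).le
  have hη := mul_pos (gainConst_pos H.pos) hgain
  -- Half of the guaranteed gain is allowed as error, so the perturbation is nonzero at time t; no
  -- weak smallness is needed.
  obtain ⟨v, u, hv, -, hvg⟩ := H.subsol.exists_perturbation H.two_le H.isOpen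
    H.continuousOn_energy hCc hCU (half_pos hη) [] (by simp)
  exact ⟨v, u, hv, by linarith [hvg t]⟩

/-- Infinitely many strong limits of subsolutions, pairwise distinct at time `T / 2`. -/
theorem Background.exists_strongLimits (H : Background T Ω ebar v₀ u₀ q₀) (hne : Ω.Nonempty) :
    ∃ w : ℕ → Rn n × ℝ → Rn n, (∀ i, ∃ V U, StrongLimit T Ω ebar v₀ u₀ q₀ V U (w i)) ∧
      ∀ i j, i < j → ¬ (fun x => w i (x, T / 2)) =ᵐ[volume] fun x => w j (x, T / 2) := by
  have ht : T / 2 ∈ Ioo 0 T := ⟨half_pos H.T_pos, half_lt_self H.T_pos⟩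
  obtain ⟨v, u, hv, hG⟩ := H.exists_ne hne ht
  set g : Rn n → ℝ → Rn n := fun x t => v x t + (-1 : ℝ) • v₀ x t with hg
  have hgv : ∀ x t, v x t - v₀ x t = g x t := fun x t => by simp [hg, sub_eq_add_neg]
  simp only [hgv] at hG
  set G := ∫ x, ‖g x (T / 2)‖ ^ 2 with hGdef
  have hgs : SmoothOnSlab T g := (hv.sol.add_smul H.subsol.sol (-1)).smooth_v
  have hgL : MemLp (fun x => g x (T / 2)) 2 volume := by
    simp only [← hgv]
    exact (hv.memLp H ht).sub (H.subsol.memLp H ht)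
  -- Start from v₀ + 2⁻ⁱ(v − v₀) with tolerance G2⁻ⁱ/8, a fixed fraction of the pairing 2⁻ⁱG that
  -- identifies i.
  have hex := fun i : ℕ => (hv.interpolate H (c := (1 / 2) ^ i) (by positivity)
    (pow_le_one₀ (by norm_num) (by norm_num))).exists_limit H hgs
      (show 0 < G * (1 / 2) ^ i / 8 by positivity)
  choose V U w hsub hmeas hlim hen hclose using hex
  have hS : ∀ i, StrongLimit T Ω ebar v₀ u₀ q₀ (V i) (U i) (w i) := fun i =>
    ⟨H, hsub i, hmeas i, hlim i, hen i⟩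
  refine ⟨w, fun i => ⟨V i, U i, hS i⟩, fun i j hij hEq => ?_⟩
  have hv₀L := H.subsol.memLp H ht
  have key : ∀ i, |(∫ x, inner ℝ (w i (x, T / 2)) (g x (T / 2)))
      - (∫ x, inner ℝ (v₀ x (T / 2)) (g x (T / 2))) - (1 / 2) ^ i * G| ≤ G * (1 / 2) ^ i / 8 := by
    intro i
    have h1 := hclose i (T / 2) ht hgL
    have hwL := (hS i).memLp ht
    have hi := (integrable_inner_of_memLp hgL hgL).const_mul ((1 / 2) ^ i)
    have e : ∀ x, inner ℝ (w i (x, T / 2) - (v₀ x (T / 2) + (1 / 2 : ℝ) ^ i •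
        (v x (T / 2) + (-1 : ℝ) • v₀ x (T / 2)))) (g x (T / 2))
        = inner ℝ (w i (x, T / 2)) (g x (T / 2)) - inner ℝ (v₀ x (T / 2)) (g x (T / 2))
          - (1 / 2 : ℝ) ^ i * inner ℝ (g x (T / 2)) (g x (T / 2)) := fun x => by
      rw [inner_sub_left, inner_add_left, real_inner_smul_left]
      ring
    simp only [e] at h1
    have hi1 := integrable_inner_of_memLp hwL hgL
    have hi2 := integrable_inner_of_memLp hv₀L hgL
    have hi3 : Integrable fun x => inner ℝ (w i (x, T / 2)) (g x (T / 2))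
      - inner ℝ (v₀ x (T / 2)) (g x (T / 2)) := hi1.sub hi2
    rw [integral_sub hi3 hi, integral_sub hi1 hi2, integral_const_mul] at h1
    simpa only [real_inner_self_eq_norm_sq] using h1
  have hEq' : ∫ x, inner ℝ (w i (x, T / 2)) (g x (T / 2))
      = ∫ x, inner ℝ (w j (x, T / 2)) (g x (T / 2)) := by
    refine integral_congr_ae ?_
    filter_upwards [hEq] with x hx
    rw [hx]
  -- Equal pairings would give (7/8)2⁻ⁱG ≤ (9/8)2⁻ʲG ≤ (9/16)2⁻ⁱG, which is impossible for G > 0.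
  have hi := (abs_le.mp (key i)).1
  have hj := (abs_le.mp (key j)).2
  rw [hEq'] at hi
  have hpow : (1 / 2 : ℝ) ^ j ≤ (1 / 2) ^ i * (1 / 2) := by
    rw [← pow_succ]
    exact pow_le_pow_of_le_one (by norm_num) (by norm_num) hij
  have hpos : 0 < G * (1 / 2) ^ i := by positivity
  have := mul_le_mul_of_nonneg_left hpow hG.le
  linarith

end Multiplicity

end Euler

end

/-! ### The main theorem. -/

theorem mainTheorem3 (n : ℕ) (hn : 2 ≤ n) (T : ℝ) (hT : 0 < T)
    (Ω : Set (Euler.Rn n)) (hΩ : IsOpen Ω) (hΩne : Ω.Nonempty)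
    (ebar : Euler.Rn n → ℝ → ℝ)
    (hebar : ContinuousOn (fun p : Euler.Rn n × ℝ => ebar p.1 p.2) (closure Ω ×ˢ Ioo 0 T))
    (hebarL1 : Euler.ContinuousInL1 T Ω ebar)
    (v₀ : Euler.Rn n → ℝ → Euler.Rn n)
    (u₀ : Euler.Rn n → ℝ → Matrix (Fin n) (Fin n) ℝ)
    (q₀ : Euler.Rn n → ℝ → ℝ)
    (hsol : Euler.IsSmoothLinearSolution T v₀ u₀ q₀)
    (hv₀ : Euler.ContinuousInL2w T v₀)
    (hsupp : ∀ t ∈ Ioo 0 T, IsCompact (tsupport fun x => (v₀ x t, u₀ x t)) ∧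
      (tsupport fun x => (v₀ x t, u₀ x t)) ⊆ Ω)
    (henergy : ∀ x ∈ Ω, ∀ t ∈ Ioo 0 T, Euler.genEnergy (v₀ x t) (u₀ x t) < ebar x t) :
    ∃ S : Set (Euler.Rn n → ℝ → Euler.Rn n),
      S.Infinite ∧
      -- distinct members of `S` are distinct as elements of `C([0,T]; L²_w)`
      (S.Pairwise fun v w => ∃ t ∈ Ioo 0 T, ¬ (fun x => v x t) =ᵐ[volume] fun x => w x t) ∧
      ∀ v ∈ S,
        Euler.IsWeakSolution T (fun x => v₀ x 0) v ∧
        Euler.HasPressure T v (fun x t => q₀ x t - 1 / (n : ℝ) * ‖v x t‖ ^ 2) ∧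
        Euler.ContinuousInL2w T v ∧
        (∀ᵐ x, v x 0 = v₀ x 0) ∧
        (∀ᵐ x, v x T = v₀ x T) ∧
        (∀ t ∈ Ioo 0 T, ∀ᵐ x,
          1 / 2 * ‖v x t‖ ^ 2 = Ω.indicator (fun y => ebar y t) x) := by
  have H : Euler.Background T Ω ebar v₀ u₀ q₀ :=
    { two_le := hn
      T_pos := hT
      isOpen := hΩ
      continuousOn_energy := hebar.mono (prod_mono subset_closure le_rfl)
      energy := hebarL1
      weak := hv₀
      support := fun t ht => (hsupp t ht).2
      subsol :=
        { sol := hsol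
          eq_off_compact := ⟨∅, isCompact_empty, empty_subset _, fun _ _ _ => ⟨rfl, rfl⟩⟩
          pos := fun x hx t ht y hy => Euler.quad_gapMat_pos_of_genEnergy_lt (by omega)
            (hsol.symm x t ht) (henergy x hx t ht) hy } }
  obtain ⟨w, hw, hdist⟩ := H.exists_strongLimits hΩne
  have ht : T / 2 ∈ Ioo 0 T := ⟨half_pos hT, half_lt_self hT⟩
  have hne : ∀ i j, i ≠ j → ¬ (fun x => Euler.timeExtend T v₀ (w i) x (T / 2))
      =ᵐ[volume] fun x => Euler.timeExtend T v₀ (w j) x (T / 2) := by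
    intro i j hij
    simp only [Euler.timeExtend_of_mem ht]
    rcases lt_or_gt_of_ne hij with h | h
    · exact hdist i j h
    · exact fun he => hdist j i h he.symm
  refine ⟨range fun i => Euler.timeExtend T v₀ (w i), infinite_range_of_injective ?_, ?_, ?_⟩
  · intro i j hij
    by_contra h
    refine hne i j h ?_
    simp only at hij
    rw [hij]
  · rintro _ ⟨i, rfl⟩ _ ⟨j, rfl⟩ hij
    exact ⟨T / 2, ht, hne i j fun h => hij (by rw [h])⟩
  · rintro _ ⟨i, rfl⟩
    obtain ⟨V, U, hS⟩ := hw i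
    refine ⟨hS.isWeakSolution, hS.hasPressure, hS.continuousInL2w,
      Eventually.of_forall fun x => Euler.timeExtend_of_notMem (fun h => lt_irrefl _ h.1) x,
      Eventually.of_forall fun x => Euler.timeExtend_of_notMem (fun h => lt_irrefl _ h.2) x,
      fun t ht => ?_⟩
    filter_upwards [hS.energy t ht] with x hx
    rw [Euler.timeExtend_of_mem ht, hx, Euler.extEnergy]
    ring
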